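/- **Setting.** Let $\Im=\mathbb R\times\mathbb S^2$ with points $(u,s)$, where $\mathbb S^2\subset\mathbb R^3$ is the unit sphere with its rotation-invariant measure $\mu_{\mathbb S^2}$ of total mass $4\pi$. For a bounded function $\psi$ let $\widehat\psi(k,s)=\frac1{\sqrt{2\pi}}\int_{\mathbb R}e^{iku}\psi(u,s)\,du$ denote its distributional Fourier transform in the $\mathbb R$-direction. Let $\mathcal S_c(\Im)$ be the real vector space of bounded real functions $\psi\in C^\infty(\Im)$ such that $\partial_u\psi\in L^1(du\,d\mu_{\mathbb S^2})$, $\widehat\psi\in L^1(dk\,d\mu_{\mathbb S^2})$ and $k\widehat\psi\in L^\infty$. On it put the symplectic form and the scalar product $$\sigma(\psi,\psi')=\int_{\Im}\big(\psi\,\partial_u\psi'-\psi'\,\partial_u\psi\big)\,du\,d\mu_{\mathbb S^2},\qquad \mu(\psi,\psi')=\operatorname{Re}\int_{\mathbb S^2}\int_0^\infty 2k\,\overline{\widehat\psi(k,s)}\,\widehat{\psi'}(k,s)\,dk\,d\mu_{\mathbb S^2}(s).$$ The algebra $\mathcal A_c(\Im)$ is the unital complex $*$-algebra generated by elements $[\psi]$,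 $\psi\in\mathcal S_c(\Im)$, which are real-linear in $\psi$ and satisfy $[\psi]^*=[\psi]$ and $[\psi][\psi']-[\psi'][\psi]=i\sigma(\psi,\psi')1$ (the complex universal tensor algebra of $\mathcal S_c(\Im)$ modulo the two-sided ideal generated by the commutation relations). The horizon symmetry group $SG_{\Im^-}$ consists of the maps $F_{(a,b,R)}(u,s)=(e^{a(s)}u+b(s),Rs)$ with $a,b\in C^\infty(\mathbb S^2)$ and $R\in SO(3)$, under composition. It acts on $\mathcal A_c(\Im)$ by the $*$-automorphisms $\widetilde\alpha_h$ determined by $\widetilde\alpha_h[\psi]=[\psi\circ h^{-1}]$. A (compatible) Bondi frame is a coordinate system $(u',s')=B(u,s)$ with $B=F_{(0,b,R)}$; its $u'$-translations are the one-parameter group $B^{-1}\circ T_t\circ B$, $T_t(u,s)=(u+t,s)$, and $\widetilde\alpha_t$ denotes the corresponding automorphisms. A state is a linear functional $\omega$ on $\mathcal A_c(\Im)$ with $\omega(1)=1$ and $\omega(x^*x)\ge 0$ for all $x$. It is quasi-free if $\omega([\psi_1]\cdots[\psi_n])=0$ for odd $n$ and, for even $n$, $\omega([\psi_1]\cdots[\psi_n])=\sum\prod_{\{i<j\}}\omega([\psi_i][\psi_j])$,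 the sum running over all partitions of $\{1,\dots,n\}$ into pairs and the product over the pairs of the partition. A GNS quadruple of $\omega$ is $(H,D,\pi,\Omega)$ with $H$ a complex Hilbert space, $D$ a dense subspace, $\pi$ a representation of $\mathcal A_c(\Im)$ on $D$ with $\langle\pi(x^*)v,w\rangle=\langle v,\pi(x)w\rangle$, $\Omega\in D$ a unit vector, $D=\pi(\mathcal A_c(\Im))\Omega$ and $\omega(x)=\langle\Omega,\pi(x)\Omega\rangle$. The one-particle space $H^{(1)}$ is the closed complex span of the vectors $\pi([\psi])\Omega$. A unitary $V$ implements an automorphism $\beta$ and fixes the cyclic vector if $VD=D$, $V\Omega=\Omega$ and $V\pi(x)V^{-1}=\pi(\beta(x))$ on $D$ for all $x$. The generator of a strongly continuous one-parameter unitary group $(U_t)$ is the self-adjoint operator $G$ with $U_t=e^{itG}$. **Theorem.** There is exactly one quasi-free state $\omega_{\Im_c}$ on $\mathcal A_c(\Im)$ with two-point function $\omega_{\Im_c}([\psi][\psi'])=\mu(\psi,\psi')+\frac i2\sigma(\psi,\psi')$; it has a GNS quadruple, and the following holds. (a) $\omega_{\Im_c}\circ\widetilde\alpha_h=\omega_{\Im_c}$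 for all $h\in SG_{\Im^-}$. In each GNS quadruple of $\omega_{\Im_c}$ there is a unitary representation of $SG_{\Im^-}$ that implements $\widetilde\alpha$ and fixes the cyclic vector. (b) For every Bondi frame as above and every GNS quadruple of $\omega_{\Im_c}$, the group $(\widetilde\alpha_t)_{t\in\mathbb R}$ of $u'$-translations is implemented by a strongly continuous one-parameter unitary group that fixes the cyclic vector and has nonnegative generator; the restriction of the generator to the one-particle space has no zero eigenvalue. (c) Fix any Bondi frame as above. Let $\omega$ be a quasi-free state on $\mathcal A_c(\Im)$ such that, in some GNS quadruple of $\omega$, $(\widetilde\alpha_t)_{t\in\mathbb R}$ is implemented by a strongly continuous one-parameter unitary group that fixes the cyclic vector, has nonnegative generator, and whose generator restricted to the one-particle space has no zero eigenvalue. Then $\omega=\omega_{\Im_c}$. Hence $\omega_{\Im_c}$ is the unique quasi-free state with this property. -/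

import Mathlib

open MeasureTheory Complex
open scoped Manifold ContDiff SchwartzMap TensorProduct InnerProductSpace Pointwise ComplexOrder

namespace CosmoHorizon

abbrev E3 := EuclideanSpace ℝ (Fin 3)
/-- The unit sphere, with the manifold structure that Mathlib puts on it. -/
abbrev S2 := Metric.sphere (0 : E3) 1
/-- The boundary `ℝ × S²`, with points `(u, s)`. -/
abbrev Scri := ℝ × S2

noncomputable section

/-- The measure `du dμ_{S²}` (also used as `dk dμ_{S²}`); `toSphere` of Lebesgue measure is the
rotation invariant measure of total mass `4π`. -/
def scriMeasure : Measure Scri := (volume : Measure ℝ).prod (volume : Measure E3).toSphere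

/-- The derivative `∂_u ψ`. -/
def duDeriv (ψ : Scri → ℝ) (p : Scri) : ℝ := deriv (fun v => ψ (v, p.2)) p.1

/-- `(2π)^{-1/2} ∫ e^{iku} f(u) du`, used on Schwartz functions `f`. -/
def fourierU (f : ℝ → ℂ) (k : ℝ) : ℂ :=
  ∫ u : ℝ, Complex.exp (Complex.I * k * u) * f u / (Real.sqrt (2 * Real.pi) : ℂ)

/-- The function `g` is the distributional Fourier transform of `ψ` in the direction `ℝ`: for almost
every `s`, the tempered distribution `ψ(·, s)` has Fourier transform `g(·, s)`. -/
def IsFourierU (ψ : Scri → ℝ) (g : Scri → ℂ) : Prop :=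
  ∀ᵐ s ∂(volume : Measure E3).toSphere, ∀ f : 𝓢(ℝ, ℂ),
    ∫ u : ℝ, (ψ (u, s) : ℂ) * fourierU f u = ∫ k : ℝ, g (k, s) * f k

/-- `g` represents the distribution `ψ̂`, it is in `L¹`, and `k g` is in `L^∞`. -/
structure IsGoodFourier (ψ : Scri → ℝ) (g : Scri → ℂ) : Prop where
  isFourier : IsFourierU ψ g
  integrable : Integrable g scriMeasure
  bounded : ∃ C : ℝ, ∀ᵐ p ∂scriMeasure, ‖(p.1 : ℂ) * g p‖ ≤ C

/-- Membership in `S_c`: `ψ` is smooth and bounded, `∂_u ψ` is in `L¹`, the Fourier transform `ψ̂` is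
(represented by) a function in `L¹`, and `k ψ̂` is in `L^∞`. -/
structure MemSc (ψ : Scri → ℝ) : Prop where
  smooth : ContMDiff (𝓘(ℝ, ℝ).prod (𝓡 2)) 𝓘(ℝ, ℝ) ∞ ψ
  bounded : ∃ C : ℝ, ∀ p, |ψ p| ≤ C
  integrable : Integrable (duDeriv ψ) scriMeasure
  fourier : ∃ g, IsGoodFourier ψ g

theorem fourierU_integrable (f : 𝓢(ℝ, ℂ)) : Integrable (fourierU f) := by
  have h : fourierU f = fun k => (Real.sqrt (2 * Real.pi) : ℂ)⁻¹ *
      (FourierTransformInv.fourierInv f : 𝓢(ℝ, ℂ)) ((2 * Real.pi)⁻¹ * k) := by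
    funext k
    rw [SchwartzMap.fourierInv_coe, Real.fourierInv_eq', fourierU, ← integral_const_mul]
    refine integral_congr_ae (.of_forall fun u => ?_)
    have hpi : (Real.pi : ℂ) ≠ 0 := by exact_mod_cast Real.pi_ne_zero
    have : Complex.I * k * u = ((2 * Real.pi * inner ℝ u ((2 * Real.pi)⁻¹ * k) : ℝ) : ℂ) * Complex.I := by
      simp; field_simp
    simp only [this, smul_eq_mul]
    ring
  rw [h]
  exact ((SchwartzMap.integrable _).comp_mul_left' (by positivity)).const_mul _

theorem bddInt {ψ : Scri → ℝ} (h : MemSc ψ) (s : S2) (f : 𝓢(ℝ, ℂ)) :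
    Integrable (fun u : ℝ => (ψ (u, s) : ℂ) * fourierU f u) := by
  obtain ⟨C, hC⟩ := h.bounded
  refine (fourierU_integrable f).bdd_mul (c := C) ?_ ?_
  · have : Continuous ψ := h.smooth.continuous
    exact (by fun_prop : Continuous fun u : ℝ => (ψ (u, s) : ℂ)).aestronglyMeasurable
  · exact .of_forall fun u => by simpa using hC (u, s)

theorem sliceInt {g : Scri → ℂ} (h : Integrable g scriMeasure) :
    ∀ᵐ s ∂(volume : Measure E3).toSphere, ∀ f : 𝓢(ℝ, ℂ), Integrable fun k : ℝ => g (k, s) * f k := by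
  filter_upwards [h.prod_left_ae] with s hs f
  exact hs.mul_bdd (c := SchwartzMap.seminorm ℝ 0 0 f) f.continuous.aestronglyMeasurable
    (.of_forall fun k => SchwartzMap.norm_le_seminorm ℝ f k)

theorem slice_diff {ψ : Scri → ℝ} (h : ContMDiff (𝓘(ℝ, ℝ).prod (𝓡 2)) 𝓘(ℝ, ℝ) ∞ ψ) (s : S2) :
    Differentiable ℝ fun u : ℝ => ψ (u, s) := by
  have : ContMDiff 𝓘(ℝ, ℝ) (𝓘(ℝ, ℝ).prod (𝓡 2)) ∞ (fun u : ℝ => ((u, s) : Scri)) :=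
    contMDiff_id.prodMk contMDiff_const
  exact ((h.comp this).contDiff).differentiable (by simp)

/-- The real vector space `S_c` of real functions on `ℝ × S²`. -/
def Sc : Submodule ℝ (Scri → ℝ) where
  carrier := {ψ | MemSc ψ}
  zero_mem' := by
    refine ⟨contMDiff_const, ⟨0, by simp⟩, ?_, 0, ?_, integrable_zero _ _ _, 0, ?_⟩
    · have : duDeriv 0 = 0 := by funext p; simp [duDeriv]
      rw [this]; exact integrable_zero _ _ _
    · exact .of_forall fun s f => by simp
    · exact .of_forall fun p => by simp
  add_mem' := by
    rintro φ ψ hφ hψ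
    obtain ⟨C, hC⟩ := hφ.bounded
    obtain ⟨D, hD⟩ := hψ.bounded
    obtain ⟨g, hg1, hg2, A, hA⟩ := hφ.fourier
    obtain ⟨h, hh1, hh2, B, hB⟩ := hψ.fourier
    refine ⟨hφ.smooth.add hψ.smooth, ⟨C + D, fun p => ?_⟩, ?_, g + h, ?_, hg2.add hh2, A + B, ?_⟩
    · exact (abs_add_le _ _).trans (add_le_add (hC p) (hD p))
    · have : duDeriv (φ + ψ) = duDeriv φ + duDeriv ψ := by
        funext p
        exact deriv_add (slice_diff hφ.smooth p.2 p.1) (slice_diff hψ.smooth p.2 p.1)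
      rw [this]; exact hφ.integrable.add hψ.integrable
    · filter_upwards [hg1, hh1, sliceInt hg2, sliceInt hh2] with s h1 h2 h3 h4 f
      simp only [Pi.add_apply, ofReal_add, add_mul]
      rw [integral_add (bddInt hφ s f) (bddInt hψ s f), integral_add (h3 f) (h4 f), h1, h2]
    · filter_upwards [hA, hB] with p h1 h2
      rw [Pi.add_apply, mul_add]
      exact (norm_add_le _ _).trans (add_le_add h1 h2)
  smul_mem' := by
    rintro c ψ hψ
    obtain ⟨C, hC⟩ := hψ.bounded
    obtain ⟨g, hg1, hg2, A, hA⟩ := hψ.fourier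
    refine ⟨(contMDiff_const (c := c)).mul hψ.smooth, ⟨|c| * C, fun p => ?_⟩, ?_,
      fun p => (c : ℂ) * g p, ?_, hg2.const_mul _, |c| * A, ?_⟩
    · simpa [abs_mul] using mul_le_mul_of_nonneg_left (hC p) (abs_nonneg c)
    · have : duDeriv (c • ψ) = fun p => c * duDeriv ψ p := by
        funext p
        exact deriv_const_mul c (slice_diff hψ.smooth p.2 p.1)
      rw [this]; exact hψ.integrable.const_mul c
    · filter_upwards [hg1] with s h1 f
      simp only [Pi.smul_apply, smul_eq_mul, ofReal_mul, mul_assoc]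
      rw [integral_const_mul, integral_const_mul, h1]
    · filter_upwards [hA] with p h1
      rw [mul_left_comm, norm_mul]
      simpa using mul_le_mul_of_nonneg_left h1 (abs_nonneg c)

/-! ## The horizon symmetry group -/

/-- Rotations of `ℝ³`. -/
def SO3 : Subgroup (E3 ≃ₗᵢ[ℝ] E3) where
  carrier := {R | LinearMap.det (R.toLinearEquiv : E3 →ₗ[ℝ] E3) = 1}
  one_mem' := LinearMap.det_id
  mul_mem' := by
    intro R R' h h'
    have : ((R * R').toLinearEquiv : E3 →ₗ[ℝ] E3) =
      (R.toLinearEquiv : E3 →ₗ[ℝ] E3) ∘ₗ (R'.toLinearEquiv : E3 →ₗ[ℝ] E3) := rfl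
    simp only [Set.mem_ofPred_eq] at *
    rw [this, LinearMap.det_comp, h, h', one_mul]
  inv_mem' := by
    intro R h
    simp only [Set.mem_ofPred_eq] at *
    have h2 : LinearMap.det (((R⁻¹).toLinearEquiv : E3 →ₗ[ℝ] E3) ∘ₗ (R.toLinearEquiv : E3 →ₗ[ℝ] E3)) = 1 := by
      have : ((R⁻¹).toLinearEquiv : E3 →ₗ[ℝ] E3) ∘ₗ (R.toLinearEquiv : E3 →ₗ[ℝ] E3) = LinearMap.id := by
        ext1 x; exact R.symm_apply_apply x
      rw [this, LinearMap.det_id]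
    rwa [LinearMap.det_comp, h, mul_one] at h2

/-- Action of a linear isometry of `ℝ³` on the unit sphere. -/
def rot (R : E3 ≃ₗᵢ[ℝ] E3) (s : S2) : S2 := ⟨R s, by simp⟩

theorem rot_smooth (R : E3 ≃ₗᵢ[ℝ] E3) : ContMDiff (𝓡 2) (𝓡 2) ∞ (rot R) := by
  have : Fact (Module.finrank ℝ E3 = 2 + 1) := ⟨by simp⟩
  refine ContMDiff.codRestrict_sphere (f := fun s : S2 => R s) ?_ _
  exact R.toContinuousLinearEquiv.contDiff.contMDiff.comp contMDiff_coe_sphere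

theorem rot_rot (R R' : E3 ≃ₗᵢ[ℝ] E3) (s : S2) : rot R (rot R' s) = rot (R * R') s := rfl
theorem rot_inv (R : E3 ≃ₗᵢ[ℝ] E3) (s : S2) : rot R⁻¹ (rot R s) = s :=
  Subtype.ext (R.symm_apply_apply s)
theorem rot_inv' (R : E3 ≃ₗᵢ[ℝ] E3) (s : S2) : rot R (rot R⁻¹ s) = s :=
  Subtype.ext (R.apply_symm_apply s)

theorem rot_mp (R : E3 ≃ₗᵢ[ℝ] E3) :
    MeasurePreserving (rot R) (volume : Measure E3).toSphere (volume : Measure E3).toSphere := by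
  have hm (R : E3 ≃ₗᵢ[ℝ] E3) : Measurable (rot R) := (rot_smooth R).continuous.measurable
  refine ⟨hm R, Measure.ext fun t ht => ?_⟩
  rw [Measure.map_apply (hm R) ht, Measure.toSphere_apply' _ ht, Measure.toSphere_apply' _ (hm R ht)]
  congr 1
  have hset : (Set.Ioo (0:ℝ) 1 • (Subtype.val '' (rot R ⁻¹' t)) : Set E3) =
      R ⁻¹' (Set.Ioo (0:ℝ) 1 • (Subtype.val '' t)) := by
    ext x
    simp only [Set.mem_smul, Set.mem_image, Set.mem_preimage]
    constructor
    · rintro ⟨r, hr, _, ⟨y, hy, rfl⟩, rfl⟩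
      exact ⟨r, hr, _, ⟨_, hy, rfl⟩, by simp [rot]⟩
    · rintro ⟨r, hr, _, ⟨y, hy, rfl⟩, h⟩
      refine ⟨r, hr, _, ⟨rot R⁻¹ y, by rwa [rot_inv'], rfl⟩, ?_⟩
      apply R.injective
      rw [← h, map_smul]
      congr 1
      exact R.apply_symm_apply _
  rw [hset]
  exact R.measurePreserving.measure_preimage_emb R.toHomeomorph.measurableEmbedding _

abbrev IsSmoothS2 (a : S2 → ℝ) : Prop := ContMDiff (𝓡 2) 𝓘(ℝ, ℝ) ∞ a

/-- `F_{(a,b,R)} (u, s) = (exp(a(s)) u + b(s), R s)`. -/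
def horizonMap (a b : S2 → ℝ) (R : E3 ≃ₗᵢ[ℝ] E3) (p : Scri) : Scri :=
  (Real.exp (a p.2) * p.1 + b p.2, rot R p.2)

/-- The horizon symmetry group: all `F_{(a,b,R)}` with `a, b` smooth on `S²` and `R` in `SO(3)`; the
group law is composition. -/
def SG : Subgroup (Equiv.Perm Scri) where
  carrier := {F | ∃ a b : S2 → ℝ, ∃ R ∈ SO3, IsSmoothS2 a ∧ IsSmoothS2 b ∧ ⇑F = horizonMap a b R}
  one_mem' := ⟨0, 0, 1, one_mem _, contMDiff_const, contMDiff_const, by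
    funext p; simp [horizonMap, rot]⟩
  mul_mem' := by
    rintro F F' ⟨a, b, R, hR, ha, hb, hF⟩ ⟨a', b', R', hR', ha', hb', hF'⟩
    refine ⟨fun s => a' s + a (rot R' s), fun s => Real.exp (a (rot R' s)) * b' s + b (rot R' s),
      R * R', mul_mem hR hR', ?_, ?_, ?_⟩
    · exact ha'.add (ha.comp (rot_smooth R'))
    · exact ((Real.contDiff_exp.contMDiff.comp (ha.comp (rot_smooth R'))).mul hb').add
        (hb.comp (rot_smooth R'))
    · funext p
      simp only [Equiv.Perm.coe_mul, Function.comp, hF, hF', horizonMap, rot_rot, Real.exp_add]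
      exact Prod.ext (by ring) rfl
  inv_mem' := by
    rintro F ⟨a, b, R, hR, ha, hb, hF⟩
    have h1 := ha.comp (rot_smooth R⁻¹)
    have h2 := hb.comp (rot_smooth R⁻¹)
    refine ⟨fun s => -a (rot R⁻¹ s), fun s => -(Real.exp (-a (rot R⁻¹ s)) * b (rot R⁻¹ s)),
      R⁻¹, inv_mem hR, h1.neg, ((Real.contDiff_exp.contMDiff.comp h1.neg).mul h2).neg, ?_⟩
    funext p
    rw [Equiv.Perm.inv_eq_iff_eq, hF]
    refine Prod.ext ?_ (rot_inv' R _).symm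
    simp only [horizonMap]
    have : Real.exp (a (rot R⁻¹ p.2)) * Real.exp (-a (rot R⁻¹ p.2)) = 1 := by
      rw [← Real.exp_add]; simp
    linear_combination (b (rot R⁻¹ p.2) - p.1) * this

theorem horizonMap_smooth {a b : S2 → ℝ} (ha : IsSmoothS2 a) (hb : IsSmoothS2 b) (R : E3 ≃ₗᵢ[ℝ] E3) :
    ContMDiff (𝓘(ℝ, ℝ).prod (𝓡 2)) (𝓘(ℝ, ℝ).prod (𝓡 2)) ∞ (horizonMap a b R) := by
  refine ContMDiff.prodMk ?_ ((rot_smooth R).comp contMDiff_snd)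
  exact ((Real.contDiff_exp.contMDiff.comp (ha.comp contMDiff_snd)).mul contMDiff_fst).add
    (hb.comp contMDiff_snd)

/-- Change of variables: `exp(a) du dμ` is carried by `F_{a,b,R}` to `du dμ`. -/
theorem map_horizonMap {a b : S2 → ℝ} (ha : IsSmoothS2 a) (hb : IsSmoothS2 b) (R : E3 ≃ₗᵢ[ℝ] E3) :
    MeasurePreserving (horizonMap a b R)
      (scriMeasure.withDensity fun p => ((Real.exp (a p.2)).toNNReal : ENNReal)) scriMeasure := by
  have hm : Measurable (horizonMap a b R) := (horizonMap_smooth ha hb R).continuous.measurable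
  have hac : Continuous a := ha.continuous
  have hbc : Continuous b := hb.continuous
  refine ⟨hm, Measure.ext fun t ht => ?_⟩
  have hd : Measurable fun p : Scri => ((Real.exp (a p.2)).toNNReal : ENNReal) := by fun_prop
  rw [Measure.map_apply hm ht, withDensity_apply _ (hm ht), ← lintegral_indicator (hm ht),
    ← lintegral_indicator_one ht, scriMeasure, lintegral_prod_symm' _ (hd.indicator (hm ht)),
    lintegral_prod_symm' _ (measurable_one.indicator ht)]
  have hg : Measurable fun s : S2 => ∫⁻ u : ℝ, t.indicator (1 : Scri → ENNReal) (u, s) :=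
    Measurable.lintegral_prod_left' (measurable_one.indicator ht)
  rw [← (rot_mp R).lintegral_comp hg]
  refine lintegral_congr fun s => ?_
  have hc : Real.exp (a s) ≠ 0 := (Real.exp_pos _).ne'
  have key := Real.smul_map_volume_mul_left hc
  have h1 : ∀ u : ℝ, (horizonMap a b R ⁻¹' t).indicator
      (fun p : Scri => ((Real.exp (a p.2)).toNNReal : ENNReal)) (u, s) =
      ENNReal.ofReal (Real.exp (a s)) *
        t.indicator (1 : Scri → ENNReal) (Real.exp (a s) * u + b s, rot R s) := by
    intro u
    by_cases h : horizonMap a b R (u, s) ∈ t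
    · rw [Set.indicator_of_mem (by exact h), Set.indicator_of_mem (by exact h)]
      simp [ENNReal.ofReal]
    · rw [Set.indicator_of_notMem (by exact h), Set.indicator_of_notMem (by exact h)]
      simp
  have hf : Measurable fun u : ℝ => t.indicator (1 : Scri → ENNReal) (u, rot R s) :=
    (measurable_one.indicator ht).comp (by fun_prop)
  have hf' : Measurable fun u : ℝ => t.indicator (1 : Scri → ENNReal) (u + b s, rot R s) :=
    (measurable_one.indicator ht).comp (by fun_prop)
  simp_rw [h1]
  have hf2 : Measurable fun u : ℝ =>
      t.indicator (1 : Scri → ENNReal) (Real.exp (a s) * u + b s, rot R s) :=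
    (measurable_one.indicator ht).comp (by fun_prop)
  rw [lintegral_const_mul _ hf2,
    ← lintegral_add_right_eq_self (fun u : ℝ => t.indicator (1 : Scri → ENNReal) (u, rot R s)) (b s)]
  conv_rhs => rw [← key]
  rw [lintegral_smul_measure, lintegral_map hf' (by fun_prop), abs_of_pos (Real.exp_pos _)]
  rfl

theorem ae_horizonMap {a b : S2 → ℝ} (ha : IsSmoothS2 a) (hb : IsSmoothS2 b) (R : E3 ≃ₗᵢ[ℝ] E3)
    {P : Scri → Prop} (hP : ∀ᵐ p ∂scriMeasure, P p) :
    ∀ᵐ p ∂scriMeasure, P (horizonMap a b R p) := by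
  have hac : Continuous a := ha.continuous
  have h := (map_horizonMap ha hb R).quasiMeasurePreserving.ae hP
  refine (withDensity_absolutelyContinuous' ?_ ?_).ae_le h
  · exact Measurable.aemeasurable (by fun_prop)
  · exact .of_forall fun p => by simp [Real.exp_pos]

theorem integrable_horizonMap {F : Type*} [NormedAddCommGroup F] [NormedSpace ℝ F]
    {a b : S2 → ℝ} (ha : IsSmoothS2 a) (hb : IsSmoothS2 b) (R : E3 ≃ₗᵢ[ℝ] E3) {f : Scri → F}
    (hf : Integrable f scriMeasure) :
    Integrable (fun p => Real.exp (a p.2) • f (horizonMap a b R p)) scriMeasure := by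
  have hac : Continuous a := ha.continuous
  have h := (map_horizonMap ha hb R).integrable_comp_of_integrable hf
  rw [integrable_withDensity_iff_integrable_smul (by fun_prop)] at h
  refine h.congr (.of_forall fun p => ?_)
  simp [NNReal.smul_def, (Real.exp_pos _).le]

theorem integral_horizonMap {F : Type*} [NormedAddCommGroup F] [NormedSpace ℝ F]
    {a b : S2 → ℝ} (ha : IsSmoothS2 a) (hb : IsSmoothS2 b) {R : E3 ≃ₗᵢ[ℝ] E3}
    (hbij : Function.Bijective (horizonMap a b R)) (f : Scri → F) :
    ∫ p, Real.exp (a p.2) • f (horizonMap a b R p) ∂scriMeasure = ∫ p, f p ∂scriMeasure := by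
  have hac : Continuous a := ha.continuous
  have hemb : MeasurableEmbedding (horizonMap a b R) :=
    (horizonMap_smooth ha hb R).continuous.measurableEmbedding hbij.1
  conv_rhs => rw [← (map_horizonMap ha hb R).integral_comp hemb]
  rw [integral_withDensity_eq_integral_smul (by fun_prop)]
  refine integral_congr_ae (.of_forall fun p => ?_)
  simp [NNReal.smul_def, (Real.exp_pos _).le]

theorem norm_phase (x y : ℝ) : ‖Complex.exp (-(Complex.I * x * y))‖ = 1 := by
  rw [Complex.norm_exp]; simp

theorem temperate_cexp (c : ℝ) :
    Function.HasTemperateGrowth fun k : ℝ => Complex.exp (-(Complex.I * k * c)) := by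
  have hs : ContDiff ℝ ∞ fun k : ℝ => Complex.exp (-(Complex.I * k * c)) :=
    ((contDiff_const.mul Complex.ofRealCLM.contDiff).mul contDiff_const).neg.cexp
  have hn (n : ℕ) : iteratedDeriv n (fun k : ℝ => Complex.exp (-(Complex.I * k * c))) =
      fun k : ℝ => (-(Complex.I * c)) ^ n * Complex.exp (-(Complex.I * k * c)) := by
    induction n with
    | zero => simp
    | succ n ih =>
      rw [iteratedDeriv_succ, ih]
      funext k
      have h0 : HasDerivAt (fun k : ℝ => (k : ℂ)) 1 k := Complex.ofRealCLM.hasDerivAt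
      have h1 : HasDerivAt (fun k : ℝ => (-(Complex.I * c)) ^ n * Complex.exp (-(Complex.I * k * c)))
          _ k := (((h0.const_mul Complex.I).mul_const (c : ℂ)).neg).cexp.const_mul
        ((-(Complex.I * c)) ^ n)
      simp only [Pi.neg_apply] at h1
      rw [h1.deriv]
      ring
  refine ⟨hs, fun n => ⟨0, |c| ^ n, fun k => ?_⟩⟩
  rw [norm_iteratedFDeriv_eq_norm_iteratedDeriv, hn]
  simp [norm_phase]

/-- The test function `k ↦ exp(-i k b) f (A k)`. -/
theorem exists_modulated (A : ℝ) (hA : 0 < A) (b : ℝ) (f : 𝓢(ℝ, ℂ)) :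
    ∃ f₁ : 𝓢(ℝ, ℂ), ∀ k : ℝ, f₁ k = Complex.exp (-(Complex.I * k * b)) * f (A * k) := by
  refine ⟨SchwartzMap.smulLeftCLM ℂ (fun k : ℝ => Complex.exp (-(Complex.I * k * b)))
    (SchwartzMap.compCLMOfContinuousLinearEquiv ℂ
      (ContinuousLinearEquiv.unitsEquivAut ℝ (Units.mk0 A hA.ne')) f), fun k => ?_⟩
  rw [SchwartzMap.smulLeftCLM_apply_apply (temperate_cexp b)]
  simp [mul_comm]

theorem fourier_slice {A : ℝ} (hA : 0 < A) (b : ℝ) {ψ : ℝ → ℝ} {g : ℝ → ℂ}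
    (h : ∀ f : 𝓢(ℝ, ℂ), ∫ u : ℝ, (ψ u : ℂ) * fourierU f u = ∫ k : ℝ, g k * f k) (f : 𝓢(ℝ, ℂ)) :
    ∫ u : ℝ, (ψ (A * u + b) : ℂ) * fourierU f u =
      ∫ k : ℝ, ((A⁻¹ : ℝ) : ℂ) * (Complex.exp (-(Complex.I * ((A⁻¹ * k : ℝ) : ℂ) * b)) * g (A⁻¹ * k)) * f k := by
  obtain ⟨f₁, hf₁⟩ := exists_modulated A hA b f
  have hA' : (A : ℂ) ≠ 0 := by exact_mod_cast hA.ne'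
  have h1 (u : ℝ) : fourierU f u = A * fourierU f₁ (A * u + b) := by
    have := Measure.integral_comp_mul_left
      (fun k : ℝ => Complex.exp (Complex.I * u * k) * f k / (Real.sqrt (2 * Real.pi) : ℂ)) A
    rw [abs_of_pos (inv_pos.2 hA)] at this
    rw [fourierU, fourierU, eq_comm, show (A : ℂ) = ((A : ℝ) : ℂ) from rfl, ← Complex.real_smul,
      ← eq_inv_smul_iff₀ hA.ne', ← this]
    refine integral_congr_ae (.of_forall fun k => ?_)
    simp only [hf₁]
    rw [← mul_assoc, ← Complex.exp_add]
    congr 3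
    push_cast; ring
  have e1 : ∫ u : ℝ, (ψ (A * u + b) : ℂ) * fourierU f u = ∫ u : ℝ, (ψ u : ℂ) * fourierU f₁ u := by
    have := Measure.integral_comp_mul_left
      (fun u : ℝ => (A : ℂ) * ((ψ (u + b) : ℂ) * fourierU f₁ (u + b))) A
    simp_rw [h1]
    rw [integral_congr_ae (.of_forall fun u => mul_left_comm _ _ _), this,
      integral_const_mul, integral_add_right_eq_self (fun u : ℝ => (ψ u : ℂ) * fourierU f₁ u) b,
      abs_of_pos (inv_pos.2 hA), Complex.real_smul, ← mul_assoc, ← Complex.ofReal_mul,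
      inv_mul_cancel₀ hA.ne', Complex.ofReal_one, one_mul]
  have e2 : ∫ k : ℝ, ((A⁻¹ : ℝ) : ℂ) *
      (Complex.exp (-(Complex.I * ((A⁻¹ * k : ℝ) : ℂ) * b)) * g (A⁻¹ * k)) * f k =
      ∫ k : ℝ, g k * f₁ k := by
    have := Measure.integral_comp_mul_left (fun k : ℝ => ((A⁻¹ : ℝ) : ℂ) * (g k * f₁ k)) A⁻¹
    rw [inv_inv, abs_of_pos hA, integral_const_mul (((A⁻¹ : ℝ) : ℂ)) (fun k => g k * f₁ k),
      Complex.real_smul, ← mul_assoc,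
      ← Complex.ofReal_mul, mul_inv_cancel₀ hA.ne', Complex.ofReal_one, one_mul] at this
    rw [← this]
    refine integral_congr_ae (.of_forall fun k => ?_)
    simp only [hf₁, mul_inv_cancel_left₀ hA.ne']
    ring
  rw [e1, e2, h]

theorem duDeriv_horizonMap {ψ : Scri → ℝ}
    (h : ContMDiff (𝓘(ℝ, ℝ).prod (𝓡 2)) 𝓘(ℝ, ℝ) ∞ ψ) (a b : S2 → ℝ) (R : E3 ≃ₗᵢ[ℝ] E3) (p : Scri) :
    duDeriv (ψ ∘ horizonMap a b R) p = Real.exp (a p.2) * duDeriv ψ (horizonMap a b R p) := by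
  have h1 := (slice_diff h (rot R p.2) (Real.exp (a p.2) * p.1 + b p.2)).hasDerivAt
  have h2 : HasDerivAt (fun v : ℝ => Real.exp (a p.2) * v + b p.2) (Real.exp (a p.2)) p.1 := by
    simpa using ((hasDerivAt_id p.1).const_mul (Real.exp (a p.2))).add_const (b p.2)
  have h3 := (h1.comp p.1 h2).deriv
  rw [mul_comm] at h3
  exact h3

theorem memSc_horizonMap {ψ : Scri → ℝ} (hψ : MemSc ψ) {a b : S2 → ℝ} (ha : IsSmoothS2 a)
    (hb : IsSmoothS2 b) (R : E3 ≃ₗᵢ[ℝ] E3) : MemSc (ψ ∘ horizonMap a b R) := by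
  obtain ⟨C, hC⟩ := hψ.bounded
  obtain ⟨g, hg1, hg2, D, hD⟩ := hψ.fourier
  have hac : Continuous a := ha.continuous
  have hbc : Continuous b := hb.continuous
  have h0 : IsSmoothS2 (0 : S2 → ℝ) := contMDiff_const
  have hna : IsSmoothS2 (-a) := ha.neg
  have hm (p : Scri) : ‖Complex.exp (-(Complex.I * ((Real.exp (-a p.2) * p.1 : ℝ) : ℂ) * b p.2))‖ = 1 :=
    norm_phase _ _
  refine ⟨hψ.smooth.comp (horizonMap_smooth ha hb R), ⟨C, fun p => hC _⟩, ?_,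
    fun p => (Real.exp (-a p.2) : ℂ) *
      (Complex.exp (-(Complex.I * ((Real.exp (-a p.2) * p.1 : ℝ) : ℂ) * b p.2)) *
        g (horizonMap (-a) 0 R p)), ?_, ?_, D, ?_⟩
  · rw [show duDeriv (ψ ∘ horizonMap a b R) = _ from
      funext fun p => duDeriv_horizonMap hψ.smooth a b R p]
    exact integrable_horizonMap ha hb R hψ.integrable
  · have h1 := (rot_mp R).quasiMeasurePreserving.ae hg1
    filter_upwards [h1] with s hs f
    have := fourier_slice (Real.exp_pos (a s)) (b s) hs f
    simpa [horizonMap, Real.exp_neg] using this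
  · have h1 := integrable_horizonMap hna h0 R hg2
    have h2 := h1.bdd_mul (c := 1) (f := fun p : Scri =>
      Complex.exp (-(Complex.I * ((Real.exp (-a p.2) * p.1 : ℝ) : ℂ) * b p.2))) (by
        refine Continuous.aestronglyMeasurable ?_
        fun_prop) (.of_forall fun p => (hm p).le)
    refine h2.congr (.of_forall fun p => ?_)
    simp only [Complex.real_smul, Pi.neg_apply]
    ring
  · filter_upwards [ae_horizonMap hna h0 R hD] with p hp
    refine le_trans (le_of_eq ?_) hp
    rw [norm_mul, norm_mul, norm_mul, norm_mul, hm, one_mul, ← mul_assoc, ← norm_mul]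
    simp [horizonMap, mul_comm]

/-! ## The symplectic form, the scalar product and the boundary algebra -/

/-- The symplectic form `∫ (ψ ∂_u ψ' - ψ' ∂_u ψ) du dμ_{S²}`. -/
def sigmaC (ψ ψ' : Sc) : ℝ :=
  ∫ p, ((ψ : Scri → ℝ) p * duDeriv ψ' p - (ψ' : Scri → ℝ) p * duDeriv ψ p) ∂scriMeasure

theorem sigmaC_swap (ψ ψ' : Sc) : sigmaC ψ' ψ = -sigmaC ψ ψ' := by
  rw [sigmaC, sigmaC, ← integral_neg]
  exact integral_congr_ae (.of_forall fun p => by ring)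

/-- A representative of `ψ̂` (it is unique almost everywhere). -/
def hat (ψ : Sc) : Scri → ℂ := Classical.choose ψ.2.fourier

theorem hat_spec (ψ : Sc) : IsGoodFourier ψ (hat ψ) := Classical.choose_spec ψ.2.fourier

/-- The scalar product `Re ∫_{k > 0} 2 k conj(ψ̂) ψ̂' dk dμ_{S²}`. -/
def muC (ψ ψ' : Sc) : ℝ :=
  (∫ p in {p : Scri | 0 < p.1},
    2 * (p.1 : ℂ) * (starRingEnd ℂ) (hat ψ p) * hat ψ' p ∂scriMeasure).re

/-- `μ(ψ, ψ') + (i/2) σ(ψ, ψ')`. -/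
def twoPointC (ψ ψ' : Sc) : ℂ := (muC ψ ψ' : ℂ) + Complex.I / 2 * (sigmaC ψ ψ' : ℂ)

/-- Order reversal on the real tensor algebra, as a homomorphism to the opposite algebra. -/
def tensorReverse (V : Type*) [AddCommGroup V] [Module ℝ V] :
    TensorAlgebra ℝ V →ₐ[ℝ] (TensorAlgebra ℝ V)ᵐᵒᵖ :=
  TensorAlgebra.lift ℝ ((MulOpposite.opLinearEquiv ℝ).toLinearMap ∘ₗ TensorAlgebra.ι ℝ)

theorem tensorReverse_invol (V : Type*) [AddCommGroup V] [Module ℝ V] (x : TensorAlgebra ℝ V) :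
    (tensorReverse V (tensorReverse V x).unop).unop = x := by
  induction x using TensorAlgebra.induction with
  | algebraMap r => simp
  | ι v => simp [tensorReverse]
  | mul a b ha hb => simp [ha, hb]
  | add a b ha hb => simp [ha, hb]

/-- The involution `(v₁ ⊗ ⋯ ⊗ vₙ)^* = vₙ ⊗ ⋯ ⊗ v₁`. -/
instance tensorStarRing (V : Type*) [AddCommGroup V] [Module ℝ V] :
    StarRing (TensorAlgebra ℝ V) where
  star x := (tensorReverse V x).unop
  star_involutive := tensorReverse_invol V
  star_mul x y := by simp
  star_add x y := by simp

theorem tensorStar_ι {V : Type*} [AddCommGroup V] [Module ℝ V] (v : V) :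
    star (TensorAlgebra.ι ℝ v) = TensorAlgebra.ι ℝ v := by
  change (tensorReverse V (TensorAlgebra.ι ℝ v)).unop = _
  simp [tensorReverse]

instance tensorStarModule (V : Type*) [AddCommGroup V] [Module ℝ V] :
    StarModule ℝ (TensorAlgebra ℝ V) where
  star_smul r x := by
    change (tensorReverse V (r • x)).unop = _ • (tensorReverse V x).unop
    simp

/-- The universal tensor algebra `ℂ ⊗ ⨁ₙ S_c^{⊗ n}`; its `*` is complex conjugation tensored with
order reversal. -/
abbrev Tc := ℂ ⊗[ℝ] TensorAlgebra ℝ Sc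

/-- A function in `S_c` as an element of degree one. -/
def gen (ψ : Sc) : Tc := (1 : ℂ) ⊗ₜ[ℝ] TensorAlgebra.ι ℝ ψ

theorem star_add_Tc (x y : Tc) : star (x + y) = star x + star y := star_add x y
theorem star_sub_Tc (x y : Tc) : star (x - y) = star x - star y := star_sub x y
theorem star_mul_Tc (x y : Tc) : star (x * y) = star y * star x := star_mul x y

theorem star_gen (ψ : Sc) : star (gen ψ) = gen ψ := by
  rw [gen, TensorProduct.star_tmul, tensorStar_ι, star_one]

/-- The canonical commutation relations `ψ ⊗ ψ' - ψ' ⊗ ψ = i σ(ψ, ψ') 1`. -/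
inductive CCRRel : Tc → Tc → Prop
  | ccr (ψ ψ' : Sc) :
      CCRRel (gen ψ * gen ψ' - gen ψ' * gen ψ) (algebraMap ℂ Tc (Complex.I * (sigmaC ψ ψ' : ℂ)))

theorem star_algebraMap_Tc (z : ℂ) : star (algebraMap ℂ Tc z) = algebraMap ℂ Tc (star z) := by
  simp [Algebra.TensorProduct.algebraMap_apply]

theorem CCRRel.star_mem (x y : Tc) (h : CCRRel x y) : CCRRel (star x) (star y) := by
  obtain ⟨ψ, ψ'⟩ := h
  have h1 : star (gen ψ * gen ψ' - gen ψ' * gen ψ) = gen ψ' * gen ψ - gen ψ * gen ψ' := by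
    rw [star_sub_Tc, star_mul_Tc, star_mul_Tc, star_gen, star_gen]
  have h2 : star (algebraMap ℂ Tc (Complex.I * (sigmaC ψ ψ' : ℂ))) =
      algebraMap ℂ Tc (Complex.I * (sigmaC ψ' ψ : ℂ)) := by
    rw [star_algebraMap_Tc, sigmaC_swap ψ ψ']; simp
  rw [h1, h2]
  exact CCRRel.ccr ψ' ψ

/-- The boundary algebra `A_c`: the quotient of the tensor algebra by the two-sided ideal generated
by the commutation relations. -/
abbrev Ac := RingQuot CCRRel

instance : StarRing Ac := RingQuot.starRing CCRRel CCRRel.star_mem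

/-- The quotient map. -/
def toAc : Tc →ₐ[ℂ] Ac := RingQuot.mkAlgHom ℂ CCRRel

theorem toAc_star (x : Tc) : toAc (star x) = star (toAc x) := by
  simp only [toAc, RingQuot.mkAlgHom_def, RingQuot.mkRingHom_def]
  rfl

/-- The generator `[ψ]` of `A_c`. -/
def field (ψ : Sc) : Ac := toAc (gen ψ)

theorem star_smul_Tc (z : ℂ) (x : Tc) : star (z • x) = star z • star x := by
  have h1 := Algebra.smul_def z x
  have h2 := Algebra.smul_def (star z) (star x)
  refine (congrArg star h1).trans (Eq.trans ?_ h2.symm)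
  rw [star_mul_Tc, star_algebraMap_Tc, ← Algebra.commutes]

instance : StarModule ℂ Ac where
  star_smul z a := by
    obtain ⟨x, rfl⟩ := RingQuot.mkAlgHom_surjective ℂ CCRRel a
    change star (z • toAc x) = star z • star (toAc x)
    rw [← map_smul, ← toAc_star, star_smul_Tc, map_smul, toAc_star]

theorem star_field (ψ : Sc) : star (field ψ) = field ψ := by
  rw [field, ← toAc_star, star_gen]

theorem field_ccr (ψ ψ' : Sc) : field ψ * field ψ' - field ψ' * field ψ =
    algebraMap ℂ Ac (Complex.I * (sigmaC ψ ψ' : ℂ)) := by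
  have h := RingQuot.mkAlgHom_rel ℂ (CCRRel.ccr ψ ψ')
  change toAc _ = toAc _ at h
  rw [map_sub, map_mul, map_mul, AlgHom.commutes] at h
  exact h

theorem Tc_ext {B : Type*} [Ring B] [Algebra ℂ B] {f g : Tc →ₐ[ℂ] B} (h : ∀ ψ, f (gen ψ) = g (gen ψ)) :
    f = g := by
  let _ : Algebra ℝ B := Algebra.compHom B (algebraMap ℝ ℂ)
  have : IsScalarTower ℝ ℂ B := ⟨fun r z b => by
    change _ = (r : ℂ) • (z • b)
    rw [smul_smul]; simp⟩
  refine Algebra.TensorProduct.ext (by ext) ?_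
  refine TensorAlgebra.hom_ext (LinearMap.ext fun ψ => h ψ)

theorem Ac_ext {B : Type*} [Ring B] [Algebra ℂ B] {f g : Ac →ₐ[ℂ] B} (h : ∀ ψ, f (field ψ) = g (field ψ)) :
    f = g :=
  RingQuot.ringQuot_ext' ℂ f g (Tc_ext h)

theorem exists_params (h : SG) : ∃ a b : S2 → ℝ, ∃ R : E3 ≃ₗᵢ[ℝ] E3, R ∈ SO3 ∧ IsSmoothS2 a ∧ IsSmoothS2 b ∧
    ⇑(h : Equiv.Perm Scri) = horizonMap a b R := by
  obtain ⟨a, b, R, h1, h2, h3, h4⟩ := h.2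
  exact ⟨a, b, R, h1, h2, h3, h4⟩

/-- `(A_h ψ)(p) = ψ(h⁻¹ p)`. -/
def actSc (h : SG) : Sc →ₗ[ℝ] Sc where
  toFun ψ := ⟨fun p => (ψ : Scri → ℝ) (((h⁻¹ : SG) : Equiv.Perm Scri) p), by
    obtain ⟨a, b, R, -, ha, hb, hF⟩ := exists_params h⁻¹
    rw [hF]
    exact memSc_horizonMap ψ.2 ha hb R⟩
  map_add' ψ ψ' := rfl
  map_smul' c ψ := rfl

theorem sigmaC_actSc (h : SG) (ψ ψ' : Sc) : sigmaC (actSc h ψ) (actSc h ψ') = sigmaC ψ ψ' := by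
  obtain ⟨a, b, R, -, ha, hb, hF⟩ := exists_params h⁻¹
  have hbij : Function.Bijective (horizonMap a b R) := hF ▸ Equiv.bijective _
  have h1 (φ : Sc) : (actSc h φ : Scri → ℝ) = (φ : Scri → ℝ) ∘ horizonMap a b R := by
    rw [← hF]; rfl
  rw [sigmaC, sigmaC]
  conv_rhs => rw [← integral_horizonMap ha hb hbij]
  refine integral_congr_ae (.of_forall fun p => ?_)
  simp only [h1, duDeriv_horizonMap ψ.2.smooth, duDeriv_horizonMap ψ'.2.smooth, smul_eq_mul,
    Function.comp]
  ring

def actTc (h : SG) : Tc →ₐ[ℂ] Tc :=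
  Algebra.TensorProduct.map (AlgHom.id ℂ ℂ) (TensorAlgebra.lift ℝ (TensorAlgebra.ι ℝ ∘ₗ actSc h))

theorem actTc_gen (h : SG) (ψ : Sc) : actTc h (gen ψ) = gen (actSc h ψ) := by
  simp [actTc, gen]

/-- The homomorphism of `A_c` with `[ψ] ↦ [A_h ψ]`. -/
def actHom (h : SG) : Ac →ₐ[ℂ] Ac :=
  RingQuot.liftAlgHom ℂ ⟨toAc.comp (actTc h), by
    rintro _ _ ⟨ψ, ψ'⟩
    have := field_ccr (actSc h ψ) (actSc h ψ')
    rw [sigmaC_actSc] at this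
    rw [AlgHom.comp_apply, AlgHom.comp_apply, map_sub, map_sub, map_mul, map_mul, map_mul, map_mul,
      actTc_gen, actTc_gen, AlgHom.commutes, AlgHom.commutes]
    exact this⟩

theorem actHom_field (h : SG) (ψ : Sc) : actHom h (field ψ) = field (actSc h ψ) := by
  have : actHom h (field ψ) = toAc (actTc h (gen ψ)) :=
    RingQuot.liftAlgHom_mkAlgHom_apply ℂ _ _ _
  rw [this, actTc_gen, field]

theorem actSc_mul (h k : SG) (ψ : Sc) : actSc (h * k) ψ = actSc h (actSc k ψ) := by
  refine Subtype.ext (funext fun p => ?_)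
  change (ψ : Scri → ℝ) ((((h * k)⁻¹ : SG) : Equiv.Perm Scri) p) = _
  rw [mul_inv_rev]; rfl

theorem actSc_one (ψ : Sc) : actSc 1 ψ = ψ := by
  refine Subtype.ext (funext fun p => ?_)
  change (ψ : Scri → ℝ) ((((1 : SG)⁻¹ : SG) : Equiv.Perm Scri) p) = _
  rw [inv_one]; rfl

theorem actHom_mul (h k : SG) : actHom (h * k) = (actHom h).comp (actHom k) := by
  refine Ac_ext (B := Ac) fun ψ => ?_
  rw [AlgHom.comp_apply, actHom_field, actHom_field, actHom_field, actSc_mul]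

theorem actHom_one : actHom 1 = AlgHom.id ℂ Ac := by
  refine Ac_ext (B := Ac) fun ψ => ?_
  rw [actHom_field, actSc_one, AlgHom.id_apply]

theorem actHom_star (h : SG) (x : Ac) : actHom h (star x) = star (actHom h x) := by
  obtain ⟨x, rfl⟩ := RingQuot.mkAlgHom_surjective ℂ CCRRel x
  change actHom h (star (toAc x)) = star (actHom h (toAc x))
  have hz (z : Tc) : actHom h (toAc z) = toAc (actTc h z) := RingQuot.liftAlgHom_mkAlgHom_apply ℂ _ _ _
  rw [← toAc_star, hz, hz, ← toAc_star]
  congr 1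
  induction x using TensorProduct.induction_on with
  | zero =>
    have h0 : star (0 : Tc) = 0 := star_zero Tc
    rw [h0, map_zero, h0]
  | add x y hx hy =>
    have h1 := star_add_Tc x y
    rw [h1, map_add, hx, hy, map_add, star_add_Tc]
  | tmul z t =>
    simp only [TensorProduct.star_tmul, actTc, Algebra.TensorProduct.map_tmul]
    congr 1
    induction t using TensorAlgebra.induction with
    | algebraMap r => 
      have : star (algebraMap ℝ (TensorAlgebra ℝ Sc) r) = algebraMap ℝ _ r := by
        change (tensorReverse _ _).unop = _
        simp
      rw [this]; simp [this]
    | ι v => simp [tensorStar_ι]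
    | mul a b ha hb => simp [ha, hb]
    | add a b ha hb => simp [ha, hb]

/-- The representation of the horizon symmetry group by `*`-automorphisms, `α_h [ψ] = [A_h ψ]`. -/
def alpha : SG →* (Ac ≃⋆ₐ[ℂ] Ac) where
  toFun h := StarAlgEquiv.ofAlgEquiv (AlgEquiv.ofAlgHom (actHom h) (actHom h⁻¹)
    (by rw [← actHom_mul, mul_inv_cancel, actHom_one])
    (by rw [← actHom_mul, inv_mul_cancel, actHom_one])) (actHom_star h)
  map_one' := by
    ext x
    exact congrArg (fun f : Ac →ₐ[ℂ] Ac => f x) actHom_one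
  map_mul' h k := by
    ext x
    exact congrArg (fun f : Ac →ₐ[ℂ] Ac => f x) (actHom_mul h k)

/-! ## States, GNS quadruples and unitary implementation -/

/-- Algebraic states of `A_c`: normalized and positive. -/
structure IsState (w : Ac →ₗ[ℂ] ℂ) : Prop where
  normalized : w 1 = 1
  positive : ∀ a : Ac, 0 ≤ w (star a * a)

/-- A GNS quadruple `(H, D, π, Ω)` of a functional `w`. By cyclicity `D = π(A_c) Ω`. -/
structure GNSQuadruple (w : Ac →ₗ[ℂ] ℂ) where
  H : Type
  [normed : NormedAddCommGroup H]
  [inner : InnerProductSpace ℂ H]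
  [complete : CompleteSpace H]
  D : Submodule ℂ H
  dense : Dense (D : Set H)
  π : Ac →ₐ[ℂ] Module.End ℂ D
  π_star : ∀ (a : Ac) (x y : D), ⟪(π (star a) x : H), (y : H)⟫_ℂ = ⟪(x : H), (π a y : H)⟫_ℂ
  Ω : D
  norm_Ω : ‖(Ω : H)‖ = 1
  cyclic : ∀ x : D, ∃ a : Ac, π a Ω = x
  vector_state : ∀ a : Ac, w a = ⟪(Ω : H), (π a Ω : H)⟫_ℂ

attribute [instance] GNSQuadruple.normed GNSQuadruple.inner GNSQuadruple.complete

namespace GNSQuadruple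
variable {w : Ac →ₗ[ℂ] ℂ} (Q : GNSQuadruple w)

/-- The unitary `V` implements the automorphism `β` and fixes the cyclic vector:
`V D = D`, `V Ω = Ω`, `V π(a) V⁻¹ = π(β a)` on `D`. -/
structure Implements (β : Ac ≃⋆ₐ[ℂ] Ac) (V : Q.H ≃ₗᵢ[ℂ] Q.H) : Prop where
  map_domain : V '' (Q.D : Set Q.H) = Q.D
  map_vacuum : V Q.Ω = Q.Ω
  intertwines : ∀ (a : Ac) (x y : Q.D), V x = y → V (Q.π a x) = Q.π (β a) y

/-- The generator `H` of the unitary group `U_t = e^{itH}` (in the sense of Stone) is defined on `x`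
and `H x = y`. -/
def GeneratorApplies (U : ℝ → Q.H ≃ₗᵢ[ℂ] Q.H) (x y : Q.H) : Prop :=
  HasDerivAt (fun t : ℝ => U t x) (Complex.I • y) 0

/-- `U` is a strongly continuous one-parameter unitary group that implements `β` and fixes the cyclic
vector, and its self-adjoint generator `H`, `U_t = e^{itH}`, is nonnegative: `⟪x, H x⟫ ≥ 0` on its
domain. -/
structure PositiveEnergy (β : ℝ → Ac ≃⋆ₐ[ℂ] Ac) (U : ℝ → Q.H ≃ₗᵢ[ℂ] Q.H) : Prop where
  implements : ∀ t, Q.Implements (β t) (U t)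
  map_zero : U 0 = 1
  map_add : ∀ s t, U (s + t) = U s * U t
  strongly_continuous : ∀ x, Continuous fun t => U t x
  generator_nonneg : ∀ x y, Q.GeneratorApplies U x y → 0 ≤ ⟪x, y⟫_ℂ
end GNSQuadruple

/-- The partitions of `{1, …, n}` into pairs, as involutions without fixed points. -/
def pairings (n : ℕ) : Finset (Equiv.Perm (Fin n)) :=
  Finset.univ.filter fun τ => ∀ i, τ (τ i) = i ∧ τ i ≠ i

/-- Quasi-free states of `A_c`: odd `n`-point functions vanish, even ones are sums over pairings of
products of two-point functions, with the arguments of each factor in increasing order. -/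
structure IsQuasiFree (w : Ac →ₗ[ℂ] ℂ) : Prop where
  isState : IsState w
  odd : ∀ (n : ℕ) (f : Fin n → Sc), Odd n → w (List.ofFn fun i => field (f i)).prod = 0
  even : ∀ (n : ℕ) (f : Fin n → Sc), Even n → w (List.ofFn fun i => field (f i)).prod =
    ∑ τ ∈ pairings n, ∏ i with i < τ i, w (field (f i) * field (f (τ i)))

def HasTwoPointC (w : Ac →ₗ[ℂ] ℂ) : Prop :=
  ∀ ψ ψ' : Sc, w (field ψ * field ψ') = twoPointC ψ ψ'

/-- The quasi-free state of `A_c` with two-point function `μ + (i/2) σ`. That there is exactly one such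
state is part of the theorem. -/
def omegaC : Ac →ₗ[ℂ] ℂ := Classical.epsilon fun w => IsQuasiFree w ∧ HasTwoPointC w

/-- The one-particle space: the closed complex span of the vectors `π([ψ]) Ω`. -/
def oneParticle {w : Ac →ₗ[ℂ] ℂ} (Q : GNSQuadruple w) : Submodule ℂ Q.H :=
  (Submodule.span ℂ (Set.range fun ψ : Sc => (Q.π (field ψ) Q.Ω : Q.H))).topologicalClosure

/-- The generator of `U`, restricted to the one-particle space, has no zero eigenvalue. -/
def NoZeroEigenvalue {w : Ac →ₗ[ℂ] ℂ} (Q : GNSQuadruple w) (U : ℝ → Q.H ≃ₗᵢ[ℂ] Q.H) : Prop :=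
  ∀ x ∈ oneParticle Q, Q.GeneratorApplies U x 0 → x = 0

/-- The translation `(u, s) ↦ (u + t, s)`. -/
def uTranslation (t : ℝ) : SG := ⟨(Equiv.addRight t).prodCongr (Equiv.refl S2), 0, fun _ => t, 1,
  one_mem _, contMDiff_const, contMDiff_const, by
    funext p; simp [horizonMap, rot]; rfl⟩

/-- Bondi frames `(u', s') = B(u, s)`: they differ from the given frame by the elements of the horizon
symmetry group with `a = 0`. -/
def IsBondiFrame (B : SG) : Prop :=
  ∃ b : S2 → ℝ, ∃ R ∈ SO3, IsSmoothS2 b ∧ ⇑(B : Equiv.Perm Scri) = horizonMap 0 b R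

/-- The one-parameter group generated by `∂_{u'}`: translation by `t` of the coordinate `u'` of the
frame `B`. -/
def frameTranslation (B : SG) (t : ℝ) : SG := B⁻¹ * uTranslation t * B

end
end CosmoHorizon
open CosmoHorizon

open CosmoHorizon
namespace CosmoHorizon
open Filter Topology

/-! Existence. With `g = ψ̂` and `h = φ̂`, Parseval on each line `ℝ × {s}` and the reality condition
`g(-k) = conj g(k)` show that `σ` is twice the imaginary part of `∫_{k>0} 2k conj(g) h`, of which
`μ` is the real part. So `μ + (i/2)σ` is this integral itself (`twoPointC_eq`), the Gram kernel of
`ψ ↦ √(2k) ψ̂` in `L²(k > 0)`. For any Gram kernel with the imaginary part prescribed by the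
commutation relations, creation and annihilation operators on polynomials produce the Wick
functional. Positivity involves only finitely many test functions at a time, so it is checked in the
Fock space over some `ℂᵐ` (`wickList_nonneg`).

Symmetry. `F_{(a,b,R)}` acts on `ψ̂` by a rotation, a phase and the dilation `k ↦ e^{-a}k`; the
measure `k dk` absorbs the dilation factors and the phases cancel. Invariance of the two-point
function gives invariance of the state, hence unitary implementation in every GNS quadruple. All
maps with `a = 0` commute with the `u`-translations, so every Bondi frame has the same translation
group.

Positive energy. Call a function on `ℝ` Hardy if it extends to a bounded continuous function on the
closed upper half plane that is holomorphic inside. A strongly continuous unitary group has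
nonnegative generator iff all its matrix elements are Hardy: `nonneg_of_isHardy` uses the maximum
principle, `isHardy_of_nonneg` approximates the generator by bounded positive operators, without the
spectral theorem. For `omegaC` the two-point function is a Fourier integral over `k > 0`, which is
Hardy and, by Riemann–Lebesgue, tends to zero; so the energy is nonnegative and no one-particle
vector is invariant.

Uniqueness. The commutation relations fix the imaginary part of every two-point function. For a
competitor `w`, the difference of the two functions of `t` is therefore Hardy and real, hence
constant (`IsHardy.eq_of_real`). The function for `omegaC` decays, so the one for `w` converges; a
limit of matrix elements is represented by an invariant one-particle vector, which must be zero
(`tendsto_zero_of_tendsto`). So the constant is zero, and quasi-free states with equal two-point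
functions coincide. -/

/-! ## Boundary values of bounded holomorphic functions on the upper half plane -/

/-- `f` is bounded and continuous on the closed upper half plane, holomorphic in its interior, and
restricts to `F` on the real line. -/
structure IsHardyExtension (f : ℂ → ℂ) (F : ℝ → ℂ) : Prop where
  diff : DiffContOnCl ℂ f {z | 0 < z.im}
  bounded : ∃ C, ∀ z : ℂ, 0 ≤ z.im → ‖f z‖ ≤ C
  eq : ∀ t : ℝ, f t = F t

/-- `F` is the boundary value of a bounded holomorphic function on the upper half plane. -/
def IsHardy (F : ℝ → ℂ) : Prop := ∃ f, IsHardyExtension f F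

theorem closure_upper : closure {z : ℂ | 0 < z.im} = {z | 0 ≤ z.im} :=
  Complex.closure_setOfPred_lt_im 0

theorem isOpen_upper : IsOpen {z : ℂ | 0 < z.im} := isOpen_lt continuous_const Complex.continuous_im

theorem isPreconnected_upper : IsPreconnected {z : ℂ | 0 < z.im} :=
  (convex_halfSpace_im_gt 0).isPreconnected

namespace IsHardyExtension
variable {f g : ℂ → ℂ} {F G : ℝ → ℂ}

theorem continuousOn (h : IsHardyExtension f F) : ContinuousOn f {z | 0 ≤ z.im} := by
  rw [← closure_upper]; exact h.diff.continuousOn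

theorem differentiableAt (h : IsHardyExtension f F) {z : ℂ} (hz : 0 < z.im) :
    DifferentiableAt ℂ f z :=
  h.diff.differentiableAt isOpen_upper hz

/-- The maximum principle in the half plane. -/
theorem norm_le (h : IsHardyExtension f F) {C : ℝ} (hF : ∀ t, ‖F t‖ ≤ C) {z : ℂ} (hz : 0 ≤ z.im) :
    ‖f z‖ ≤ C := by
  obtain ⟨D, hD⟩ := h.bounded
  have hmaps : Set.MapsTo (fun w : ℂ => I * w) {w | 0 < w.re} {z | 0 < z.im} := fun w hw => by
    simpa using hw
  have hd : DiffContOnCl ℂ (fun w => f (I * w)) {w | 0 < w.re} :=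
    h.diff.comp (Differentiable.diffContOnCl (by fun_prop)) hmaps
  have hb : ∀ w : ℂ, 0 ≤ w.re → ‖f (I * w)‖ ≤ D := fun w hw => hD _ (by simpa using hw)
  -- After the rotation `w ↦ I * w`, Phragmén–Lindelöf applies to the right half plane. Boundedness
  -- of `f` supplies the growth condition, with exponent `1 < 2` and factor `0`, and the bound on
  -- the real axis.
  have := PhragmenLindelof.right_half_plane_of_bounded_on_real (C := C) (z := -I * z) hd
    ⟨1, by norm_num, 0, by
      refine Asymptotics.IsBigO.of_bound D ?_
      filter_upwards [mem_inf_of_right (mem_principal_self _)] with w hw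
      simpa using hb w (le_of_lt hw)⟩
    ⟨D, by
      rw [eventually_map]
      filter_upwards [eventually_ge_atTop 0] with x hx using hb x (by simpa using hx)⟩
    (fun x => by
      have e : I * ((x : ℂ) * I) = ((-x : ℝ) : ℂ) := by
        push_cast; linear_combination (x : ℂ) * I_mul_I
      rw [e, h.eq]; exact hF _) (by simpa using hz)
  rwa [show I * (-I * z) = z by linear_combination -z * I_mul_I] at this

theorem add (hf : IsHardyExtension f F) (hg : IsHardyExtension g G) :
    IsHardyExtension (fun z => f z + g z) (fun t => F t + G t) := by
  obtain ⟨C, hC⟩ := hf.bounded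
  obtain ⟨D, hD⟩ := hg.bounded
  refine ⟨hf.diff.add hg.diff, ⟨C + D, fun z hz => ?_⟩, fun t => by rw [hf.eq, hg.eq]⟩
  exact (norm_add_le _ _).trans (add_le_add (hC z hz) (hD z hz))

theorem mul (hf : IsHardyExtension f F) (hg : IsHardyExtension g G) :
    IsHardyExtension (fun z => f z * g z) (fun t => F t * G t) := by
  obtain ⟨C, hC⟩ := hf.bounded
  obtain ⟨D, hD⟩ := hg.bounded
  refine ⟨⟨hf.diff.1.mul hg.diff.1, hf.diff.2.mul hg.diff.2⟩, ⟨C * D, fun z hz => ?_⟩,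
    fun t => by rw [hf.eq, hg.eq]⟩
  rw [norm_mul]
  exact mul_le_mul (hC z hz) (hD z hz) (norm_nonneg _) ((norm_nonneg _).trans (hC z hz))

theorem const (c : ℂ) : IsHardyExtension (fun _ => c) (fun _ => c) :=
  ⟨diffContOnCl_const, ⟨‖c‖, fun _ _ => le_rfl⟩, fun _ => rfl⟩

theorem neg (hf : IsHardyExtension f F) : IsHardyExtension (fun z => -f z) (fun t => -F t) := by
  simpa using (const (-1)).mul hf

/-- Translation of the argument by a real number. -/
theorem comp_add (hf : IsHardyExtension f F) (s : ℝ) :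
    IsHardyExtension (fun z => f (z + s)) (fun t => F (t + s)) := by
  obtain ⟨C, hC⟩ := hf.bounded
  refine ⟨hf.diff.comp (Differentiable.diffContOnCl (by fun_prop)) fun z hz => by simpa using hz,
    ⟨C, fun z hz => hC _ (by simpa using hz)⟩, fun t => by rw [← hf.eq]; simp⟩

/-- If `F` has derivative `G` uniformly on the real line, then `f' = g` in the half plane. -/
theorem hasDerivAt (hf : IsHardyExtension f F) (hg : IsHardyExtension g G) {ε : ℝ → ℝ}
    (hε : Tendsto ε (𝓝[≠] 0) (𝓝 0))
    (hFG : ∀ h : ℝ, ∀ t, ‖F (t + h) - F t - h * G t‖ ≤ |h| * ε h) {z : ℂ} (hz : 0 < z.im) :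
    HasDerivAt f (g z) z := by
  have h1 := (hf.differentiableAt hz).hasDerivAt
  -- The complex derivative is known to exist, so real increments suffice to compute it.
  have h2 : HasDerivAt (fun h : ℝ => f (z + h)) (deriv f z) 0 := by
    have h3 : HasDerivAt (fun h : ℝ => z + (h : ℂ)) 1 0 :=
      (Complex.ofRealCLM.hasDerivAt (x := 0)).const_add z
    have h4 : HasDerivAt f (deriv f z) (z + ((0 : ℝ) : ℂ)) := by simpa using h1
    have h5 : HasDerivAt (fun h : ℝ => f (z + (h : ℂ))) _ 0 := h4.scomp (0 : ℝ) h3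
    simpa using h5
  have h5 : Tendsto (fun h : ℝ => h⁻¹ • (f (z + h) - f z)) (𝓝[≠] 0) (𝓝 (deriv f z)) := by
    simpa using h2.tendsto_slope_zero
  have h6 : Tendsto (fun h : ℝ => h⁻¹ • (f (z + h) - f z)) (𝓝[≠] 0) (𝓝 (g z)) := by
    rw [tendsto_iff_norm_sub_tendsto_zero]
    refine squeeze_zero' (.of_forall fun _ => norm_nonneg _) ?_ hε
    filter_upwards [self_mem_nhdsWithin] with h hh
    have hh : h ≠ 0 := hh
    -- The maximum principle for `f(z+h) - f(z) - h g(z)` carries the uniform estimate from the real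
    -- line to `z`.
    have hk := (((hf.comp_add h).add hf.neg).add ((const (-(h : ℂ))).mul hg)).norm_le
      (C := |h| * ε h) (fun t => by
        refine le_trans (le_of_eq ?_) (hFG h t)
        congr 1; ring) hz.le
    have e : h⁻¹ • (f (z + h) - f z) - g z = (h : ℂ)⁻¹ * (f (z + h) + -f z + -h * g z) := by
      have : (h : ℂ) ≠ 0 := by exact_mod_cast hh
      rw [Complex.real_smul]; push_cast; field_simp; ring
    rw [e, norm_mul, norm_inv, Complex.norm_real, Real.norm_eq_abs]
    calc _ ≤ |h|⁻¹ * (|h| * ε h) := mul_le_mul_of_nonneg_left hk (by positivity)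
      _ = ε h := by rw [inv_mul_cancel_left₀ (abs_ne_zero.2 hh)]
  rw [← tendsto_nhds_unique h5 h6]
  exact h1

/-- If `|F| ≤ F 0` then `i F'(0)` has nonpositive real part. -/
theorem re_deriv_nonpos (hf : IsHardyExtension f F) (hg : IsHardyExtension g G) {ε : ℝ → ℝ}
    (hε : Tendsto ε (𝓝[≠] 0) (𝓝 0))
    (hFG : ∀ h : ℝ, ∀ t, ‖F (t + h) - F t - h * G t‖ ≤ |h| * ε h)
    (hmax : ∀ t, ‖F t‖ ≤ (F 0).re) : (I * G 0).re ≤ 0 := by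
  have hd (y : ℝ) (hy : 0 < y) : HasDerivAt (fun y : ℝ => f (I * y)) (I * g (I * y)) y := by
    have h1 := hf.hasDerivAt hg hε hFG (z := I * y) (by simpa using hy)
    have h3 : HasDerivAt (fun h : ℝ => I * (h : ℂ)) I y := by
      simpa using (Complex.ofRealCLM.hasDerivAt (x := y)).const_mul I
    have h4 : HasDerivAt (fun h : ℝ => f (I * (h : ℂ))) _ y := h1.scomp y h3
    simpa using h4
  have hc {k : ℂ → ℂ} {K : ℝ → ℂ} (hk : IsHardyExtension k K) :
      ContinuousWithinAt (fun y : ℝ => k (I * y)) (Set.Ici 0) 0 := by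
    have h1 : ContinuousOn (fun y : ℝ => k (I * y)) (Set.Ici 0) :=
      hk.continuousOn.comp (by fun_prop) fun y hy => by simpa using hy
    exact h1 0 Set.self_mem_Ici
  -- The right derivative of `y ↦ f(iy)` at `0` is `i G(0)`. Since `|f(iy)| ≤ Re F(0)`, the real
  -- part of each difference quotient is nonpositive.
  have h := hasDerivWithinAt_Ici_of_tendsto_deriv (s := Set.Ioi 0) (e := I * g 0)
    (f := fun y : ℝ => f (I * y)) (a := 0)
    (fun y hy => (hd y hy).differentiableAt.differentiableWithinAt)
    ((hc hf).mono Set.Ioi_subset_Ici_self) self_mem_nhdsWithin (by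
      have h1 := ((hc hg).mono Set.Ioi_subset_Ici_self).tendsto.const_mul I
      simp only [ofReal_zero, mul_zero] at h1
      refine h1.congr' ?_
      filter_upwards [self_mem_nhdsWithin] with y hy
      exact (hd y hy).deriv.symm)
  have h0 : g 0 = G 0 := by simpa using hg.eq 0
  rw [h0] at h
  have h2 := (hasDerivWithinAt_iff_tendsto_slope' (by simp)).1 (h.mono Set.Ioi_subset_Ici_self)
  have h3 := (Complex.continuous_re.tendsto _).comp h2
  refine le_of_tendsto h3 ?_
  filter_upwards [self_mem_nhdsWithin] with y hy
  have hy : 0 < y := hy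
  have e0 : f 0 = F 0 := by simpa using hf.eq 0
  have h4 : (f (I * y)).re ≤ (F 0).re :=
    (Complex.re_le_norm _).trans (hf.norm_le hmax (by simpa using hy.le))
  simp only [Function.comp, slope, vsub_eq_sub, sub_zero, Complex.smul_re, Complex.sub_re,
    ofReal_zero, mul_zero, e0, smul_eq_mul]
  exact mul_nonpos_of_nonneg_of_nonpos (by positivity) (by linarith)

end IsHardyExtension

namespace IsHardy
variable {F G : ℝ → ℂ}

theorem add (hF : IsHardy F) (hG : IsHardy G) : IsHardy fun t => F t + G t := by
  obtain ⟨f, hf⟩ := hF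
  obtain ⟨g, hg⟩ := hG
  exact ⟨_, hf.add hg⟩

theorem mul (hF : IsHardy F) (hG : IsHardy G) : IsHardy fun t => F t * G t := by
  obtain ⟨f, hf⟩ := hF
  obtain ⟨g, hg⟩ := hG
  exact ⟨_, hf.mul hg⟩

theorem neg (hF : IsHardy F) : IsHardy fun t => -F t := by
  obtain ⟨f, hf⟩ := hF
  exact ⟨_, hf.neg⟩

theorem sub (hF : IsHardy F) (hG : IsHardy G) : IsHardy fun t => F t - G t := by
  simpa only [sub_eq_add_neg] using hF.add hG.neg

theorem const (c : ℂ) : IsHardy fun _ => c := ⟨_, .const c⟩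

theorem sum {ι : Type*} (s : Finset ι) {F : ι → ℝ → ℂ} (h : ∀ i ∈ s, IsHardy (F i)) :
    IsHardy fun t => ∑ i ∈ s, F i t := by
  classical
  induction s using Finset.induction_on with
  | empty => simpa using const 0
  | insert a s ha ih =>
    simp only [Finset.sum_insert ha]
    exact (h a (by simp)).add (ih fun i hi => h i (by simp [hi]))

theorem prod {ι : Type*} (s : Finset ι) {F : ι → ℝ → ℂ} (h : ∀ i ∈ s, IsHardy (F i)) :
    IsHardy fun t => ∏ i ∈ s, F i t := by
  classical
  induction s using Finset.induction_on with
  | empty => simpa using const 1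
  | insert a s ha ih =>
    simp only [Finset.prod_insert ha]
    exact (h a (by simp)).mul (ih fun i hi => h i (by simp [hi]))

theorem continuous (hF : IsHardy F) : Continuous F := by
  obtain ⟨f, hf⟩ := hF
  have : F = fun t : ℝ => f t := funext fun t => (hf.eq t).symm
  rw [this, ← continuousOn_univ]
  exact hf.continuousOn.comp (by fun_prop) fun t _ => by simp

/-- The class is closed under limits of bounded sequences that converge uniformly with weight
`1 / |t + i|`. -/
theorem of_tendsto {Fn : ℕ → ℝ → ℂ} {C : ℝ} (hFn : ∀ n, IsHardy (Fn n)) (hC : ∀ n t, ‖Fn n t‖ ≤ C)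
    (hlim : ∀ ε > 0, ∀ᶠ n in atTop, ∀ t : ℝ, ‖Fn n t - F t‖ ≤ ε * ‖(t : ℂ) + I‖) : IsHardy F := by
  choose f hf using hFn
  have hne {z : ℂ} (hz : 0 ≤ z.im) : z + I ≠ 0 := fun h => by
    have := congrArg Complex.im h; simp at this; linarith
  have h1 {z : ℂ} (hz : 0 ≤ z.im) : ‖(z + I)⁻¹‖ ≤ 1 := by
    rw [norm_inv]
    refine inv_le_one_of_one_le₀ (le_trans ?_ (Complex.abs_im_le_norm _))
    rw [Complex.add_im, I_im, abs_of_nonneg (by linarith)]; linarith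
  -- Multiplication by `1/(z+i)`, which is Hardy, turns the weighted convergence into uniform
  -- convergence; the factor is removed again at the end.
  have hr : IsHardyExtension (fun z => (z + I)⁻¹) (fun t => ((t : ℂ) + I)⁻¹) := by
    refine ⟨⟨fun z hz => ?_, ?_⟩, ⟨1, fun z hz => h1 hz⟩, fun _ => rfl⟩
    · exact ((differentiableAt_id.add_const I).inv (hne (le_of_lt hz))).differentiableWithinAt
    · rw [closure_upper]
      exact ContinuousOn.inv₀ (by fun_prop) fun z hz => hne hz
  have hgn (n : ℕ) := hr.mul (hf n)
  -- By the maximum principle, being uniformly Cauchy on the real line implies the same on the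
  -- closed half plane.
  have hcau : UniformCauchySeqOn (fun n z => (z + I)⁻¹ * f n z) atTop {z | 0 ≤ z.im} := by
    rw [Metric.uniformCauchySeqOn_iff]
    intro ε hε
    obtain ⟨N, hN⟩ := eventually_atTop.1 (hlim (ε / 3) (by positivity))
    refine ⟨N, fun m hm n hn z hz => ?_⟩
    rw [dist_eq_norm, sub_eq_add_neg]
    refine lt_of_le_of_lt (((hgn m).add (hgn n).neg).norm_le (C := ε / 3 + ε / 3) (fun t => ?_) hz)
      (by linarith)
    have e : ((t : ℂ) + I)⁻¹ * Fn m t + -(((t : ℂ) + I)⁻¹ * Fn n t) =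
      ((t : ℂ) + I)⁻¹ * (Fn m t - F t) - ((t : ℂ) + I)⁻¹ * (Fn n t - F t) := by ring
    have hp : 0 < ‖(t : ℂ) + I‖ := norm_pos_iff.2 (hne (by simp))
    have hk {k : ℕ} (hk : N ≤ k) : ‖((t : ℂ) + I)⁻¹ * (Fn k t - F t)‖ ≤ ε / 3 := by
      rw [norm_mul, norm_inv, inv_mul_le_iff₀ hp, mul_comm]
      exact hN k hk t
    rw [e]
    exact (norm_sub_le _ _).trans (add_le_add (hk hm) (hk hn))
  have hpt (z : ℂ) : ∃ w, 0 ≤ z.im → Tendsto (fun n => (z + I)⁻¹ * f n z) atTop (𝓝 w) := by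
    by_cases hz : 0 ≤ z.im
    · obtain ⟨w, hw⟩ := cauchySeq_tendsto_of_complete (hcau.cauchySeq (x := z) hz)
      exact ⟨w, fun _ => hw⟩
    · exact ⟨0, fun h => absurd h hz⟩
  choose g hg using hpt
  have hunif := hcau.tendstoUniformlyOn_of_tendsto (f := g) fun z hz => hg z hz
  have hsub : {z : ℂ | 0 < z.im} ⊆ {z | 0 ≤ z.im} := fun z hz => le_of_lt (Set.mem_ofPred_eq ▸ hz)
  have hlimf {z : ℂ} (hz : 0 ≤ z.im) : Tendsto (fun n => f n z) atTop (𝓝 ((z + I) * g z)) := by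
    have := (hg z hz).const_mul (z + I)
    simpa [mul_inv_cancel_left₀ (hne hz)] using this
  refine ⟨fun z => (z + I) * g z, ⟨?_, ?_⟩, ⟨C, fun z hz => ?_⟩, fun t => ?_⟩
  · have hd := (hunif.mono hsub).tendstoLocallyUniformlyOn.differentiableOn
      (.of_forall fun n => (hgn n).diff.1) isOpen_upper
    exact DifferentiableOn.mul (by fun_prop) hd
  · rw [closure_upper]
    have hc : ContinuousOn g {z | 0 ≤ z.im} :=
      hunif.continuousOn (.of_forall fun n => (hgn n).continuousOn)
    exact ContinuousOn.mul (by fun_prop) hc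
  · exact le_of_tendsto (hlimf hz).norm (.of_forall fun n => (hf n).norm_le (hC n) hz)
  · have hz : 0 ≤ (t : ℂ).im := by simp
    refine tendsto_nhds_unique (hlimf hz) ?_
    rw [Metric.tendsto_atTop']
    intro ε hε
    have hp : 0 < ‖(t : ℂ) + I‖ := norm_pos_iff.2 (hne (by simp))
    obtain ⟨N, hN⟩ := eventually_atTop.1 (hlim (ε / (2 * ‖(t : ℂ) + I‖)) (by positivity))
    refine ⟨N, fun n hn => ?_⟩
    rw [dist_eq_norm, (hf n).eq]
    refine (hN n hn.le t).trans_lt ?_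
    field_simp
    linarith

/-- A bounded holomorphic function on the half plane with real boundary values is constant. -/
theorem eq_of_real (hF : IsHardy F) (hreal : ∀ t, (F t).im = 0) (s t : ℝ) : F s = F t := by
  obtain ⟨f, hf⟩ := hF
  -- With `c = ± i`, `exp(c f)` has modulus `1` on the boundary, hence at most `1` inside. The two
  -- bounds force `Im f = 0` throughout.
  have hexp (c : ℂ) : IsHardyExtension (fun z => exp (c * f z)) (fun t => exp (c * F t)) := by
    obtain ⟨C, hC⟩ := hf.bounded
    refine ⟨⟨fun z hz => ?_, (hf.diff.2.const_mul c).cexp⟩, ⟨Real.exp (‖c‖ * C), fun z hz => ?_⟩,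
      fun t => by rw [hf.eq]⟩
    · exact ((hf.diff.1 z hz).const_mul c).cexp
    · rw [Complex.norm_exp]
      refine Real.exp_le_exp.2 ((Complex.re_le_norm _).trans ?_)
      rw [norm_mul]
      exact mul_le_mul_of_nonneg_left (hC z hz) (norm_nonneg _)
  have h1 {z : ℂ} (hz : 0 ≤ z.im) : (f z).im = 0 := by
    have ha := (hexp I).norm_le (C := 1) (fun t => by rw [Complex.norm_exp]; simp [hreal]) hz
    have hb := (hexp (-I)).norm_le (C := 1) (fun t => by rw [Complex.norm_exp]; simp [hreal]) hz
    rw [Complex.norm_exp, Real.exp_le_one_iff] at ha hb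
    simp at ha hb
    linarith
  have hdz {z : ℂ} (hz : 0 < z.im) : deriv f z = 0 := by
    have hd := (hf.differentiableAt hz).hasDerivAt
    -- `f` is real near `z`, so its derivative in every direction `v` is real; `v = 1` and `v = I`
    -- give `f' = 0`.
    have key (v : ℂ) : (v * deriv f z).im = 0 := by
      have h3 : HasDerivAt (fun h : ℝ => z + (h : ℂ) * v) v 0 := by
        simpa using ((Complex.ofRealCLM.hasDerivAt (x := (0 : ℝ))).mul_const v).const_add z
      have h4 : HasDerivAt f (deriv f z) (z + ((0 : ℝ) : ℂ) * v) := by simpa using hd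
      have h5 := h4.scomp (0 : ℝ) h3
      have h6 : HasDerivAt (fun h : ℝ => (f (z + h * v)).im) (v * deriv f z).im 0 := by
        have h7 : HasDerivAt (fun h : ℝ => (f (z + h * v)).im) _ 0 :=
          Complex.imCLM.hasFDerivAt.comp_hasDerivAt (0 : ℝ) h5
        simpa using h7
      refine h6.unique ((hasDerivAt_const (0 : ℝ) (0 : ℝ)).congr_of_eventuallyEq ?_)
      have hc : Continuous fun h : ℝ => (z + (h : ℂ) * v).im := by fun_prop
      filter_upwards [hc.continuousAt.eventually (lt_mem_nhds (a := 0) (by simpa using hz))]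
        with h hh using h1 (le_of_lt hh)
    refine Complex.ext ?_ ?_
    · simpa using key I
    · simpa using key 1
  have hconst : ∃ c, ∀ z : ℂ, 0 < z.im → f z = c := by
    refine ⟨f I, fun z hz => ?_⟩
    exact isOpen_upper.is_const_of_deriv_eq_zero isPreconnected_upper hf.diff.1
      (fun w hw => hdz hw) hz (by simp)
  obtain ⟨c, hc⟩ := hconst
  have hall : ∀ z ∈ closure {z : ℂ | 0 < z.im}, f z = c := by
    have : Set.EqOn f (fun _ => c) (closure {z : ℂ | 0 < z.im}) :=
      Set.EqOn.of_subset_closure (s := {z : ℂ | 0 < z.im}) (fun z hz => hc z hz) hf.diff.2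
        continuousOn_const subset_closure subset_rfl
    exact this
  rw [closure_upper] at hall
  rw [← hf.eq, ← hf.eq, hall s (by simp), hall t (by simp)]

end IsHardy

/-- Since `|t + i| ≥ 1`, uniform approximation is a special case of the weighted one; errors
`1/(n+1) ≤ 1` explain the bound `C + 1`. -/
theorem IsHardy.of_uniform {F : ℝ → ℂ} {C : ℝ} (hF : ∀ t, ‖F t‖ ≤ C)
    (h : ∀ ε > 0, ∃ G, IsHardy G ∧ ∀ t, ‖G t - F t‖ ≤ ε) : IsHardy F := by
  choose G hG hGF using fun n : ℕ => h (1 / ((n : ℝ) + 1)) (by positivity)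
  refine IsHardy.of_tendsto (C := C + 1) hG (fun n t => ?_) fun ε hε => ?_
  · have h1 : 1 / ((n : ℝ) + 1) ≤ 1 := by
      rw [div_le_one (by positivity)]; linarith [n.cast_nonneg (α := ℝ)]
    calc ‖G n t‖ = ‖F t + (G n t - F t)‖ := by congr 1; ring
      _ ≤ _ := (norm_add_le _ _).trans (add_le_add (hF t) ((hGF n t).trans h1))
  · have h2 := (tendsto_one_div_add_atTop_nhds_zero_nat (𝕜 := ℝ)).eventually (gt_mem_nhds hε)
    filter_upwards [h2] with n hn t
    have h3 : 1 ≤ ‖(t : ℂ) + I‖ := by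
      refine le_trans ?_ (Complex.abs_im_le_norm _)
      simp
    refine (hGF n t).trans (hn.le.trans ?_)
    exact le_mul_of_one_le_right hε.le h3

/-! ## One-parameter unitary groups with nonnegative generator -/

variable {H : Type*} [NormedAddCommGroup H] [InnerProductSpace ℂ H]

/-- A strongly continuous one-parameter unitary group. -/
structure IsUnitaryGroup (U : ℝ → H ≃ₗᵢ[ℂ] H) : Prop where
  map_zero : U 0 = 1
  map_add : ∀ s t, U (s + t) = U s * U t
  continuous : ∀ x, Continuous fun t => U t x

namespace IsUnitaryGroup
variable {U : ℝ → H ≃ₗᵢ[ℂ] H} (hU : IsUnitaryGroup U)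
include hU

theorem zero_apply (x : H) : U 0 x = x := by rw [hU.map_zero]; rfl

theorem add_apply (s t : ℝ) (x : H) : U (s + t) x = U s (U t x) := by rw [hU.map_add]; rfl

theorem comm_apply (s t : ℝ) (x : H) : U s (U t x) = U t (U s x) := by
  rw [← hU.add_apply, add_comm, hU.add_apply]

theorem neg_apply_apply (t : ℝ) (x : H) : U (-t) (U t x) = x := by
  rw [← hU.add_apply, neg_add_cancel, hU.zero_apply]

theorem inner_apply_right (t : ℝ) (x y : H) : ⟪x, U t y⟫_ℂ = ⟪U (-t) x, y⟫_ℂ := by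
  rw [← (U (-t)).inner_map_map, hU.neg_apply_apply]

theorem hasDerivAt {x y : H} (h : HasDerivAt (fun t => U t x) y 0) (t : ℝ) :
    HasDerivAt (fun t => U t x) (U t y) t := by
  have h1 : HasDerivAt (fun s : ℝ => U t (U s x)) (U t y) 0 :=
    ((U t).toContinuousLinearEquiv.toContinuousLinearMap.restrictScalars ℝ).hasFDerivAt.comp_hasDerivAt
      (0 : ℝ) h
  have h2 : HasDerivAt (fun s : ℝ => U t (U (s - t) x)) (U t y) t := by
    have h1' : HasDerivAt (fun s : ℝ => U t (U s x)) (U t y) (t - t) := by simpa using h1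
    exact h1'.comp_sub_const t t
  refine h2.congr_of_eventuallyEq (.of_forall fun s => ?_)
  simp only [← hU.add_apply, add_sub_cancel]

/-- Vectors in the kernel of the generator are invariant. -/
theorem eq_self_of_hasDerivAt_zero {x : H} (h : HasDerivAt (fun t => U t x) 0 0) (t : ℝ) :
    U t x = x := by
  have h1 (s : ℝ) : HasDerivAt (fun t => U t x) 0 s := by simpa using hU.hasDerivAt h s
  have := is_const_of_deriv_eq_zero (fun s => (h1 s).differentiableAt) (fun s => (h1 s).deriv) t 0
  rwa [hU.zero_apply] at this

/-- `‖U_t x‖²` is constant, and its derivative at `0` is `2 Re ⟪x, iy⟫ = -2 Im ⟪x, y⟫`. -/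
theorem inner_im_eq_zero {x y : H} (h : HasDerivAt (fun t => U t x) (I • y) 0) :
    (⟪x, y⟫_ℂ).im = 0 := by
  have h1 := h.inner ℂ h
  have h2 : HasDerivAt (fun t => ⟪U t x, U t x⟫_ℂ) 0 0 := by
    simp only [LinearIsometryEquiv.inner_map_map]; exact hasDerivAt_const _ _
  have h3 := congrArg Complex.re (h1.unique h2)
  rw [hU.zero_apply, inner_smul_right, inner_smul_left, ← inner_conj_symm y x] at h3
  simp only [Complex.add_re, Complex.mul_re, Complex.conj_re, Complex.conj_im, I_re, I_im,
    Complex.zero_re] at h3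
  linarith

/-- If the matrix elements of `U` extend to the upper half plane then the generator is
nonnegative. -/
theorem nonneg_of_isHardy (hH : ∀ x y : H, IsHardy fun t => ⟪x, U t y⟫_ℂ) {x y : H}
    (h : HasDerivAt (fun t => U t x) (I • y) 0) : 0 ≤ ⟪x, y⟫_ℂ := by
  obtain ⟨f, hf⟩ := hH x x
  obtain ⟨g, hg⟩ := hH x (I • y)
  have hslope := h.tendsto_slope_zero
  simp only [zero_add, hU.zero_apply] at hslope
  have hε := ((tendsto_iff_norm_sub_tendsto_zero.1 hslope).const_mul ‖x‖)
  rw [mul_zero] at hε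
  have key := hf.re_deriv_nonpos hg hε (fun s t => ?_) fun t => ?_
  · rw [hU.zero_apply, inner_smul_right, ← mul_assoc, I_mul_I] at key
    rw [Complex.nonneg_iff]
    refine ⟨?_, (hU.inner_im_eq_zero h).symm⟩
    simpa using key
  · rcases eq_or_ne s 0 with rfl | hs
    · simp
    have hs' : (s : ℂ) ≠ 0 := by exact_mod_cast hs
    -- The remainder at `t` is `U t` applied to the remainder at `0`, so the estimate is uniform in
    -- `t`, as the maximum principle requires.
    have e : ⟪x, U (t + s) x⟫_ℂ - ⟪x, U t x⟫_ℂ - s * ⟪x, U t (I • y)⟫_ℂ =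
        s * ⟪x, U t (s⁻¹ • (U s x - x) - I • y)⟫_ℂ := by
      rw [hU.add_apply, ← Complex.coe_smul]
      simp only [map_sub, map_smul, inner_sub_right, inner_smul_right]
      push_cast
      field_simp
    rw [e, norm_mul, Complex.norm_real, Real.norm_eq_abs]
    refine mul_le_mul_of_nonneg_left ((norm_inner_le_norm _ _).trans ?_) (abs_nonneg _)
    rw [LinearIsometryEquiv.norm_map]
  · refine (norm_inner_le_norm _ _).trans ?_
    rw [LinearIsometryEquiv.norm_map, hU.zero_apply, inner_self_eq_norm_sq_to_K]
    rw [← sq]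
    exact le_of_eq (by norm_cast)

omit hU in
/-- Matrix elements in the Hardy class pass to limits of vectors. -/
theorem isHardy_of_dense {S : Set H} (hS : Dense S)
    (h : ∀ x ∈ S, ∀ y ∈ S, IsHardy fun t => ⟪x, U t y⟫_ℂ) (x y : H) :
    IsHardy fun t => ⟪x, U t y⟫_ℂ := by
  have hb (x y : H) (t : ℝ) : ‖⟪x, U t y⟫_ℂ‖ ≤ ‖x‖ * ‖y‖ := by
    simpa using norm_inner_le_norm (𝕜 := ℂ) x (U t y)
  have happ (z : H) (c : ℝ) (hc : 0 ≤ c) (ε : ℝ) (hε : 0 < ε) : ∃ w ∈ S, c * ‖w - z‖ ≤ ε := by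
    obtain ⟨w, hw, hd⟩ := hS.exists_dist_lt z (ε := ε / (c + 1)) (by positivity)
    refine ⟨w, hw, ?_⟩
    rw [dist_comm, dist_eq_norm, lt_div_iff₀ (by positivity)] at hd
    nlinarith [norm_nonneg (w - z)]
  have h1 (x : H) (hx : x ∈ S) (y : H) : IsHardy fun t => ⟪x, U t y⟫_ℂ := by
    refine IsHardy.of_uniform (hb x y) fun ε hε => ?_
    obtain ⟨w, hw, hd⟩ := happ y ‖x‖ (norm_nonneg _) ε hε
    refine ⟨_, h x hx w hw, fun t => ?_⟩
    rw [← inner_sub_right, ← map_sub]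
    exact (hb _ _ _).trans hd
  refine IsHardy.of_uniform (hb x y) fun ε hε => ?_
  obtain ⟨w, hw, hd⟩ := happ x ‖y‖ (norm_nonneg _) ε hε
  refine ⟨_, h1 w hw y, fun t => ?_⟩
  rw [← inner_sub_left]
  exact (hb _ _ _).trans (by rwa [mul_comm])

end IsUnitaryGroup

/-! ### Exponentials of bounded positive operators -/

section Bounded
variable [CompleteSpace H] {G : H →L[ℂ] H}

omit [CompleteSpace H] in
theorem hasDerivAt_clm_apply {c : ℝ → H →L[ℂ] H} {c' : H →L[ℂ] H} {u : ℝ → H} {u' : H} {s : ℝ}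
    (hc : HasDerivAt c c' s) (hu : HasDerivAt u u' s) :
    HasDerivAt (fun s => c s (u s)) (c' (u s) + c s u') s :=
  ((ContinuousLinearMap.restrictScalarsL ℂ H H ℝ ℝ).hasFDerivAt.comp_hasDerivAt s hc).clm_apply hu

/-- With `v = e^{scG}x`, the derivative of `‖v‖²` in `s` is `2 Re(c) ⟪v, Gv⟫ ≤ 0`. Purely imaginary
`c` is included, so both `e^{itG}` and its inverse are contractions. -/
theorem norm_exp_smul_apply_le (hG : ∀ v, 0 ≤ ⟪v, G v⟫_ℂ) {c : ℂ} (hc : c.re ≤ 0) (x : H) :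
    ‖NormedSpace.exp (c • G) x‖ ≤ ‖x‖ := by
  have hd (s : ℝ) : HasDerivAt (fun s : ℝ => NormedSpace.exp (s • (c • G)) x)
      (c • G (NormedSpace.exp (s • (c • G)) x)) s := by
    have h1 := hasDerivAt_exp_smul_const' (𝕂 := ℝ) (c • G) s
    refine (hasDerivAt_clm_apply h1 (hasDerivAt_const s x)).congr_deriv ?_
    rw [map_zero, add_zero]; rfl
  have hn (s : ℝ) : HasDerivAt (fun s : ℝ => ‖NormedSpace.exp (s • (c • G)) x‖ ^ 2) _ s :=
    (Complex.reCLM.hasFDerivAt.comp_hasDerivAt s ((hd s).inner ℂ (hd s))).congr_of_eventuallyEq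
      (.of_forall fun s => norm_sq_eq_re_inner (𝕜 := ℂ) _)
  have hanti : AntitoneOn (fun s : ℝ => ‖NormedSpace.exp (s • (c • G)) x‖ ^ 2) Set.univ := by
    refine antitoneOn_of_deriv_nonpos convex_univ
      (fun s _ => (hn s).continuousAt.continuousWithinAt)
      (fun s _ => (hn s).differentiableAt.differentiableWithinAt) fun s _ => ?_
    rw [(hn s).deriv, inner_smul_right, inner_smul_left,
      ← inner_conj_symm (G (NormedSpace.exp (s • (c • G)) x))]
    have := Complex.nonneg_iff.1 (hG (NormedSpace.exp (s • (c • G)) x))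
    simp only [Complex.reCLM_apply, Complex.mul_re, Complex.add_re, Complex.conj_re,
      Complex.conj_im, ← this.2]
    nlinarith [this.1]
  have h01 := hanti (Set.mem_univ 0) (Set.mem_univ 1) zero_le_one
  simp only [one_smul, zero_smul, NormedSpace.exp_zero, one_apply_eq_self] at h01
  exact le_of_sq_le_sq h01 (norm_nonneg _)

/-- For bounded `G` the function `z ↦ e^{izG}` is entire, and it is contractive where `Re(iz) ≤ 0`,
that is on the closed upper half plane. -/
theorem isHardy_exp (hG : ∀ v, 0 ≤ ⟪v, G v⟫_ℂ) (x y : H) :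
    IsHardy fun t : ℝ => ⟪x, NormedSpace.exp (((t : ℂ) * I) • G) y⟫_ℂ := by
  refine ⟨fun z => ⟪x, NormedSpace.exp ((z * I) • G) y⟫_ℂ, Differentiable.diffContOnCl fun z => ?_,
    ⟨‖x‖ * ‖y‖, fun z hz => ?_⟩, fun t => rfl⟩
  · have h1 : DifferentiableAt ℂ (fun z : ℂ => NormedSpace.exp (z • (I • G))) z :=
      (hasDerivAt_exp_smul_const (𝕂 := ℂ) (I • G) z).differentiableAt
    have h2 : DifferentiableAt ℂ (fun z : ℂ => innerSL ℂ x (NormedSpace.exp (z • (I • G)) y)) z :=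
      (innerSL ℂ x).differentiableAt.comp z (h1.clm_apply (differentiableAt_const y))
    simpa only [smul_smul, innerSL_apply_apply] using h2
  · refine (norm_inner_le_norm _ _).trans (mul_le_mul_of_nonneg_left ?_ (norm_nonneg _))
    exact norm_exp_smul_apply_le hG (by simpa using hz) y

end Bounded

/-! ### Approximation of the generator by bounded positive operators -/

namespace IsUnitaryGroup
variable [CompleteSpace H] {U : ℝ → H ≃ₗᵢ[ℂ] H} (hU : IsUnitaryGroup U)
include hU

/-- The average `(1/ε) ∫_0^ε U_{c s} ds`. -/
noncomputable def average (c ε : ℝ) : H →L[ℂ] H :=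
  LinearMap.mkContinuous (σ := RingHom.id ℂ) (E := H) (F := H)
    { toFun := fun x => (ε⁻¹ : ℝ) • ∫ s in (0 : ℝ)..ε, U (c * s) x
      map_add' := fun x y => by
        have hi (x : H) : IntervalIntegrable (fun s => U (c * s) x) volume 0 ε :=
          ((hU.continuous x).comp (by fun_prop)).intervalIntegrable _ _
        simp only [_root_.map_add]
        rw [intervalIntegral.integral_add (hi x) (hi y), smul_add]
      map_smul' := fun a x => by
        simp only [map_smul, RingHom.id_apply]
        rw [intervalIntegral.integral_smul, smul_comm] } 1 fun x => by
    have h1 := intervalIntegral.norm_integral_le_of_norm_le_const (C := ‖x‖) (a := 0) (b := ε)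
      (f := fun s => U (c * s) x) (fun s _ => by simp)
    simp only [LinearMap.coe_mk, AddHom.coe_mk, norm_smul, norm_inv, Real.norm_eq_abs, one_mul]
    rw [sub_zero] at h1
    refine (mul_le_mul_of_nonneg_left h1 (by positivity)).trans ?_
    rw [mul_left_comm]
    exact mul_le_of_le_one_right (norm_nonneg _) (inv_mul_le_one)

omit [CompleteSpace H] in
theorem average_apply (c ε : ℝ) (x : H) :
    hU.average c ε x = (ε⁻¹ : ℝ) • ∫ s in (0 : ℝ)..ε, U (c * s) x := rfl

omit [CompleteSpace H] in
theorem norm_average_le (c ε : ℝ) (x : H) : ‖hU.average c ε x‖ ≤ ‖x‖ := by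
  have h := (hU.average c ε).le_opNorm x
  exact h.trans (mul_le_of_le_one_left (norm_nonneg _)
    (LinearMap.mkContinuous_norm_le _ zero_le_one _))

/-- The adjoint of `U_s` is `U_{-s}`, so the averages with `c = 1` and `c = -1` are adjoint to each
other. -/
theorem inner_average_neg (ε : ℝ) (x y : H) :
    ⟪x, hU.average (-1) ε y⟫_ℂ = ⟪hU.average 1 ε x, y⟫_ℂ := by
  have hi (c : ℝ) (x : H) : IntervalIntegrable (fun s => U (c * s) x) volume 0 ε :=
    ((hU.continuous x).comp (by fun_prop)).intervalIntegrable _ _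
  have h1 : ∫ s in (0 : ℝ)..ε, ⟪x, U (-1 * s) y⟫_ℂ = ⟪x, ∫ s in (0 : ℝ)..ε, U (-1 * s) y⟫_ℂ :=
    (innerSL ℂ x).intervalIntegral_comp_comm (hi (-1) y)
  have h2 : ∫ s in (0 : ℝ)..ε, ⟪y, U (1 * s) x⟫_ℂ = ⟪y, ∫ s in (0 : ℝ)..ε, U (1 * s) x⟫_ℂ :=
    (innerSL ℂ y).intervalIntegral_comp_comm (hi 1 x)
  have h3 : ⟪∫ s in (0 : ℝ)..ε, U (1 * s) x, y⟫_ℂ = ∫ s in (0 : ℝ)..ε, ⟪U (1 * s) x, y⟫_ℂ := by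
    rw [← inner_conj_symm, ← h2]
    simp only [intervalIntegral, map_sub, ← integral_conj, inner_conj_symm]
  rw [average_apply, average_apply, ← Complex.coe_smul, ← Complex.coe_smul, inner_smul_right,
    inner_smul_left, conj_ofReal, ← h1, h3]
  congr 2
  funext s
  rw [hU.inner_apply_right]
  simp

theorem apply_average (c ε t : ℝ) (x : H) : U t (hU.average c ε x) = hU.average c ε (U t x) := by
  have hi (x : H) : IntervalIntegrable (fun s => U (c * s) x) volume 0 ε :=
    ((hU.continuous x).comp (by fun_prop)).intervalIntegrable _ _
  have h1 : ∫ s in (0 : ℝ)..ε, U t (U (c * s) x) = U t (∫ s in (0 : ℝ)..ε, U (c * s) x) :=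
    (U t).toContinuousLinearEquiv.toContinuousLinearMap.intervalIntegral_comp_comm (hi x)
  rw [average_apply, average_apply, ← Complex.coe_smul, map_smul, ← h1, Complex.coe_smul]
  congr 2
  funext s
  exact hU.comm_apply _ _ _

/-- The range of the averages lies in the domain of the generator. -/
theorem hasDerivAt_average (ε : ℝ) (x : H) :
    HasDerivAt (fun t => U t (hU.average 1 ε x)) ((ε⁻¹ : ℝ) • (U ε x - x)) 0 := by
  have hc := hU.continuous x
  -- The moved average is `ε⁻¹ ∫_t^{t+ε} U_s x ds`, a difference of primitives, so it is
  -- differentiable for every `x`.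
  have e : (fun t => U t (hU.average 1 ε x)) =
      fun t => (ε⁻¹ : ℝ) • ((∫ s in (0 : ℝ)..(t + ε), U s x) - ∫ s in (0 : ℝ)..t, U s x) := by
    funext t
    rw [hU.apply_average, average_apply]
    congr 1
    rw [intervalIntegral.integral_interval_sub_left (hc.intervalIntegrable _ _)
      (hc.intervalIntegrable _ _)]
    have := intervalIntegral.integral_comp_add_right (fun s => U s x) (a := 0) (b := ε) t
    rw [zero_add, add_comm ε t] at this
    rw [← this]
    congr 1
    funext s
    rw [one_mul, hU.add_apply]
  rw [e]
  have h1 (t : ℝ) : HasDerivAt (fun t => ∫ s in (0 : ℝ)..t, U s x) (U t x) t :=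
    intervalIntegral.integral_hasDerivAt_right (hc.intervalIntegrable _ _)
      hc.aestronglyMeasurable.stronglyMeasurableAtFilter hc.continuousAt
  have h2 : HasDerivAt
      (fun t => (ε⁻¹ : ℝ) • ((∫ s in (0 : ℝ)..(t + ε), U s x) - ∫ s in (0 : ℝ)..t, U s x))
      ((ε⁻¹ : ℝ) • (U (0 + ε) x - U 0 x)) 0 :=
    (((h1 (0 + ε)).comp_add_const 0 ε).sub (h1 0)).const_smul (ε⁻¹ : ℝ)
  rwa [zero_add, hU.zero_apply] at h2

theorem tendsto_average (c : ℝ) (x : H) :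
    Tendsto (fun ε => hU.average c ε x) (𝓝[≠] 0) (𝓝 x) := by
  have hc : Continuous fun s => U (c * s) x := (hU.continuous x).comp (by fun_prop)
  have h1 : HasDerivAt (fun t => ∫ s in (0 : ℝ)..t, U (c * s) x) (U (c * 0) x) 0 :=
    intervalIntegral.integral_hasDerivAt_right (hc.intervalIntegrable _ _)
      hc.aestronglyMeasurable.stronglyMeasurableAtFilter hc.continuousAt
  simpa [hU.zero_apply, average_apply] using h1.tendsto_slope_zero

/-- The bounded approximation `A_ε^* G A_ε` of the generator `G`. -/
noncomputable def approxGenerator (ε : ℝ) : H →L[ℂ] H :=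
  (hU.average (-1) ε).comp
    ((-I * (ε⁻¹ : ℝ)) • ((U ε).toContinuousLinearEquiv.toContinuousLinearMap - 1))

omit [CompleteSpace H] in
theorem approxGenerator_apply (ε : ℝ) (x : H) :
    hU.approxGenerator ε x = hU.average (-1) ε (-I • (ε⁻¹ : ℝ) • (U ε x - x)) := by
  rw [← Complex.coe_smul, smul_smul]; rfl

/-- `⟪v, A^* G A v⟫ = ⟪A v, G A v⟫`, where `A v` lies in the domain of `G` and `G A = -i ε⁻¹ (U_ε -
1)` is bounded and defined everywhere. -/
theorem approxGenerator_nonneg (hpos : ∀ x y, HasDerivAt (fun t => U t x) (I • y) 0 → 0 ≤ ⟪x, y⟫_ℂ)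
    (ε : ℝ) (v : H) : 0 ≤ ⟪v, hU.approxGenerator ε v⟫_ℂ := by
  rw [approxGenerator_apply, inner_average_neg]
  refine hpos _ _ ?_
  rw [smul_smul, show I * -I = 1 by simp, one_smul]
  exact hU.hasDerivAt_average ε v

theorem apply_approxGenerator (ε t : ℝ) (x : H) :
    U t (hU.approxGenerator ε x) = hU.approxGenerator ε (U t x) := by
  rw [approxGenerator_apply, apply_average, approxGenerator_apply, ← Complex.coe_smul,
    ← Complex.coe_smul]
  congr 1
  rw [map_smul, map_smul, map_sub, hU.comm_apply]

/-- The difference quotients of `U_t x` converge to `iy`, and the averages are contractions that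
converge strongly to the identity. -/
theorem tendsto_approxGenerator {x y : H} (h : HasDerivAt (fun t => U t x) (I • y) 0) :
    Tendsto (fun ε => hU.approxGenerator ε x) (𝓝[≠] 0) (𝓝 y) := by
  have hs := h.tendsto_slope_zero
  simp only [zero_add, hU.zero_apply] at hs
  have hs2 := hs.const_smul (-I)
  rw [smul_smul, show -I * I = 1 by simp, one_smul] at hs2
  have h1 : Tendsto (fun ε => hU.average (-1) ε (-I • (ε⁻¹ : ℝ) • (U ε x - x) - y))
      (𝓝[≠] 0) (𝓝 0) := by
    refine squeeze_zero_norm (fun ε => hU.norm_average_le _ _ _) ?_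
    exact tendsto_iff_norm_sub_tendsto_zero.1 hs2
  have h2 := h1.add (hU.tendsto_average (-1) y)
  simp only [map_sub, sub_add_cancel, zero_add] at h2
  simpa only [approxGenerator_apply] using h2

/-- Duhamel's argument: as `G` commutes with `U`, the curve `e^{-isG} U_s x` has speed at most `‖G x
- y‖`; integrate from `0` to `t` and apply the contraction `e^{itG}`. The factor `|t|` is why limits
of Hardy functions are needed with the weight `|t + i|`. -/
theorem norm_exp_sub_le {G : H →L[ℂ] H} (hG : ∀ v, 0 ≤ ⟪v, G v⟫_ℂ)
    (hcomm : ∀ t x, U t (G x) = G (U t x)) {x y : H}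
    (h : HasDerivAt (fun t => U t x) (I • y) 0) (t : ℝ) :
    ‖NormedSpace.exp (((t : ℂ) * I) • G) x - U t x‖ ≤ ‖G x - y‖ * |t| := by
  have hd (s : ℝ) : HasDerivAt (fun s : ℝ => NormedSpace.exp (s • (-I • G)) (U s x))
      (NormedSpace.exp (s • (-I • G)) (I • U s (y - G x))) s := by
    have h1 := hasDerivAt_exp_smul_const (𝕂 := ℝ) (-I • G) s
    refine (hasDerivAt_clm_apply h1 (hU.hasDerivAt h s)).congr_deriv ?_
    rw [mul_apply_eq_comp, ← _root_.map_add]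
    congr 1
    rw [_root_.smul_apply, map_sub, map_smul, hcomm]
    simp only [neg_smul, smul_sub]; abel
  have hb := convex_univ.norm_image_sub_le_of_norm_hasDerivWithin_le (C := ‖G x - y‖)
    (f := fun s : ℝ => NormedSpace.exp (s • (-I • G)) (U s x)) (x := 0) (y := t)
    (fun s _ => (hd s).hasDerivWithinAt) (fun s _ => by
      have : s • (-I • G) = (-(s : ℂ) * I) • G := by
        rw [← Complex.coe_smul, smul_smul]; congr 1; ring
      rw [this]
      refine (norm_exp_smul_apply_le hG (by simp) _).trans ?_
      rw [norm_smul, norm_I, one_mul, LinearIsometryEquiv.norm_map, norm_sub_rev])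
    (Set.mem_univ _) (Set.mem_univ _)
  simp only [zero_smul, NormedSpace.exp_zero, one_apply_eq_self, hU.zero_apply,
    sub_zero, Real.norm_eq_abs] at hb
  let _ : NormedAlgebra ℚ (H →L[ℂ] H) := NormedAlgebra.restrictScalars ℚ ℂ _
  have hinv : NormedSpace.exp (((t : ℂ) * I) • G) (NormedSpace.exp (t • (-I • G)) (U t x)) = U t x := by
    rw [← mul_apply_eq_comp, ← NormedSpace.exp_add_of_commute]
    · rw [← Complex.coe_smul, smul_smul, ← add_smul]
      simp
    · rw [← Complex.coe_smul, smul_smul]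
      exact ((Commute.refl G).smul_left _).smul_right _
  rw [norm_sub_rev]
  conv_lhs => rw [← hinv]
  rw [← map_sub]
  exact (norm_exp_smul_apply_le hG (by simp) _).trans hb

/-- Matrix elements of a unitary group with nonnegative generator extend to the upper half plane. -/
theorem isHardy_of_nonneg
    (hpos : ∀ x y, HasDerivAt (fun t => U t x) (I • y) 0 → 0 ≤ ⟪x, y⟫_ℂ) (x y : H) :
    IsHardy fun t => ⟪x, U t y⟫_ℂ := by
  have hseq : Tendsto (fun n : ℕ => 1 / ((n : ℝ) + 1)) atTop (𝓝[≠] 0) := by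
    refine tendsto_nhdsWithin_iff.2 ⟨tendsto_one_div_add_atTop_nhds_zero_nat, .of_forall fun n => ?_⟩
    have : (0 : ℝ) < 1 / ((n : ℝ) + 1) := by positivity
    exact this.ne'
  -- On the domain of the generator the approximants `e^{itG_ε}` converge with error `O(|t|)`, and
  -- each has Hardy matrix elements.
  have hdom (x y z : H) (h : HasDerivAt (fun t => U t y) (I • z) 0) :
      IsHardy fun t => ⟪x, U t y⟫_ℂ := by
    refine IsHardy.of_tendsto (C := ‖x‖ * ‖y‖) (fun n : ℕ =>
      isHardy_exp (hU.approxGenerator_nonneg hpos (1 / ((n : ℝ) + 1))) x y) (fun n t => ?_)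
      fun ε hε => ?_
    · refine (norm_inner_le_norm _ _).trans (mul_le_mul_of_nonneg_left ?_ (norm_nonneg _))
      exact norm_exp_smul_apply_le (hU.approxGenerator_nonneg hpos _) (by simp) y
    · have h1 := tendsto_iff_norm_sub_tendsto_zero.1 ((hU.tendsto_approxGenerator h).comp hseq)
      have h2 := h1.const_mul ‖x‖
      rw [mul_zero] at h2
      filter_upwards [h2.eventually (gt_mem_nhds hε)] with n hn t
      rw [← inner_sub_right]
      refine (norm_inner_le_norm _ _).trans ?_
      refine (mul_le_mul_of_nonneg_left (hU.norm_exp_sub_le (hU.approxGenerator_nonneg hpos _)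
        (hU.apply_approxGenerator _) h t) (norm_nonneg _)).trans ?_
      rw [← mul_assoc]
      refine mul_le_mul hn.le ?_ (abs_nonneg _) hε.le
      have := Complex.abs_re_le_norm ((t : ℂ) + I)
      simpa using this
  -- The domain is dense because it contains the averages of every vector.
  refine isHardy_of_dense (S := {y | ∃ z, HasDerivAt (fun t => U t y) (I • z) 0}) ?_ ?_ x y
  · intro y
    refine mem_closure_of_tendsto ((hU.tendsto_average 1 y).comp hseq) (.of_forall fun n => ?_)
    refine ⟨-I • ((1 / ((n : ℝ) + 1))⁻¹ : ℝ) • (U (1 / ((n : ℝ) + 1)) y - y), ?_⟩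
    rw [smul_smul, show I * -I = 1 by simp, one_smul]
    exact hU.hasDerivAt_average _ y
  · rintro x - y ⟨z, hz⟩
    exact hdom x y z hz

end IsUnitaryGroup

/-! ## Sums over pairings and Wick's theorem -/

section Pairings

theorem mem_pairings {n : ℕ} {τ : Equiv.Perm (Fin n)} :
    τ ∈ pairings n ↔ ∀ i, τ (τ i) = i ∧ τ i ≠ i := by
  simp [pairings]

/-- The decomposition of `Fin (n + 2)` into `0`, `j + 1` and the rest. -/
def splitTwo {n : ℕ} (j : Fin (n + 1)) : Fin (n + 2) ≃ Option (Option (Fin n)) :=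
  (finSuccEquiv (n + 1)).trans (Equiv.optionCongr (finSuccEquiv' j))

/-- The pairing of `Fin (n + 2)` that pairs `0` with `j + 1` and the rest by `τ`. -/
def pairZero {n : ℕ} (j : Fin (n + 1)) (τ : Equiv.Perm (Fin n)) : Equiv.Perm (Fin (n + 2)) :=
  (splitTwo j).symm.permCongr
    (Equiv.swap none (some none) * Equiv.optionCongr (Equiv.optionCongr τ))

variable {n : ℕ} (j : Fin (n + 1)) (τ : Equiv.Perm (Fin n))

theorem pairZero_zero : pairZero j τ 0 = j.succ := by
  simp [pairZero, splitTwo, Equiv.permCongr_apply, ← Equiv.optionCongr_symm]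

theorem pairZero_succ : pairZero j τ j.succ = 0 := by
  simp [pairZero, splitTwo, Equiv.permCongr_apply, ← Equiv.optionCongr_symm]

theorem pairZero_succAbove (i : Fin n) :
    pairZero j τ (j.succAbove i).succ = (j.succAbove (τ i)).succ := by
  simp [pairZero, splitTwo, Equiv.permCongr_apply, Equiv.swap_apply_of_ne_of_ne,
    ← Equiv.optionCongr_symm]

theorem fin_two_cases {P : Fin (n + 2) → Prop} (h0 : P 0) (hj : P j.succ)
    (h : ∀ i : Fin n, P (j.succAbove i).succ) (i : Fin (n + 2)) : P i := by
  refine Fin.cases h0 (fun k => ?_) i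
  rcases Fin.eq_self_or_eq_succAbove j k with rfl | ⟨i, rfl⟩
  · exact hj
  · exact h i

theorem pairZero_mem (h : τ ∈ pairings n) : pairZero j τ ∈ pairings (n + 2) := by
  rw [mem_pairings] at h ⊢
  refine fin_two_cases j ?_ ?_ fun i => ?_
  · rw [pairZero_zero, pairZero_succ]
    exact ⟨rfl, Fin.succ_ne_zero j⟩
  · rw [pairZero_succ, pairZero_zero]
    exact ⟨rfl, (Fin.succ_ne_zero j).symm⟩
  · rw [pairZero_succAbove, pairZero_succAbove, (h i).1]
    refine ⟨rfl, fun h' => (h i).2 ?_⟩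
    exact Fin.succAbove_right_injective (Fin.succ_injective _ h')

theorem pairZero_injective {j j' : Fin (n + 1)} {τ τ' : Equiv.Perm (Fin n)}
    (h : pairZero j τ = pairZero j' τ') : j = j' ∧ τ = τ' := by
  have hj : j = j' := by
    have := congrArg (fun σ => σ 0) h
    simp only [pairZero_zero] at this
    exact Fin.succ_injective _ this
  subst hj
  refine ⟨rfl, Equiv.ext fun i => ?_⟩
  have := congrArg (fun σ => σ (j.succAbove i).succ) h
  simp only [pairZero_succAbove] at this
  exact Fin.succAbove_right_injective (Fin.succ_injective _ this)

/-- The partner of `0` determines `j`. An involution that exchanges `0` and `j + 1` preserves the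
remaining indices and restricts to a pairing of them. -/
theorem exists_pairZero {σ : Equiv.Perm (Fin (n + 2))} (h : σ ∈ pairings (n + 2)) :
    ∃ j, ∃ τ ∈ pairings n, pairZero j τ = σ := by
  rw [mem_pairings] at h
  obtain ⟨j, hj⟩ := Fin.exists_succ_eq.2 (h 0).2
  have hj' : σ j.succ = 0 := by rw [hj, (h 0).1]
  have hex (i : Fin n) : ∃ k : Fin n, σ (j.succAbove i).succ = (j.succAbove k).succ := by
    have h0 : σ (j.succAbove i).succ ≠ 0 := fun h' => by
      rw [← hj'] at h'
      exact Fin.succAbove_ne j i (Fin.succ_injective _ (σ.injective h'))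
    have h1 : σ (j.succAbove i).succ ≠ j.succ := fun h' => by
      rw [hj] at h'
      exact Fin.succ_ne_zero _ (σ.injective h')
    revert h0 h1
    refine fin_two_cases j (P := fun m => m ≠ 0 → m ≠ j.succ →
      ∃ k : Fin n, m = (j.succAbove k).succ) ?_ ?_ ?_ _
    · exact fun h => absurd rfl h
    · exact fun _ h => absurd rfl h
    · exact fun k _ _ => ⟨k, rfl⟩
  choose t ht using hex
  have hinv : Function.Involutive t := fun i => by
    have := (h (j.succAbove i).succ).1
    rw [ht, ht] at this
    exact Fin.succAbove_right_injective (Fin.succ_injective _ this)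
  refine ⟨j, hinv.toPerm, ?_, ?_⟩
  · rw [mem_pairings]
    refine fun i => ⟨hinv i, fun h' => (h (j.succAbove i).succ).2 ?_⟩
    have h' : t i = i := h'
    rw [ht, h']
  · refine Equiv.ext (fin_two_cases j ?_ ?_ fun i => ?_)
    · rw [pairZero_zero, hj]
    · rw [pairZero_succ, hj']
    · rw [pairZero_succAbove, ht]; rfl

end Pairings

/-- The sum over all pairings of the products of two-point functions. -/
noncomputable def wickSum {S : Type*} (W : S → S → ℂ) (n : ℕ) (f : Fin n → S) : ℂ :=
  ∑ τ ∈ pairings n, ∏ i with i < τ i, W (f i) (f (τ i))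

/-! ### Wick's recursion and its operator form -/

section Wick
variable {S : Type*} (W : S → S → ℂ)

theorem wickSum_zero (f : Fin 0 → S) : wickSum W 0 f = 1 := by
  have : pairings 0 = {1} := by
    ext τ
    simp [mem_pairings, Subsingleton.elim τ 1]
  simp [wickSum, this]

theorem wickSum_one (f : Fin 1 → S) : wickSum W 1 f = 0 := by
  have : pairings 1 = ∅ := by
    ext τ
    simp [mem_pairings, Subsingleton.elim (τ 0) 0]
  simp [wickSum, this]

/-- Pairings are sorted by the partner `j + 1` of `0`. The enumeration `succAbove` of the other
indices is increasing, so the arguments of each two-point function keep their order. -/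
theorem wickSum_add_two (n : ℕ) (f : Fin (n + 2) → S) : wickSum W (n + 2) f =
    ∑ j : Fin (n + 1), W (f 0) (f j.succ) * wickSum W n fun i => f (j.succAbove i).succ := by
  simp only [wickSum, Finset.mul_sum]
  rw [← Finset.sum_product']
  symm
  refine Finset.sum_bij (fun p _ => pairZero p.1 p.2) ?_ ?_ ?_ ?_
  · exact fun p hp => pairZero_mem _ _ (Finset.mem_product.1 hp).2
  · exact fun p _ q _ h => Prod.ext (pairZero_injective h).1 (pairZero_injective h).2
  · intro σ hσ
    obtain ⟨j, τ, hτ, h⟩ := exists_pairZero hσ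
    exact ⟨(j, τ), by simpa using hτ, h⟩
  · rintro ⟨j, τ⟩ -
    simp only [Finset.prod_filter]
    rw [Fin.prod_univ_succ, Fin.prod_univ_succAbove _ j]
    simp only [pairZero_zero, pairZero_succ, pairZero_succAbove, Fin.succ_pos, if_true,
      Fin.not_lt_zero, if_false, one_mul, Fin.succ_lt_succ_iff, Fin.succAbove_lt_succAbove_iff]

theorem wickSum_odd {n : ℕ} (hn : Odd n) (f : Fin n → S) : wickSum W n f = 0 := by
  induction n using Nat.strong_induction_on with
  | _ n ih =>
    match n, f, hn with
    | 1, f, _ => exact wickSum_one W f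
    | n + 2, f, hn =>
      rw [wickSum_add_two]
      refine Finset.sum_eq_zero fun j _ => ?_
      rw [ih n (by omega) (by simpa [parity_simps] using hn), mul_zero]

variable {F : Type*} [AddCommGroup F] [Module ℂ F]

/-- Creation operators `c` and annihilation operators `d` with `[d ψ, c φ] = W ψ φ`, a vector `e`
annihilated by all `d ψ` and a functional `ε` that vanishes on the ranges of all `c ψ`. -/
structure IsFockData (W : S → S → ℂ) (c d : S → Module.End ℂ F) (e : F) (ε : F →ₗ[ℂ] ℂ) : Prop where
  annihilate : ∀ ψ, d ψ e = 0
  create : ∀ ψ x, ε (c ψ x) = 0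
  normalized : ε e = 1
  comm : ∀ ψ φ x, d ψ (c φ x) = c φ (d ψ x) + W ψ φ • x
  comm_annihilate : ∀ ψ φ x, d ψ (d φ x) = d φ (d ψ x)

namespace IsFockData
variable {W} {c d : S → Module.End ℂ F} {e : F} {ε : F →ₗ[ℂ] ℂ} (h : IsFockData W c d e ε)
include h

/-- Moving `d ψ` to the right past `c φ + d φ` costs the scalar `W ψ φ` and deletes that factor;
once past all factors, `d ψ` annihilates `e`. -/
theorem annihilate_prod (n : ℕ) (f : Fin (n + 1) → S) (ψ : S) :
    d ψ ((List.ofFn fun i => c (f i) + d (f i)).prod e) = ∑ j : Fin (n + 1),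
      W ψ (f j) • (List.ofFn fun i => c (f (j.succAbove i)) + d (f (j.succAbove i))).prod e := by
  have step (φ : S) (x : F) : d ψ ((c φ + d φ) x) = W ψ φ • x + (c φ + d φ) (d ψ x) := by
    simp only [LinearMap.add_apply, _root_.map_add, h.comm, h.comm_annihilate ψ φ]
    abel
  induction n with
  | zero =>
    simp only [List.ofFn_succ, List.ofFn_zero, List.prod_cons, List.prod_nil, Module.End.mul_apply,
      Module.End.one_apply, step, h.annihilate, map_zero, add_zero]
    simp
  | succ n ih =>
    rw [List.ofFn_succ, List.prod_cons, Module.End.mul_apply, step, ih]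
    conv_rhs => rw [Fin.sum_univ_succ]
    congr 1
    rw [map_sum]
    refine Finset.sum_congr rfl fun j _ => ?_
    rw [map_smul, List.ofFn_succ, List.prod_cons, Module.End.mul_apply]
    simp

/-- Wick's theorem. -/
theorem wick (n : ℕ) (f : Fin n → S) :
    ε ((List.ofFn fun i => c (f i) + d (f i)).prod e) = wickSum W n f := by
  induction n using Nat.strong_induction_on with
  | _ n ih =>
    match n, f with
    | 0, f => simp [wickSum_zero, h.normalized]
    | 1, f => simp [wickSum_one, h.create, h.annihilate]
    | n + 2, f =>
      -- `ε` kills the leading `c (f 0)`; moving `d (f 0)` through the product reproduces the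
      -- recursion of `wickSum`.
      rw [List.ofFn_succ, List.prod_cons, Module.End.mul_apply, LinearMap.add_apply,
        _root_.map_add, h.create, zero_add, h.annihilate_prod, map_sum, wickSum_add_two]
      refine Finset.sum_congr rfl fun j _ => ?_
      rw [map_smul, smul_eq_mul, ih n (by omega)]

end IsFockData
end Wick

/-! ## Polynomial Fock spaces -/

section PolynomialFock
open MvPolynomial

/-- Multiplication by linear forms and constant-coefficient derivations on polynomials. -/
theorem isFockData_mvPolynomial {S ι : Type*} {W : S → S → ℂ} {L : S → MvPolynomial ι ℂ}
    {v : S → ι → ℂ} (hL : ∀ ψ, constantCoeff (L ψ) = 0)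
    (hW : ∀ ψ φ, (mkDerivation ℂ (fun i => C (v ψ i)) :
      Derivation ℂ (MvPolynomial ι ℂ) (MvPolynomial ι ℂ)) (L φ) = C (W ψ φ)) :
    IsFockData W (fun ψ => LinearMap.mulLeft ℂ (L ψ))
      (fun ψ => (mkDerivation ℂ (fun i => C (v ψ i)) :
        Derivation ℂ (MvPolynomial ι ℂ) (MvPolynomial ι ℂ)).toLinearMap) 1
      (lcoeff ℂ 0) where
  annihilate ψ := by simp
  create ψ x := by
    rw [LinearMap.mulLeft_apply, lcoeff_apply, ← constantCoeff_eq, map_mul, hL, zero_mul]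
  normalized := by simp
  comm ψ φ x := by
    change (mkDerivation ℂ (fun i => C (v ψ i)) :
      Derivation ℂ (MvPolynomial ι ℂ) (MvPolynomial ι ℂ)) (L φ * x) = L φ * _ + _
    rw [Derivation.leibniz, hW, smul_eq_mul, smul_eq_mul, smul_eq_C_mul, mul_comm x]
    rfl
  comm_annihilate ψ φ x := by
    have h : ⁅(mkDerivation ℂ (fun i => C (v ψ i)) :
        Derivation ℂ (MvPolynomial ι ℂ) (MvPolynomial ι ℂ)), mkDerivation ℂ (fun i => C (v φ i))⁆ = 0 :=
      derivation_ext fun i => by rw [Derivation.commutator_apply]; simp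
    have h2 := congrArg (fun D => D x) h
    simp only [Derivation.commutator_apply, Derivation.zero_apply] at h2
    exact sub_eq_zero.1 h2

variable {ι : Type*} [Fintype ι]

/-- The inner product of polynomials for which monomials are orthogonal and `‖X^α‖² = α!`. -/
noncomputable def fockForm (p q : MvPolynomial ι ℂ) : ℂ :=
  ∑ α ∈ p.support, (∏ i, (α i).factorial : ℕ) * (starRingEnd ℂ) (coeff α p) * coeff α q

theorem fockForm_eq_sum {p : MvPolynomial ι ℂ} {s : Finset (ι →₀ ℕ)} (hs : p.support ⊆ s)
    (q : MvPolynomial ι ℂ) : fockForm p q =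
      ∑ α ∈ s, (∏ i, (α i).factorial : ℕ) * (starRingEnd ℂ) (coeff α p) * coeff α q := by
  refine Finset.sum_subset hs fun α _ h => ?_
  rw [notMem_support_iff.1 h]
  simp

theorem fockForm_conj (p q : MvPolynomial ι ℂ) : (starRingEnd ℂ) (fockForm p q) = fockForm q p := by
  classical
  rw [fockForm_eq_sum (Finset.subset_union_left (s₂ := q.support)),
    fockForm_eq_sum (Finset.subset_union_right (s₁ := p.support)), map_sum]
  refine Finset.sum_congr rfl fun α _ => ?_
  simp only [map_mul, conj_conj, map_natCast]
  ring

theorem fockForm_sum_right {κ : Type*} (s : Finset κ) (p : MvPolynomial ι ℂ) (c : κ → ℂ)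
    (q : κ → MvPolynomial ι ℂ) :
    fockForm p (∑ k ∈ s, c k • q k) = ∑ k ∈ s, c k * fockForm p (q k) := by
  simp only [fockForm, coeff_sum, coeff_smul, Finset.mul_sum, smul_eq_mul]
  rw [Finset.sum_comm]
  refine Finset.sum_congr rfl fun k _ => Finset.sum_congr rfl fun α _ => by ring

theorem fockForm_sum_left {κ : Type*} (s : Finset κ) (p : MvPolynomial ι ℂ) (c : κ → ℂ)
    (q : κ → MvPolynomial ι ℂ) :
    fockForm (∑ k ∈ s, c k • q k) p = ∑ k ∈ s, (starRingEnd ℂ) (c k) * fockForm (q k) p := by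
  rw [← fockForm_conj, fockForm_sum_right, map_sum]
  exact Finset.sum_congr rfl fun k _ => by rw [map_mul, fockForm_conj]

theorem fockForm_add_right (p q r : MvPolynomial ι ℂ) :
    fockForm p (q + r) = fockForm p q + fockForm p r := by
  simp only [fockForm, coeff_add, mul_add, Finset.sum_add_distrib]

theorem fockForm_add_left (p q r : MvPolynomial ι ℂ) :
    fockForm (p + q) r = fockForm p r + fockForm q r := by
  rw [← fockForm_conj, fockForm_add_right, map_add, fockForm_conj, fockForm_conj]

theorem fockForm_self_nonneg (p : MvPolynomial ι ℂ) : 0 ≤ fockForm p p := by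
  refine Finset.sum_nonneg fun α _ => ?_
  rw [mul_assoc, ← Complex.normSq_eq_conj_mul_self]
  exact mul_nonneg (by exact_mod_cast Nat.zero_le _) (by exact_mod_cast Complex.normSq_nonneg _)

theorem fockForm_one_left (q : MvPolynomial ι ℂ) : fockForm 1 q = coeff 0 q := by
  rw [fockForm, support_one, Finset.sum_singleton]
  simp

/-- Multiplication by `X i` and `∂ i` are adjoint because `(α + e_i)! = (α_i + 1) α!`, and `α_i + 1`
is the factor produced by differentiation. -/
theorem fockForm_X_mul (i : ι) (p q : MvPolynomial ι ℂ) :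
    fockForm (X i * p) q = fockForm p (pderiv i q) := by
  classical
  rw [fockForm, support_X_mul, Finset.sum_map, fockForm]
  refine Finset.sum_congr rfl fun α _ => ?_
  have h1 : addLeftEmbedding (Finsupp.single i 1) α = Finsupp.single i 1 + α := rfl
  rw [h1, coeff_X_mul, coeff_pderiv, add_comm (Finsupp.single i 1) α]
  have h2 : ∏ j, ((α + Finsupp.single i 1 : ι →₀ ℕ) j).factorial = (α i + 1) * ∏ j, (α j).factorial := by
    rw [← Finset.mul_prod_erase Finset.univ _ (Finset.mem_univ i),
      ← Finset.mul_prod_erase Finset.univ (fun j => (α j).factorial) (Finset.mem_univ i), ← mul_assoc]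
    congr 1
    · simp [Nat.factorial_succ]
    · refine Finset.prod_congr rfl fun j hj => ?_
      have := Finset.ne_of_mem_erase hj
      simp [Finsupp.single_eq_of_ne this]
  rw [h2]
  push_cast
  ring

omit [Fintype ι] in
theorem derivation_sum_apply {κ : Type*} (s : Finset κ)
    (D : κ → Derivation ℂ (MvPolynomial ι ℂ) (MvPolynomial ι ℂ)) (p : MvPolynomial ι ℂ) :
    (∑ k ∈ s, D k) p = ∑ k ∈ s, D k p := by
  have := congrArg (fun f => f p) (map_sum (Derivation.coeFnAddMonoidHom (R := ℂ)
    (A := MvPolynomial ι ℂ) (M := MvPolynomial ι ℂ)) D s)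
  rw [Finset.sum_apply] at this
  exact this

/-- The operator `∑ᵢ vᵢ Xᵢ + conj vᵢ ∂ᵢ` on polynomials. -/
noncomputable def segalField (v : ι → ℂ) : Module.End ℂ (MvPolynomial ι ℂ) :=
  LinearMap.mulLeft ℂ (∑ i, v i • X i) + (mkDerivation ℂ (fun i => C ((starRingEnd ℂ) (v i))) :
    Derivation ℂ (MvPolynomial ι ℂ) (MvPolynomial ι ℂ)).toLinearMap

theorem segalField_apply (v : ι → ℂ) (p : MvPolynomial ι ℂ) : segalField v p =
    ∑ i, v i • (X i * p) + ∑ i, (starRingEnd ℂ) (v i) • pderiv i p := by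
  have h : (mkDerivation ℂ (fun i => C ((starRingEnd ℂ) (v i))) :
      Derivation ℂ (MvPolynomial ι ℂ) (MvPolynomial ι ℂ)) =
      ∑ i, (starRingEnd ℂ) (v i) • pderiv i := by
    classical
    refine derivation_ext fun j => ?_
    rw [mkDerivation_X, derivation_sum_apply, Finset.sum_eq_single j]
    · simp [smul_eq_C_mul]
    · intro i _ hij
      simp [pderiv_X_of_ne hij.symm]
    · simp
  rw [segalField, h, LinearMap.add_apply, LinearMap.mulLeft_apply, Finset.sum_mul]
  congr 1
  · simp
  · simp [derivation_sum_apply]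

/-- The adjoint of `v_i X_i` is `conj(v_i) ∂_i`, so the two sums in the field operator are
exchanged. -/
theorem fockForm_segalField (v : ι → ℂ) (p q : MvPolynomial ι ℂ) :
    fockForm (segalField v p) q = fockForm p (segalField v q) := by
  rw [segalField_apply, segalField_apply, fockForm_add_left, fockForm_add_right, fockForm_sum_left,
    fockForm_sum_left, fockForm_sum_right, fockForm_sum_right, add_comm]
  congr 1
  · refine Finset.sum_congr rfl fun i _ => ?_
    rw [conj_conj, ← fockForm_conj, ← fockForm_X_mul, fockForm_conj]
  · exact Finset.sum_congr rfl fun i _ => by rw [fockForm_X_mul]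

theorem isFockData_segalField {S : Type*} (v : S → ι → ℂ) :
    IsFockData (fun ψ φ => ∑ i, (starRingEnd ℂ) (v ψ i) * v φ i)
      (fun ψ => LinearMap.mulLeft ℂ (∑ i, v ψ i • X i))
      (fun ψ => (mkDerivation ℂ (fun i => C ((starRingEnd ℂ) (v ψ i))) :
        Derivation ℂ (MvPolynomial ι ℂ) (MvPolynomial ι ℂ)).toLinearMap) 1
      (lcoeff ℂ 0) := by
  refine isFockData_mvPolynomial (fun ψ => ?_) fun ψ φ => ?_
  · simp [smul_eq_C_mul]
  · simp only [map_sum, Derivation.map_smul, mkDerivation_X, map_mul]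
    exact Finset.sum_congr rfl fun i _ => by rw [smul_eq_C_mul, mul_comm]

theorem fockForm_prod_segalField {S : Type*} (v : S → ι → ℂ) (l : List S) (p q : MvPolynomial ι ℂ) :
    fockForm ((l.map fun ψ => segalField (v ψ)).prod p) q =
      fockForm p ((l.reverse.map fun ψ => segalField (v ψ)).prod q) := by
  induction l generalizing q with
  | nil => simp
  | cons ψ l ih =>
    simp only [List.map_cons, List.prod_cons, Module.End.mul_apply, fockForm_segalField, ih,
      List.reverse_cons, List.map_append, List.prod_append, List.map_nil, List.prod_nil, mul_one]

end PolynomialFock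

/-! ## Positivity of quasi-free functionals -/

/-- The sum over pairings of the entries of a list. -/
noncomputable def wickList {S : Type*} (W : S → S → ℂ) (l : List S) : ℂ := wickSum W l.length l.get

theorem IsFockData.wickList {S F : Type*} [AddCommGroup F] [Module ℂ F] {W : S → S → ℂ}
    {c d : S → Module.End ℂ F} {e : F} {ε : F →ₗ[ℂ] ℂ} (h : IsFockData W c d e ε) (l : List S) :
    ε ((l.map fun ψ => c ψ + d ψ).prod e) = wickList W l := by
  have := h.wick l.length l.get
  rw [CosmoHorizon.wickList, ← this]
  congr 3
  conv_lhs => rw [← List.ofFn_get l, List.map_ofFn]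
  rfl

theorem wickList_congr {S : Type*} {W W' : S → S → ℂ} {l : List S}
    (h : ∀ ψ ∈ l, ∀ φ ∈ l, W ψ φ = W' ψ φ) : wickList W l = wickList W' l :=
  Finset.sum_congr rfl fun _ _ => Finset.prod_congr rfl fun _ _ =>
    h _ (List.get_mem _ _) _ (List.get_mem _ _)

/-- On a finite set, a Gram kernel is the Gram kernel of vectors in some `ℂᵐ`. -/
theorem exists_finite_gram {S H : Type*} [NormedAddCommGroup H] [InnerProductSpace ℂ H] (K : S → H)
    (T : Finset S) : ∃ (m : ℕ) (v : S → Fin m → ℂ), ∀ ψ ∈ T, ∀ φ ∈ T,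
      ⟪K ψ, K φ⟫_ℂ = ∑ i, (starRingEnd ℂ) (v ψ i) * v φ i := by
  let E : Submodule ℂ H := Submodule.span ℂ (K '' T)
  have : FiniteDimensional ℂ E := FiniteDimensional.span_of_finite ℂ (T.finite_toSet.image K)
  let b := stdOrthonormalBasis ℂ E
  refine ⟨_, fun ψ i => ⟪(b i : H), K ψ⟫_ℂ, fun ψ hψ φ hφ => ?_⟩
  have hm {ψ : S} (h : ψ ∈ T) : K ψ ∈ E := Submodule.subset_span ⟨ψ, h, rfl⟩
  have := b.sum_inner_mul_inner (⟨K ψ, hm hψ⟩ : E) ⟨K φ, hm hφ⟩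
  simp only [Submodule.coe_inner] at this
  rw [← this]
  exact Finset.sum_congr rfl fun i _ => by rw [inner_conj_symm]

/-- Only finitely many vectors `K ψ` occur, so they may be taken in some `ℂᵐ`. There the double sum
is the squared Fock norm of `∑ c_l Φ(l) 1`, where `Φ(l)` is the product of the symmetric field
operators along `l`; symmetry moves `Φ(l)` across the form as the reversed product. -/
theorem wickList_nonneg {S H : Type*} [NormedAddCommGroup H] [InnerProductSpace ℂ H] (K : S → H)
    (s : Finset (List S)) (c : List S → ℂ) :
    0 ≤ ∑ l ∈ s, ∑ l' ∈ s, (starRingEnd ℂ) (c l) * c l' *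
      wickList (fun ψ φ => ⟪K ψ, K φ⟫_ℂ) (l.reverse ++ l') := by
  classical
  obtain ⟨m, v, hv⟩ := exists_finite_gram K (s.biUnion List.toFinset)
  have h := fockForm_self_nonneg (∑ l ∈ s, c l • (l.map fun ψ => segalField (v ψ)).prod 1)
  rw [fockForm_sum_left] at h
  refine h.trans_eq (Finset.sum_congr rfl fun l hl => ?_)
  rw [fockForm_sum_right, Finset.mul_sum]
  refine Finset.sum_congr rfl fun l' hl' => ?_
  have hmem {ψ : S} (hψ : ψ ∈ l.reverse ++ l') : ψ ∈ s.biUnion List.toFinset := by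
    rcases List.mem_append.1 hψ with h | h
    · exact Finset.mem_biUnion.2 ⟨l, hl, by simpa using h⟩
    · exact Finset.mem_biUnion.2 ⟨l', hl', by simpa using h⟩
  rw [wickList_congr fun ψ hψ φ hφ => hv ψ (hmem hψ) φ (hmem hφ),
    ← (isFockData_segalField v).wickList, fockForm_prod_segalField, fockForm_one_left, mul_assoc,
    List.map_append, List.prod_append, Module.End.mul_apply]
  rfl

/-! ## Quasi-free states of the boundary algebra -/

/-- The product `[ψ₁] ⋯ [ψₙ]`. -/
noncomputable def word (l : List Sc) : Ac := (l.map field).prod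

theorem word_append (l l' : List Sc) : word (l ++ l') = word l * word l' := by simp [word]

theorem star_word (l : List Sc) : star (word l) = word l.reverse := by
  induction l with
  | nil => simp [word]
  | cons ψ l ih =>
    rw [List.reverse_cons, word_append, ← ih]
    simp [word, star_mul, star_field]

theorem word_ofFn {n : ℕ} (f : Fin n → Sc) : word (List.ofFn f) = (List.ofFn fun i => field (f i)).prod := by
  rw [word, List.map_ofFn]; rfl

/-- `A_c` is a quotient of the tensor algebra, which is generated by degree one; so linear
functionals on `A_c` can be compared on words alone. -/
theorem span_word : Submodule.span ℂ (Set.range word) = ⊤ := by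
  have h1 : Algebra.adjoin ℂ (Set.range field) = ⊤ := by
    rw [eq_top_iff]
    rintro x -
    obtain ⟨x, rfl⟩ := RingQuot.mkAlgHom_surjective ℂ CCRRel x
    change toAc x ∈ _
    induction x using TensorProduct.induction_on with
    | zero => rw [map_zero]; exact zero_mem _
    | add x y hx hy => rw [map_add]; exact add_mem hx hy
    | tmul z t =>
      have hz : z ⊗ₜ[ℝ] t = z • ((1 : ℂ) ⊗ₜ[ℝ] t) := by rw [TensorProduct.smul_tmul']; simp
      rw [hz, map_smul]
      refine Subalgebra.smul_mem _ ?_ z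
      clear hz
      induction t using TensorAlgebra.induction with
      | algebraMap r =>
        have : (1 : ℂ) ⊗ₜ[ℝ] algebraMap ℝ (TensorAlgebra ℝ Sc) r = algebraMap ℂ Tc (r : ℂ) := by
          rw [Algebra.algebraMap_eq_smul_one, ← TensorProduct.smul_tmul,
            Algebra.TensorProduct.algebraMap_apply]
          simp
        rw [this, AlgHom.commutes]
        exact Subalgebra.algebraMap_mem _ _
      | ι v => exact Algebra.subset_adjoin ⟨v, rfl⟩
      | mul a b ha hb =>
        have : (1 : ℂ) ⊗ₜ[ℝ] (a * b) = ((1 : ℂ) ⊗ₜ[ℝ] a) * ((1 : ℂ) ⊗ₜ[ℝ] b) := by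
          rw [Algebra.TensorProduct.tmul_mul_tmul, one_mul]
        rw [this, map_mul]
        exact mul_mem ha hb
      | add a b ha hb => rw [TensorProduct.tmul_add, map_add]; exact add_mem ha hb
  have h2 : (Submonoid.closure (Set.range field) : Set Ac) ⊆ Set.range word := by
    intro x hx
    induction hx using Submonoid.closure_induction with
    | mem x hx =>
      obtain ⟨ψ, rfl⟩ := hx
      exact ⟨[ψ], by simp [word]⟩
    | one => exact ⟨[], by simp [word]⟩
    | mul x y _ _ hx hy =>
      obtain ⟨l, rfl⟩ := hx
      obtain ⟨l', rfl⟩ := hy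
      exact ⟨l ++ l', word_append l l'⟩
  have h3 := congrArg Subalgebra.toSubmodule h1
  rw [Algebra.adjoin_eq_span, Algebra.top_toSubmodule] at h3
  rw [eq_top_iff, ← h3]
  exact Submodule.span_mono h2

theorem exists_sum_word (x : Ac) : ∃ (s : Finset (List Sc)) (c : List Sc → ℂ),
    x = ∑ l ∈ s, c l • word l := by
  have hx : x ∈ Submodule.span ℂ (Set.range word) := span_word ▸ Submodule.mem_top
  obtain ⟨c, rfl⟩ := (Finsupp.mem_span_range_iff_exists_finsupp).1 hx
  exact ⟨c.support, c, rfl⟩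

theorem linearMap_ext_word {M : Type*} [AddCommMonoid M] [Module ℂ M] {w w' : Ac →ₗ[ℂ] M}
    (h : ∀ l, w (word l) = w' (word l)) : w = w' :=
  LinearMap.ext_on_range span_word h

theorem wickList_ofFn {S : Type*} (W : S → S → ℂ) {n : ℕ} (f : Fin n → S) :
    wickList W (List.ofFn f) = wickSum W n f := by
  have key (m : ℕ) (g : Fin m → S) (hm : m = n) (hg : ∀ i, g i = f (Fin.cast hm i)) :
      wickSum W m g = wickSum W n f := by
    subst hm
    congr 1
    funext i
    exact hg i
  exact key _ _ (List.length_ofFn) fun i => by simp; rfl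

/-- The sum over pairings vanishes for odd length, so one formula covers both clauses of
quasi-freeness. -/
theorem IsQuasiFree.apply_word {w : Ac →ₗ[ℂ] ℂ} (hw : IsQuasiFree w) (l : List Sc) :
    w (word l) = wickList (fun ψ φ => w (field ψ * field φ)) l := by
  have h : word l = (List.ofFn fun i => field (l.get i)).prod := by
    rw [← word_ofFn, List.ofFn_get]
  rw [h]
  rcases Nat.even_or_odd l.length with he | ho
  · exact hw.even _ _ he
  · rw [hw.odd _ _ ho, wickList, wickSum_odd _ ho]

theorem wickList_pair {S : Type*} (W : S → S → ℂ) (ψ φ : S) : wickList W [ψ, φ] = W ψ φ := by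
  have : wickList W [ψ, φ] = wickSum W 2 [ψ, φ].get := rfl
  rw [this, wickSum_add_two]
  simp [wickSum_zero]

theorem isQuasiFree_of_word {w : Ac →ₗ[ℂ] ℂ} (hw : IsState w) {W : Sc → Sc → ℂ}
    (h : ∀ l, w (word l) = wickList W l) :
    IsQuasiFree w ∧ ∀ ψ φ, w (field ψ * field φ) = W ψ φ := by
  have h2 (ψ φ : Sc) : w (field ψ * field φ) = W ψ φ := by
    have := h [ψ, φ]
    rw [wickList_pair] at this
    rw [← this]
    simp [word]
  refine ⟨⟨hw, fun n f hn => ?_, fun n f hn => ?_⟩, h2⟩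
  · rw [← word_ofFn, h, wickList_ofFn, wickSum_odd _ hn]
  · rw [← word_ofFn, h, wickList_ofFn]
    simp only [h2]
    rfl

/-- Quasi-free states are determined by their two-point functions. -/
theorem IsQuasiFree.ext {w w' : Ac →ₗ[ℂ] ℂ} (hw : IsQuasiFree w) (hw' : IsQuasiFree w')
    (h : ∀ ψ φ, w (field ψ * field φ) = w' (field ψ * field φ)) : w = w' := by
  refine linearMap_ext_word fun l => ?_
  rw [hw.apply_word, hw'.apply_word]
  simp only [h]

/-- The universal property of `A_c`. -/
theorem exists_algHom {B : Type*} [Ring B] [Algebra ℂ B] (Φ : Sc → B)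
    (hadd : ∀ ψ φ, Φ (ψ + φ) = Φ ψ + Φ φ) (hsmul : ∀ (r : ℝ) ψ, Φ (r • ψ) = (r : ℂ) • Φ ψ)
    (hΦ : ∀ ψ φ, Φ ψ * Φ φ - Φ φ * Φ ψ = algebraMap ℂ B (I * (sigmaC ψ φ : ℂ))) :
    ∃ F : Ac →ₐ[ℂ] B, ∀ ψ, F (field ψ) = Φ ψ := by
  let _ : Algebra ℝ B := Algebra.compHom B (algebraMap ℝ ℂ)
  have : IsScalarTower ℝ ℂ B := ⟨fun r z b => by
    change _ = (r : ℂ) • (z • b)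
    rw [smul_smul]; simp⟩
  let T : Tc →ₐ[ℂ] B := Algebra.TensorProduct.lift (Algebra.ofId ℂ B)
    (TensorAlgebra.lift ℝ { toFun := Φ, map_add' := hadd, map_smul' := hsmul })
    fun z _ => Algebra.commutes z _
  have hT (ψ : Sc) : T (gen ψ) = Φ ψ := by
    refine (Algebra.TensorProduct.lift_tmul _ _ _ _ _).trans ?_
    rw [map_one, one_mul]
    exact TensorAlgebra.lift_ι_apply _ _
  refine ⟨RingQuot.liftAlgHom ℂ ⟨T, ?_⟩, fun ψ => ?_⟩
  · rintro _ _ ⟨ψ, φ⟩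
    rw [AlgHom.commutes, ← hΦ, map_sub, map_mul, map_mul, hT, hT]
  · rw [← hT]
    exact RingQuot.liftAlgHom_mkAlgHom_apply ℂ _ _ _

/-! ### Construction of quasi-free states from Gram kernels -/

section Existence
open MvPolynomial
variable {H : Type*} [NormedAddCommGroup H] [InnerProductSpace ℂ H] (K : Sc →ₗ[ℝ] H)

/-- Take polynomials in variables indexed by a real basis of `S_c`, and let `[ψ]` act as
multiplication by the linear form of `ψ` plus the derivation with `X_i ↦ ⟪K ψ, K b_i⟫`. Both are
real-linear in `ψ`, and the commutator is `⟪Kψ, Kφ⟫ - ⟪Kφ, Kψ⟫`, so `hK` makes this a representation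
of `A_c`; the constant term of its action on `1` is the functional. The two summands need not be
adjoint here: positivity is a separate matter. -/
theorem exists_word_functional
    (hK : ∀ ψ φ, ⟪K ψ, K φ⟫_ℂ - ⟪K φ, K ψ⟫_ℂ = I * (sigmaC ψ φ : ℂ)) :
    ∃ w : Ac →ₗ[ℂ] ℂ, ∀ l, w (word l) = wickList (fun ψ φ => ⟪K ψ, K φ⟫_ℂ) l := by
  let b := Module.Basis.ofVectorSpace ℝ Sc
  let ι := Module.Basis.ofVectorSpaceIndex ℝ Sc
  let L : Sc →ₗ[ℝ] MvPolynomial ι ℂ := b.constr ℝ X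
  let D (ψ : Sc) : Derivation ℂ (MvPolynomial ι ℂ) (MvPolynomial ι ℂ) :=
    mkDerivation ℂ fun i => C ⟪K ψ, K (b i)⟫_ℂ
  have hL (ψ : Sc) : L ψ = (b.repr ψ).sum fun i r => r • X i := by
    simp only [L, Module.Basis.constr_apply]
  have hreal (r : ℝ) (p : MvPolynomial ι ℂ) : r • p = (r : ℂ) • p := by
    ext; simp [coeff_smul]
  have hdata := isFockData_mvPolynomial (W := fun ψ φ => ⟪K ψ, K φ⟫_ℂ) (L := L)
    (v := fun ψ i => ⟪K ψ, K (b i)⟫_ℂ) (fun ψ => by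
      rw [hL, Finsupp.sum, map_sum]
      exact Finset.sum_eq_zero fun i _ => by rw [hreal, smul_eq_C_mul]; simp)
    (fun ψ φ => by
      conv_rhs => rw [← b.linearCombination_repr φ, Finsupp.linearCombination_apply, Finsupp.sum,
        map_sum, inner_sum, map_sum]
      rw [hL, Finsupp.sum, map_sum]
      refine Finset.sum_congr rfl fun i _ => ?_
      rw [hreal, Derivation.map_smul, mkDerivation_X, map_smul, ← Complex.coe_smul, inner_smul_right,
        smul_eq_C_mul, map_mul])
  have hD_add (ψ φ : Sc) : D (ψ + φ) = D ψ + D φ := derivation_ext fun i => by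
    simp only [D, mkDerivation_X, Derivation.add_apply, map_add, inner_add_left]
  have hD_smul (r : ℝ) (ψ : Sc) : D (r • ψ) = (r : ℂ) • D ψ := derivation_ext fun i => by
    rw [Derivation.smul_apply]
    simp only [D, mkDerivation_X]
    rw [map_smul, ← Complex.coe_smul, inner_smul_left, conj_ofReal, map_mul, smul_eq_C_mul]
  let Φ (ψ : Sc) : Module.End ℂ (MvPolynomial ι ℂ) := LinearMap.mulLeft ℂ (L ψ) + (D ψ).toLinearMap
  have hΦ (ψ φ : Sc) : Φ ψ * Φ φ - Φ φ * Φ ψ = algebraMap ℂ _ (I * (sigmaC ψ φ : ℂ)) := by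
    refine LinearMap.ext fun p => ?_
    have h1 := hdata.comm ψ φ p
    have h2 := hdata.comm φ ψ p
    have h3 := hdata.comm_annihilate ψ φ p
    change D ψ (L φ * p) = L φ * D ψ p + ⟪K ψ, K φ⟫_ℂ • p at h1
    change D φ (L ψ * p) = L ψ * D φ p + ⟪K φ, K ψ⟫_ℂ • p at h2
    change D ψ (D φ p) = D φ (D ψ p) at h3
    rw [Module.algebraMap_end_apply, ← hK, sub_smul]
    change (L ψ * (L φ * p + D φ p) + D ψ (L φ * p + D φ p)) -
      (L φ * (L ψ * p + D ψ p) + D φ (L ψ * p + D ψ p)) = _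
    rw [Derivation.map_add, Derivation.map_add, h1, h2, h3]
    ring
  obtain ⟨R, hR⟩ := exists_algHom Φ (fun ψ φ => LinearMap.ext fun p => by
      change L (ψ + φ) * p + D (ψ + φ) p = (L ψ * p + D ψ p) + (L φ * p + D φ p)
      rw [hD_add, map_add, Derivation.add_apply]
      ring) (fun r ψ => LinearMap.ext fun p => by
      change L (r • ψ) * p + D (r • ψ) p = (r : ℂ) • (L ψ * p + D ψ p)
      rw [hD_smul, map_smul, Derivation.smul_apply, hreal, smul_add, smul_mul_assoc]) hΦ
  refine ⟨lcoeff ℂ 0 ∘ₗ LinearMap.applyₗ 1 ∘ₗ R.toLinearMap, fun l => ?_⟩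
  rw [← hdata.wickList]
  have : R (word l) = (l.map Φ).prod := by
    rw [word, map_list_prod, List.map_map]
    congr 2
    funext ψ
    exact hR ψ
  change lcoeff ℂ 0 (R (word l) 1) = _
  rw [this]

/-- Existence of the quasi-free state with a given Gram kernel as two-point function. -/
theorem exists_isQuasiFree
    (hK : ∀ ψ φ, ⟪K ψ, K φ⟫_ℂ - ⟪K φ, K ψ⟫_ℂ = I * (sigmaC ψ φ : ℂ)) :
    ∃ w : Ac →ₗ[ℂ] ℂ, IsQuasiFree w ∧ ∀ ψ φ, w (field ψ * field φ) = ⟪K ψ, K φ⟫_ℂ := by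
  obtain ⟨w, hw⟩ := exists_word_functional K hK
  refine ⟨w, isQuasiFree_of_word ⟨?_, fun x => ?_⟩ hw⟩
  · have := hw []
    rw [show word [] = 1 by simp [word]] at this
    rw [this]
    exact wickSum_zero _ _
  · obtain ⟨s, c, rfl⟩ := exists_sum_word x
    refine (wickList_nonneg K s c).trans_eq ?_
    rw [star_sum, Finset.sum_mul, map_sum]
    refine Finset.sum_congr rfl fun l _ => ?_
    rw [Finset.mul_sum, map_sum]
    refine Finset.sum_congr rfl fun l' _ => ?_
    rw [star_smul, star_word, smul_mul_smul_comm, ← word_append, map_smul, hw]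
    rfl

end Existence

/-! ## The GNS construction and implementation of automorphisms -/

/-- Polarization: `w(x^* x)` is real for `x = a + b` and for `x = a + ib`, which compares the
imaginary and the real parts. -/
theorem IsState.conj_symm {w : Ac →ₗ[ℂ] ℂ} (hw : IsState w) (a b : Ac) :
    (starRingEnd ℂ) (w (star b * a)) = w (star a * b) := by
  have him (x : Ac) : (w (star x * x)).im = 0 := (Complex.nonneg_iff.1 (hw.positive x)).2.symm
  have h1 := him (a + b)
  have h2 := him (a + I • b)
  have ha := him a
  have hb := him b
  simp only [star_add, star_smul, add_mul, mul_add, map_add, smul_mul_assoc, mul_smul_comm, map_smul,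
    smul_eq_mul, Complex.add_im, Complex.mul_im, Complex.mul_re, ha, hb, RCLike.star_def, conj_I,
    Complex.neg_im, Complex.neg_re, I_re, I_im] at h1 h2
  refine Complex.ext ?_ ?_
  · rw [Complex.conj_re]; linarith
  · rw [Complex.conj_im]; linarith

/-- The positive semidefinite inner product `ω(a^* b)`. -/
noncomputable abbrev IsState.core {w : Ac →ₗ[ℂ] ℂ} (hw : IsState w) : PreInnerProductSpace.Core ℂ Ac where
  inner a b := w (star a * b)
  conj_inner_symm a b := hw.conj_symm a b
  re_inner_nonneg a := (Complex.nonneg_iff.1 (hw.positive a)).1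
  add_left a b c := by rw [star_add, add_mul, map_add]
  smul_left a b r := by rw [star_smul, smul_mul_assoc, map_smul]; rfl

/-- The left regular representation on the range of a linear map whose kernel is a left ideal. -/
theorem exists_algHom_range {A H : Type*} [Ring A] [Algebra ℂ A] [AddCommGroup H] [Module ℂ H]
    (j : A →ₗ[ℂ] H) (hker : ∀ a x, j x = 0 → j (a * x) = 0) :
    ∃ π : A →ₐ[ℂ] Module.End ℂ (LinearMap.range j),
      ∀ a x, π a (j.rangeRestrict x) = j.rangeRestrict (a * x) := by
  let e := j.quotKerEquivRange
  have he (x : A) : e (Submodule.Quotient.mk x) = j.rangeRestrict x := rfl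
  let P (a : A) : Module.End ℂ (LinearMap.range j) :=
    e.toLinearMap ∘ₗ (LinearMap.ker j).mapQ (LinearMap.ker j) (LinearMap.mulLeft ℂ a)
      (fun x hx => hker a x hx) ∘ₗ e.symm.toLinearMap
  have hP (a x : A) : P a (j.rangeRestrict x) = j.rangeRestrict (a * x) := by
    simp only [P, LinearMap.comp_apply, LinearEquiv.coe_coe, ← he, LinearEquiv.symm_apply_apply]
    rfl
  have hext {f g : Module.End ℂ (LinearMap.range j)}
      (h : ∀ x, f (j.rangeRestrict x) = g (j.rangeRestrict x)) : f = g := by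
    refine LinearMap.ext fun v => ?_
    obtain ⟨x, rfl⟩ := j.surjective_rangeRestrict v
    exact h x
  exact ⟨{
    toFun := P
    map_one' := hext fun x => by rw [hP, one_mul]; rfl
    map_mul' := fun a b => hext fun x => by rw [hP, Module.End.mul_apply, hP, hP, mul_assoc]
    map_zero' := hext fun x => by rw [hP, zero_mul, map_zero]; rfl
    map_add' := fun a b => hext fun x => by
      rw [hP, LinearMap.add_apply, hP, hP, add_mul, map_add]
    commutes' := fun z => hext fun x => by
      rw [hP, Module.algebraMap_end_apply, ← map_smul, Algebra.smul_def] }, hP⟩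

/-- `j` may have a kernel, but `β` preserves the seminorm `‖j ·‖`, so `j a ↦ j (β a)` is well
defined and isometric on a dense range; bijectivity of `β` makes the extension unitary. -/
theorem exists_isometry_extension {A H : Type*} [Ring A] [StarRing A] [Algebra ℂ A]
    [NormedAddCommGroup H] [InnerProductSpace ℂ H] [CompleteSpace H] (j : A →ₗ[ℂ] H)
    (hj : DenseRange j) (β : A ≃⋆ₐ[ℂ] A) (hβ : ∀ x, ‖j (β x)‖ = ‖j x‖) :
    ∃ V : H ≃ₗᵢ[ℂ] H, ∀ a, V (j a) = j (β a) := by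
  let f : A ≃ₗ[ℂ] A := β.toAlgEquiv.toLinearEquiv
  exact ⟨f.extendOfIsometry j j hj hj hβ, f.extendOfIsometry_eq j j hj hj hβ⟩

/-- Data for a GNS quadruple: a Hilbert space with a linear map from `A_c` of dense range that
carries `ω(a^* b)` to the inner product. -/
theorem nonempty_gnsQuadruple_of_map {w : Ac →ₗ[ℂ] ℂ} (hw : IsState w) {H : Type}
    [NormedAddCommGroup H] [InnerProductSpace ℂ H] [CompleteSpace H] (j : Ac →ₗ[ℂ] H)
    (hj : DenseRange j) (hjw : ∀ a b, ⟪j a, j b⟫_ℂ = w (star a * b)) : Nonempty (GNSQuadruple w) := by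
  -- The null space is a left ideal: `‖j(ax)‖² = ω(x^* (a^* a x)) = ⟪j x, j(a^* a x)⟫`, which
  -- vanishes with `j x`.
  obtain ⟨π, hP⟩ := exists_algHom_range (A := Ac) j fun a x hx => by
    rw [← inner_self_eq_zero (𝕜 := ℂ), hjw, star_mul, mul_assoc, ← hjw, hx, inner_zero_left]
  exact ⟨{
    H := H
    D := LinearMap.range j
    dense := hj
    π := π
    π_star := fun a x y => by
      obtain ⟨x, rfl⟩ := j.surjective_rangeRestrict x
      obtain ⟨y, rfl⟩ := j.surjective_rangeRestrict y
      change ⟪((π (star a) (j.rangeRestrict x) : LinearMap.range j) : H), j y⟫_ℂ =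
        ⟪j x, ((π a (j.rangeRestrict y) : LinearMap.range j) : H)⟫_ℂ
      rw [hP, hP]
      change ⟪j _, j y⟫_ℂ = ⟪j x, j _⟫_ℂ
      rw [hjw, hjw, star_mul, star_star, mul_assoc]
    Ω := j.rangeRestrict 1
    norm_Ω := by
      change ‖j 1‖ = 1
      rw [norm_eq_sqrt_re_inner (𝕜 := ℂ), hjw, star_one, one_mul, hw.normalized]
      simp
    cyclic := fun v => by
      obtain ⟨x, rfl⟩ := j.surjective_rangeRestrict v
      exact ⟨x, (hP x 1).trans (by rw [mul_one])⟩
    vector_state := fun a => by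
      change w a = ⟪j 1, ((π a (j.rangeRestrict 1) : LinearMap.range j) : H)⟫_ℂ
      rw [hP]
      change w a = ⟪j 1, j _⟫_ℂ
      rw [hjw, star_one, one_mul, mul_one] }⟩

/-- The GNS construction. -/
theorem IsState.nonempty_gnsQuadruple {w : Ac →ₗ[ℂ] ℂ} (hw : IsState w) :
    Nonempty (GNSQuadruple w) := by
  let c : PreInnerProductSpace.Core ℂ Ac := hw.core
  let _ : SeminormedAddCommGroup Ac := InnerProductSpace.Core.toSeminormedAddCommGroup (𝕜 := ℂ)
  let _ : InnerProductSpace ℂ Ac := InnerProductSpace.ofCore c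
  -- The completion of the seminormed space is Hausdorff, so it divides out the null vectors at the
  -- same time.
  refine nonempty_gnsQuadruple_of_map hw (H := UniformSpace.Completion Ac)
    (UniformSpace.Completion.toComplₗᵢ (𝕜 := ℂ) (E := Ac)).toLinearMap ?_ fun a b => ?_
  · exact UniformSpace.Completion.denseRange_coe
  · exact UniformSpace.Completion.inner_coe a b

/-! ### Unitary implementation of invariant automorphisms -/

namespace GNSQuadruple
variable {w : Ac →ₗ[ℂ] ℂ} (Q : GNSQuadruple w)

/-- The vector `π(a) Ω`. -/
noncomputable def vec : Ac →ₗ[ℂ] Q.H :=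
  Q.D.subtype ∘ₗ LinearMap.applyₗ Q.Ω ∘ₗ Q.π.toLinearMap

theorem vec_apply (a : Ac) : Q.vec a = (Q.π a Q.Ω : Q.H) := rfl

theorem inner_vec (a b : Ac) : ⟪Q.vec a, Q.vec b⟫_ℂ = w (star a * b) := by
  have := Q.π_star (star a) Q.Ω (Q.π b Q.Ω)
  rw [star_star] at this
  rw [vec_apply, vec_apply, this, Q.vector_state, map_mul]
  rfl

theorem vec_one : Q.vec 1 = Q.Ω := by rw [vec_apply, map_one]; rfl

theorem range_vec : Set.range Q.vec = Q.D := by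
  ext x
  constructor
  · rintro ⟨a, rfl⟩
    exact (Q.π a Q.Ω).2
  · intro hx
    obtain ⟨a, ha⟩ := Q.cyclic ⟨x, hx⟩
    exact ⟨a, congrArg Subtype.val ha⟩

theorem denseRange_vec : DenseRange Q.vec := by
  rw [DenseRange, range_vec]; exact Q.dense

variable {Q} in
theorem Implements.apply_vec {β : Ac ≃⋆ₐ[ℂ] Ac} {V : Q.H ≃ₗᵢ[ℂ] Q.H} (h : Q.Implements β V) (a : Ac) :
    V (Q.vec a) = Q.vec (β a) :=
  h.intertwines a Q.Ω Q.Ω h.map_vacuum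

variable {Q} in
-- By cyclicity the action on the vectors `π(a)Ω` determines everything: `V π(a) π(b)Ω = π(β(ab))Ω =
-- π(β a) V π(b)Ω`.
theorem implements_of_apply_vec {β : Ac ≃⋆ₐ[ℂ] Ac} {V : Q.H ≃ₗᵢ[ℂ] Q.H}
    (h : ∀ a, V (Q.vec a) = Q.vec (β a)) : Q.Implements β V where
  map_domain := by
    rw [← range_vec, ← Set.range_comp]
    ext x
    constructor
    · rintro ⟨a, rfl⟩
      exact ⟨β a, (h a).symm⟩
    · rintro ⟨a, rfl⟩
      exact ⟨β.symm a, by simp [h]⟩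
  map_vacuum := by rw [← vec_one, h, map_one]
  intertwines a x y hxy := by
    obtain ⟨b, rfl⟩ := Q.cyclic x
    have h1 : y = Q.π (β b) Q.Ω := Subtype.ext (hxy.symm.trans (h b))
    rw [h1, ← Module.End.mul_apply, ← Module.End.mul_apply, ← map_mul, ← map_mul, ← map_mul]
    exact h (a * b)

attribute [irreducible] vec

theorem exists_implementer {β : Ac ≃⋆ₐ[ℂ] Ac} (hβ : ∀ a, w (β a) = w a) :
    ∃ V : Q.H ≃ₗᵢ[ℂ] Q.H, ∀ a, V (Q.vec a) = Q.vec (β a) := by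
  have hn (a : Ac) : ‖Q.vec (β a)‖ = ‖Q.vec a‖ := by
    rw [norm_eq_sqrt_re_inner (𝕜 := ℂ), norm_eq_sqrt_re_inner (𝕜 := ℂ), inner_vec, inner_vec,
      ← map_star, ← map_mul, hβ]
  exact exists_isometry_extension (A := Ac) Q.vec Q.denseRange_vec β hn

theorem ext_vec {V V' : Q.H ≃ₗᵢ[ℂ] Q.H} (h : ∀ a, V (Q.vec a) = V' (Q.vec a)) : V = V' := by
  refine LinearIsometryEquiv.ext fun x => ?_
  exact congrFun (Q.denseRange_vec.equalizer V.continuous V'.continuous (funext h)) x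

/-- A group of automorphisms that leaves the state invariant is unitarily implemented. -/
theorem exists_representation {G : Type*} [Group G] (β : G →* (Ac ≃⋆ₐ[ℂ] Ac))
    (hβ : ∀ g a, w (β g a) = w a) :
    ∃ V : G →* (Q.H ≃ₗᵢ[ℂ] Q.H), ∀ g a, V g (Q.vec a) = Q.vec (β g a) := by
  choose V hV using fun g => Q.exists_implementer (hβ g)
  -- The separately chosen unitaries multiply correctly because each is determined by its values on
  -- the dense set of vectors `π(a)Ω`.
  refine ⟨MonoidHom.mk' V fun g h => Q.ext_vec fun a => ?_, hV⟩
  rw [LinearIsometryEquiv.coe_mul, Function.comp_apply, hV, hV, hV, map_mul]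
  rfl

end GNSQuadruple

/-! ## Fourier analysis on the line -/

/-- Smooth functions of compact support are Schwartz, so this is the fundamental lemma of the
calculus of variations. -/
theorem ae_eq_zero_of_schwartz {h : ℝ → ℂ} (hh : LocallyIntegrable h)
    (h0 : ∀ f : 𝓢(ℝ, ℂ), ∫ k, h k * f k = 0) : ∀ᵐ k, h k = 0 := by
  refine ae_eq_zero_of_integral_contDiff_smul_eq_zero hh fun g hg hgs => ?_
  have hs : HasCompactSupport fun k => (g k : ℂ) := hgs.comp_left (g := Complex.ofReal) rfl
  have hd : ContDiff ℝ ∞ fun k => (g k : ℂ) := Complex.ofRealCLM.contDiff.comp hg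
  have := h0 (hs.toSchwartzMap hd)
  rw [← this]
  refine integral_congr_ae (.of_forall fun k => ?_)
  change g k • h k = h k * (g k : ℂ)
  rw [Complex.real_smul, mul_comm]

theorem norm_cexp_I_mul_mul (k u : ℝ) : ‖cexp (I * k * u)‖ = 1 := by
  rw [Complex.norm_exp]; simp

/-- The kernel of the Fourier transform against a product of integrable functions. -/
theorem integrable_kernel {f h : ℝ → ℂ} (hf : Integrable f) (hh : Integrable h) :
    Integrable (fun p : ℝ × ℝ =>
      f p.1 * (cexp (I * p.1 * p.2) * h p.2 / (Real.sqrt (2 * Real.pi) : ℂ)))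
      ((volume : Measure ℝ).prod (volume : Measure ℝ)) := by
  have h1 := ((hf.mul_prod hh).bdd_mul (c := 1) (f := fun p : ℝ × ℝ => cexp (I * p.1 * p.2))
    (by fun_prop : Continuous fun p : ℝ × ℝ => cexp (I * p.1 * p.2)).aestronglyMeasurable
    (.of_forall fun p => (norm_cexp_I_mul_mul _ _).le)).div_const (Real.sqrt (2 * Real.pi) : ℂ)
  refine h1.congr (.of_forall fun p => ?_)
  simp only
  ring

/-- Fubini; the kernel `e^{iku}` is symmetric in `k` and `u`. -/
theorem fourierU_swap {f h : ℝ → ℂ} (hf : Integrable f) (hh : Integrable h) :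
    ∫ k, f k * fourierU h k = ∫ u, fourierU f u * h u := by
  simp only [fourierU, ← integral_const_mul, ← integral_mul_const]
  rw [integral_integral_swap (integrable_kernel hf hh)]
  refine integral_congr_ae (.of_forall fun u => integral_congr_ae (.of_forall fun k => ?_))
  simp only
  rw [mul_right_comm I]
  ring

theorem fourierU_continuous {f : ℝ → ℂ} (hf : Integrable f) : Continuous (fourierU f) := by
  refine continuous_of_dominated (bound := fun u => ‖f u / (Real.sqrt (2 * Real.pi) : ℂ)‖)
    (fun k => ?_) (fun k => .of_forall fun u => ?_) (hf.div_const _).norm (.of_forall fun u => ?_)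
  · have hc : Continuous fun u : ℝ => cexp (I * k * u) := by fun_prop
    exact ((hc.aestronglyMeasurable.mul hf.1).div₀ aestronglyMeasurable_const)
  · rw [mul_div_assoc, norm_mul, norm_cexp_I_mul_mul, one_mul]
  · fun_prop

theorem norm_fourierU_le (f : ℝ → ℂ) (k : ℝ) :
    ‖fourierU f k‖ ≤ ∫ u, ‖f u / (Real.sqrt (2 * Real.pi) : ℂ)‖ := by
  refine (norm_integral_le_integral_norm _).trans (le_of_eq ?_)
  refine integral_congr_ae (.of_forall fun u => ?_)
  simp only
  rw [mul_div_assoc, norm_mul, norm_cexp_I_mul_mul, one_mul]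

theorem fourierU_comp_neg (f : ℝ → ℂ) (k : ℝ) : fourierU (fun u => f (-u)) k = fourierU f (-k) := by
  rw [fourierU, fourierU, ← integral_neg_eq_self]
  refine integral_congr_ae (.of_forall fun u => ?_)
  simp

theorem fourierU_conj (f : ℝ → ℝ) (k : ℝ) :
    (starRingEnd ℂ) (fourierU (fun u => (f u : ℂ)) k) = fourierU (fun u => (f u : ℂ)) (-k) := by
  rw [fourierU, fourierU, ← integral_conj]
  refine integral_congr_ae (.of_forall fun u => ?_)
  simp only [map_div₀, map_mul, ← Complex.exp_conj, conj_I, conj_ofReal]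
  simp

/-- Every Schwartz function `φ` is the Fourier transform of `k ↦ φ̂(-k)`. -/
theorem exists_schwartz_fourierU (φ : 𝓢(ℝ, ℂ)) :
    ∃ f : 𝓢(ℝ, ℂ), (∀ k, f k = fourierU φ (-k)) ∧ ∀ u, fourierU f u = φ u := by
  have hpi : (0 : ℝ) < 2 * Real.pi := by positivity
  have hpi' : (Real.pi : ℂ) ≠ 0 := by exact_mod_cast Real.pi_ne_zero
  have hs : (Real.sqrt (2 * Real.pi) : ℂ) * (Real.sqrt (2 * Real.pi) : ℂ) = 2 * Real.pi := by
    rw [← Complex.ofReal_mul, Real.mul_self_sqrt hpi.le]; push_cast; rfl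
  have hs0 : (Real.sqrt (2 * Real.pi) : ℂ) ≠ 0 := by
    exact_mod_cast (Real.sqrt_pos.2 hpi).ne'
  -- Mathlib's transform uses `e^{-2πi u v}`; the dilation `v = k/(2π)` and the factor `(2π)^{-1/2}`
  -- convert it to `φ̂(-k)`.
  let f : 𝓢(ℝ, ℂ) := (Real.sqrt (2 * Real.pi) : ℂ)⁻¹ •
    SchwartzMap.compCLMOfContinuousLinearEquiv ℂ
      (ContinuousLinearEquiv.unitsEquivAut ℝ (Units.mk0 (2 * Real.pi)⁻¹ (inv_pos.2 hpi).ne'))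
      (FourierTransform.fourier φ)
  have hf (k : ℝ) : f k = (Real.sqrt (2 * Real.pi) : ℂ)⁻¹ *
      (FourierTransform.fourier φ : 𝓢(ℝ, ℂ)) ((2 * Real.pi)⁻¹ * k) := by
    simp [f, mul_comm]
  refine ⟨f, fun k => ?_, fun u => ?_⟩
  · rw [hf, SchwartzMap.fourier_coe, Real.fourier_eq', fourierU, ← integral_const_mul]
    refine integral_congr_ae (.of_forall fun u => ?_)
    have : ((-2 * Real.pi * inner ℝ u ((2 * Real.pi)⁻¹ * k) : ℝ) : ℂ) * I = I * ((-k : ℝ) : ℂ) * u := by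
      simp; field_simp
    simp only [this, smul_eq_mul]
    ring
  · have h1 : (FourierTransformInv.fourierInv (FourierTransform.fourier φ : 𝓢(ℝ, ℂ)) : 𝓢(ℝ, ℂ)) = φ :=
      FourierTransform.fourierInv_fourier_eq φ
    have h2 := congrArg (fun g : 𝓢(ℝ, ℂ) => g u) h1
    rw [SchwartzMap.fourierInv_coe, Real.fourierInv_eq'] at h2
    rw [← h2, fourierU]
    have h3 := Measure.integral_comp_mul_left (fun v : ℝ => cexp (((2 * Real.pi * inner ℝ v u : ℝ) : ℂ) * I) •
      (FourierTransform.fourier φ : 𝓢(ℝ, ℂ)) v) (2 * Real.pi)⁻¹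
    rw [inv_inv, abs_of_pos hpi, Complex.real_smul, eq_comm,
      ← eq_inv_mul_iff_mul_eq₀ (by exact_mod_cast hpi.ne')] at h3
    rw [h3, ← integral_const_mul]
    refine integral_congr_ae (.of_forall fun k => ?_)
    have : ((2 * Real.pi * inner ℝ ((2 * Real.pi)⁻¹ * k) u : ℝ) : ℂ) * I = I * u * k := by
      simp; field_simp
    simp only [this, smul_eq_mul, hf]
    push_cast
    rw [← hs]
    field_simp

/-- Multiplication of a Schwartz function by `i k`. -/
theorem exists_schwartz_mul_I (f : 𝓢(ℝ, ℂ)) : ∃ f₁ : 𝓢(ℝ, ℂ), ∀ k : ℝ, f₁ k = I * k * f k := by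
  have ht : Function.HasTemperateGrowth fun k : ℝ => I * (k : ℂ) := by fun_prop
  exact ⟨SchwartzMap.smulLeftCLM ℂ (fun k : ℝ => I * (k : ℂ)) f, fun k => by
    rw [SchwartzMap.smulLeftCLM_apply_apply ht, smul_eq_mul]⟩

theorem fourierU_hasDerivAt (f f₁ : 𝓢(ℝ, ℂ)) (hf : ∀ k : ℝ, f₁ k = I * k * f k) (u : ℝ) :
    HasDerivAt (fourierU f) (fourierU f₁ u) u := by
  have hc {h : ℝ → ℂ} (hh : Continuous h) (u : ℝ) : AEStronglyMeasurable
      (fun k : ℝ => cexp (I * u * k) * h k / (Real.sqrt (2 * Real.pi) : ℂ)) :=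
    Continuous.aestronglyMeasurable (by fun_prop)
  refine (hasDerivAt_integral_of_dominated_loc_of_deriv_le (s := Set.univ)
    (F := fun (u : ℝ) (k : ℝ) => cexp (I * u * k) * f k / (Real.sqrt (2 * Real.pi) : ℂ))
    (F' := fun (u : ℝ) (k : ℝ) => cexp (I * u * k) * f₁ k / (Real.sqrt (2 * Real.pi) : ℂ))
    (bound := fun k => ‖f₁ k / (Real.sqrt (2 * Real.pi) : ℂ)‖) univ_mem
    (.of_forall fun u => hc f.continuous u) ?_ (hc f₁.continuous u) ?_
    (f₁.integrable.div_const _).norm ?_).2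
  · refine (f.integrable.div_const (Real.sqrt (2 * Real.pi) : ℂ)).mono (hc f.continuous u)
      (.of_forall fun k => ?_)
    rw [mul_div_assoc, norm_mul, norm_cexp_I_mul_mul, one_mul]
  · refine .of_forall fun k v _ => ?_
    rw [mul_div_assoc, norm_mul, norm_cexp_I_mul_mul, one_mul]
  · refine .of_forall fun k v _ => ?_
    have h0 : HasDerivAt (fun v : ℝ => I * (v : ℂ) * k) (I * k) v := by
      simpa using ((Complex.ofRealCLM.hasDerivAt (x := v)).const_mul I).mul_const (k : ℂ)
    have h1 := (h0.cexp.mul_const (f k)).div_const (Real.sqrt (2 * Real.pi) : ℂ)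
    refine h1.congr_deriv ?_
    rw [hf]
    ring

/-- A function on the line that satisfies the requirements on `ψ(·, s)`, and its distributional
Fourier transform. -/
structure IsGoodSlice (ψ : ℝ → ℝ) (g : ℝ → ℂ) : Prop where
  diff : Differentiable ℝ ψ
  bounded : ∃ C, ∀ u, |ψ u| ≤ C
  integrable_deriv : Integrable (deriv ψ)
  integrable : Integrable g
  fourier : ∀ f : 𝓢(ℝ, ℂ), ∫ u : ℝ, (ψ u : ℂ) * fourierU f u = ∫ k : ℝ, g k * f k

namespace IsGoodSlice
variable {ψ φ : ℝ → ℝ} {g h : ℝ → ℂ}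

/-- The Fourier transform of `∂_u ψ`. -/
theorem fourierU_deriv (hψ : IsGoodSlice ψ g) :
    ∀ᵐ k : ℝ, fourierU (fun u => ((deriv ψ u : ℝ) : ℂ)) k = -(I * k * g k) := by
  have hi : Integrable fun u => ((deriv ψ u : ℝ) : ℂ) := hψ.integrable_deriv.ofReal
  have hc := fourierU_continuous hi
  have hkg : LocallyIntegrable fun k : ℝ => g k * (I * k) :=
    hψ.integrable.locallyIntegrable.smul_continuous (by fun_prop : Continuous fun k : ℝ => I * (k : ℂ))
  have h0 := ae_eq_zero_of_schwartz (hc.locallyIntegrable.add hkg) fun f => by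
    obtain ⟨f₁, hf₁⟩ := exists_schwartz_mul_I f
    obtain ⟨C, hC⟩ := hψ.bounded
    have hb (f : 𝓢(ℝ, ℂ)) : Integrable fun u => fourierU f u * (ψ u : ℂ) :=
      (fourierU_integrable f).mul_bdd (c := C)
        (Complex.continuous_ofReal.comp hψ.diff.continuous).aestronglyMeasurable
        (.of_forall fun u => by simpa using hC u)
    -- Swap the transform onto `f`, integrate by parts, and use that `(f̂)'` is the transform of `i
    -- k f`. The boundary terms vanish since the products are integrable: `ψ` is bounded and `∂_u ψ`
    -- is in `L¹`.
    have e1 : ∫ k, fourierU (fun u => ((deriv ψ u : ℝ) : ℂ)) k * f k = -∫ k, g k * f₁ k := by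
      rw [← fourierU_swap hi f.integrable, ← hψ.fourier]
      simp only [mul_comm (Complex.ofReal _)]
      refine integral_mul_deriv_eq_deriv_mul_of_integrable
        (fun u _ => fourierU_hasDerivAt f f₁ hf₁ u) (fun u _ => (hψ.diff u).hasDerivAt.ofReal_comp)
        ?_ (hb f₁) (hb f)
      exact hi.bdd_mul (c := ∫ u, ‖f u / (Real.sqrt (2 * Real.pi) : ℂ)‖)
        (fourierU_continuous f.integrable).aestronglyMeasurable
        (.of_forall fun u => norm_fourierU_le _ _)
    have hi1 : Integrable fun k => fourierU (fun u => ((deriv ψ u : ℝ) : ℂ)) k * f k :=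
      f.integrable.bdd_mul (c := ∫ u, ‖((deriv ψ u : ℝ) : ℂ) / (Real.sqrt (2 * Real.pi) : ℂ)‖)
        hc.aestronglyMeasurable (.of_forall fun u => norm_fourierU_le _ _)
    have hi2 : Integrable fun k => g k * f₁ k :=
      hψ.integrable.mul_bdd (c := SchwartzMap.seminorm ℝ 0 0 f₁) f₁.continuous.aestronglyMeasurable
        (.of_forall fun k => SchwartzMap.norm_le_seminorm ℝ f₁ k)
    have e2 : ∫ k, fourierU (fun u => ((deriv ψ u : ℝ) : ℂ)) k * f k + g k * f₁ k = 0 := by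
      rw [integral_add hi1 hi2, e1]; ring
    rw [← e2]
    refine integral_congr_ae (.of_forall fun k => ?_)
    simp only [Pi.add_apply, hf₁]
    ring
  filter_upwards [h0] with k hk
  simp only [Pi.add_apply] at hk
  linear_combination hk

/-- Fourier inversion. -/
theorem inversion (hψ : IsGoodSlice ψ g) : ∀ᵐ u : ℝ, (ψ u : ℂ) = fourierU g (-u) := by
  have hcψ : Continuous fun u => (ψ u : ℂ) := Complex.continuous_ofReal.comp hψ.diff.continuous
  have hcg : Continuous fun u => fourierU g (-u) := (fourierU_continuous hψ.integrable).comp continuous_neg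
  -- An arbitrary test function `φ` is written as a transform `f̂`, so that the distributional
  -- definition of `g` applies.
  have h0 := ae_eq_zero_of_schwartz (hcψ.sub hcg).locallyIntegrable fun φ => by
    obtain ⟨f, hf, hfφ⟩ := exists_schwartz_fourierU φ
    obtain ⟨C, hC⟩ := hψ.bounded
    have hi1 : Integrable fun u => (ψ u : ℂ) * φ u :=
      φ.integrable.bdd_mul (c := C) hcψ.aestronglyMeasurable (.of_forall fun u => by simpa using hC u)
    have hi2 : Integrable fun u => fourierU g (-u) * φ u :=
      φ.integrable.bdd_mul (c := ∫ u, ‖g u / (Real.sqrt (2 * Real.pi) : ℂ)‖)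
        hcg.aestronglyMeasurable (.of_forall fun u => norm_fourierU_le _ _)
    simp only [Pi.sub_apply, sub_mul]
    rw [integral_sub hi1 hi2, sub_eq_zero]
    have h1 := hψ.fourier f
    simp only [hfφ, hf] at h1
    rw [h1, ← integral_neg_eq_self]
    simp only [neg_neg]
    rw [fourierU_swap hψ.integrable.comp_neg φ.integrable]
    simp only [fourierU_comp_neg]
  filter_upwards [h0] with u hu
  exact sub_eq_zero.1 hu

theorem conj_deriv (hψ : IsGoodSlice ψ g) :
    ∀ᵐ k : ℝ, fourierU (fun u => ((deriv ψ u : ℝ) : ℂ)) (-k) = I * k * (starRingEnd ℂ) (g k) := by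
  filter_upwards [hψ.fourierU_deriv] with k hk
  rw [← fourierU_conj, hk]
  simp

/-- `ψ` need not be integrable, so its transform cannot be conjugated under the integral. The
transform of the real `L¹` function `∂_u ψ` can: compare its two expressions at `-k` and divide by
`ik` off `k = 0`. -/
theorem reality (hψ : IsGoodSlice ψ g) : ∀ᵐ k : ℝ, g (-k) = (starRingEnd ℂ) (g k) := by
  have h0 : ∀ᵐ k : ℝ, k ≠ 0 := Measure.ae_ne volume 0
  have h1 := (Measure.measurePreserving_neg (volume : Measure ℝ)).quasiMeasurePreserving.ae
    hψ.fourierU_deriv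
  filter_upwards [hψ.conj_deriv, h0, h1] with k hk hk0 hk1
  rw [hk] at hk1
  have h2 : I * (k : ℂ) ≠ 0 := mul_ne_zero I_ne_zero (by exact_mod_cast hk0)
  refine mul_left_cancel₀ h2 ?_
  rw [hk1]
  push_cast
  ring

/-- Parseval's formula for `∫ ψ ∂_u φ du`. -/
theorem integral_mul_deriv (hψ : IsGoodSlice ψ g) (hφ : IsGoodSlice φ h) :
    ((∫ u, ψ u * deriv φ u : ℝ) : ℂ) = ∫ k : ℝ, I * k * (g k * (starRingEnd ℂ) (h k)) := by
  have hi : Integrable fun u => ((deriv φ u : ℝ) : ℂ) := hφ.integrable_deriv.ofReal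
  refine (integral_complex_ofReal (f := fun u => ψ u * deriv φ u)).symm.trans ?_
  -- Only `∂_u φ` and `g` are known to be integrable, so `ψ` is replaced by the inversion formula
  -- before the transform is swapped onto `∂_u φ`.
  have e1 : ∫ u, ((ψ u * deriv φ u : ℝ) : ℂ) = ∫ u, fourierU g (-u) * ((deriv φ u : ℝ) : ℂ) := by
    refine integral_congr_ae ?_
    filter_upwards [hψ.inversion] with u hu
    rw [ofReal_mul, hu]
  simp only [← fourierU_comp_neg] at e1
  rw [e1, ← fourierU_swap hψ.integrable.comp_neg hi, ← integral_neg_eq_self]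
  refine integral_congr_ae ?_
  filter_upwards [hφ.conj_deriv] with k hk
  rw [neg_neg, hk]
  ring

end IsGoodSlice

/-! ## The two-point function in Fourier space -/

/-- Parseval gives the integral of `Im(2k conj(g) h)` over all `k`. Under `k ↦ -k` the factor `k`
changes sign and `conj(g) h` is conjugated, so the integrand is even and the half line counts twice.
-/
theorem IsGoodSlice.integral_symplectic {ψ φ : ℝ → ℝ} {g h : ℝ → ℂ} (hψ : IsGoodSlice ψ g)
    (hφ : IsGoodSlice φ h) (h1 : Integrable fun u => ψ u * deriv φ u)
    (h2 : Integrable fun u => φ u * deriv ψ u)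
    (h3 : Integrable fun k : ℝ => 2 * (k : ℂ) * (starRingEnd ℂ) (g k) * h k)
    (h4 : Integrable fun k : ℝ => 2 * (k : ℂ) * (starRingEnd ℂ) (h k) * g k) :
    ∫ u, (ψ u * deriv φ u - φ u * deriv ψ u) =
      2 * ∫ k in Set.Ioi (0 : ℝ), (2 * (k : ℂ) * (starRingEnd ℂ) (g k) * h k).im := by
  have e1 : ∫ u, (ψ u * deriv φ u - φ u * deriv ψ u) =
      ∫ k : ℝ, (2 * (k : ℂ) * (starRingEnd ℂ) (g k) * h k).im := by
    have i1 : Integrable fun k : ℝ => I * k * (g k * (starRingEnd ℂ) (h k)) :=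
      (h4.const_mul (I / 2)).congr (.of_forall fun k => by simp only; ring)
    have i2 : Integrable fun k : ℝ => I * k * (h k * (starRingEnd ℂ) (g k)) :=
      (h3.const_mul (I / 2)).congr (.of_forall fun k => by simp only; ring)
    rw [integral_sub h1 h2]
    apply Complex.ofReal_injective
    rw [Complex.ofReal_sub, hψ.integral_mul_deriv hφ, hφ.integral_mul_deriv hψ, ← integral_sub i1 i2,
      ← integral_complex_ofReal]
    refine integral_congr_ae (.of_forall fun k => ?_)
    apply Complex.ext <;> simp <;> ring
  rw [e1, ← integral_comp_abs (f := fun k : ℝ => (2 * (k : ℂ) * (starRingEnd ℂ) (g k) * h k).im)]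
  refine integral_congr_ae ?_
  filter_upwards [hψ.reality, hφ.reality] with k hk hk'
  rcases le_total 0 k with hk0 | hk0
  · rw [abs_of_nonneg hk0]
  · rw [abs_of_nonpos hk0]
    simp only [hk, hk', Complex.conj_conj]
    simp
    ring

/-- The positive-frequency part of `dk dμ_{S²}`. -/
noncomputable def posMeasure : Measure Scri := scriMeasure.restrict {p | 0 < p.1}

theorem posMeasure_eq : posMeasure =
    ((volume : Measure ℝ).restrict (Set.Ioi 0)).prod (volume : Measure E3).toSphere := by
  have h := Measure.prod_restrict (μ := (volume : Measure ℝ)) (ν := (volume : Measure E3).toSphere)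
    (Set.Ioi 0) Set.univ
  rw [Measure.restrict_univ] at h
  rw [h, posMeasure, scriMeasure]
  congr 1
  ext p
  simp

theorem ae_posMeasure_pos : ∀ᵐ p ∂posMeasure, 0 < p.1 :=
  ae_restrict_mem (measurableSet_lt measurable_const measurable_fst)

theorem ae_posMeasure {P : Scri → Prop} (h : ∀ᵐ p ∂scriMeasure, P p) : ∀ᵐ p ∂posMeasure, P p :=
  ae_restrict_of_ae h

theorem IsGoodFourier.ae_slice {ψ : Scri → ℝ} {g : Scri → ℂ} (hψ : MemSc ψ) (hg : IsGoodFourier ψ g) :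
    ∀ᵐ s ∂(volume : Measure E3).toSphere, IsGoodSlice (fun u => ψ (u, s)) (fun k => g (k, s)) := by
  obtain ⟨C, hC⟩ := hψ.bounded
  filter_upwards [hg.isFourier, hg.integrable.prod_left_ae, hψ.integrable.prod_left_ae] with s h1 h2 h3
  exact ⟨slice_diff hψ.smooth s, ⟨C, fun u => hC _⟩, h3, h2, h1⟩

theorem MemSc.integrable_mul_duDeriv {ψ φ : Scri → ℝ} (hψ : MemSc ψ) (hφ : MemSc φ) :
    Integrable (fun p => ψ p * duDeriv φ p) scriMeasure := by
  obtain ⟨C, hC⟩ := hψ.bounded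
  exact hφ.integrable.bdd_mul (c := C) hψ.smooth.continuous.aestronglyMeasurable
    (.of_forall fun p => hC p)

/-- The factor `k` goes with `g`, where `k g` is bounded; the remaining `h` is in `L¹`. -/
theorem IsGoodFourier.integrable_mul {ψ φ : Scri → ℝ} {g h : Scri → ℂ} (hg : IsGoodFourier ψ g)
    (hh : IsGoodFourier φ h) :
    Integrable (fun p => 2 * (p.1 : ℂ) * (starRingEnd ℂ) (g p) * h p) scriMeasure := by
  obtain ⟨C, hC⟩ := hg.bounded
  have hm : AEStronglyMeasurable (fun p : Scri => 2 * (p.1 : ℂ) * (starRingEnd ℂ) (g p)) scriMeasure :=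
    (Continuous.aestronglyMeasurable (by fun_prop)).mul
      (Complex.continuous_conj.comp_aestronglyMeasurable hg.integrable.1)
  refine hh.integrable.bdd_mul (c := 2 * C) hm ?_
  filter_upwards [hC] with p hp
  rw [mul_assoc, norm_mul, norm_mul, RCLike.norm_conj, ← norm_mul]
  simpa using hp

/-- `∫_{k > 0} 2 k conj(g) h dk dμ_{S²}`. -/
noncomputable def energyForm (g h : Scri → ℂ) : ℂ :=
  ∫ p, 2 * (p.1 : ℂ) * (starRingEnd ℂ) (g p) * h p ∂posMeasure

theorem sigmaC_eq_energyForm (ψ φ : Sc) {g h : Scri → ℂ} (hg : IsGoodFourier ψ g)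
    (hh : IsGoodFourier φ h) : sigmaC ψ φ = 2 * (energyForm g h).im := by
  have i0 := hg.integrable_mul hh
  have i1 : Integrable (fun p => (2 * (p.1 : ℂ) * (starRingEnd ℂ) (g p) * h p).im)
      (((volume : Measure ℝ).restrict (Set.Ioi 0)).prod (volume : Measure E3).toSphere) := by
    rw [← posMeasure_eq]; exact i0.restrict.im
  have e1 : (energyForm g h).im = ∫ p, (2 * (p.1 : ℂ) * (starRingEnd ℂ) (g p) * h p).im ∂posMeasure :=
    (integral_im (𝕜 := ℂ) i0.restrict).symm
  rw [e1, posMeasure_eq, integral_prod_symm _ i1, ← integral_const_mul, sigmaC, scriMeasure]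
  have j1 := ψ.2.integrable_mul_duDeriv φ.2
  have j2 := φ.2.integrable_mul_duDeriv ψ.2
  refine (integral_prod_symm _ (j1.sub j2)).trans ?_
  refine integral_congr_ae ?_
  filter_upwards [hg.ae_slice ψ.2, hh.ae_slice φ.2, j1.prod_left_ae, j2.prod_left_ae,
    i0.prod_left_ae, (hh.integrable_mul hg).prod_left_ae] with s h1 h2 h3 h4 h5 h6
  exact h1.integral_symplectic h2 h3 h4 h5 h6

/-- The Fourier transform is unique almost everywhere. -/
theorem IsGoodFourier.ae_eq {ψ : Scri → ℝ} {g h : Scri → ℂ} (hg : IsGoodFourier ψ g)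
    (hh : IsGoodFourier ψ h) : g =ᵐ[scriMeasure] h := by
  have hi := hg.integrable.sub hh.integrable
  have h0 : ∫ p, ‖(g - h) p‖ ∂scriMeasure = 0 := by
    rw [scriMeasure, integral_prod_symm _ hi.norm]
    refine integral_eq_zero_of_ae ?_
    filter_upwards [hg.isFourier, hh.isFourier, sliceInt hg.integrable, sliceInt hh.integrable,
      hi.prod_left_ae] with s h1 h2 h3 h4 h5
    have h6 := ae_eq_zero_of_schwartz h5.locallyIntegrable fun f => by
      simp only [Pi.sub_apply, sub_mul]
      rw [integral_sub (h3 f) (h4 f), ← h1, ← h2, sub_self]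
    refine integral_eq_zero_of_ae ?_
    filter_upwards [h6] with k hk
    rw [hk, norm_zero]; rfl
  rw [integral_eq_zero_iff_of_nonneg (fun p => norm_nonneg _) hi.norm] at h0
  filter_upwards [h0] with p hp
  exact sub_eq_zero.1 (norm_eq_zero.1 hp)

theorem energyForm_congr {g g' h h' : Scri → ℂ} (hg : g =ᵐ[scriMeasure] g')
    (hh : h =ᵐ[scriMeasure] h') : energyForm g h = energyForm g' h' := by
  refine integral_congr_ae (ae_posMeasure ?_)
  filter_upwards [hg, hh] with p h1 h2
  rw [h1, h2]

/-- `μ` is the real part of the energy form and `σ/2` its imaginary part. Any representatives of the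
transforms may be used, so explicit formulas can replace the chosen `hat`. -/
theorem twoPointC_eq (ψ φ : Sc) {g h : Scri → ℂ} (hg : IsGoodFourier ψ g) (hh : IsGoodFourier φ h) :
    twoPointC ψ φ = energyForm g h := by
  have e1 : muC ψ φ = (energyForm (hat ψ) (hat φ)).re := rfl
  rw [energyForm_congr ((hat_spec ψ).ae_eq hg) ((hat_spec φ).ae_eq hh)] at e1
  rw [twoPointC, e1, sigmaC_eq_energyForm ψ φ hg hh]
  apply Complex.ext <;> simp

/-- `hat` is an arbitrary choice of representative, so linearity holds only almost everywhere, by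
uniqueness of the transform. -/
theorem hat_add (ψ φ : Sc) : hat (ψ + φ) =ᵐ[scriMeasure] hat ψ + hat φ := by
  have h1 := hat_spec ψ
  have h2 := hat_spec φ
  obtain ⟨A, hA⟩ := h1.bounded
  obtain ⟨B, hB⟩ := h2.bounded
  refine (hat_spec (ψ + φ)).ae_eq ⟨?_, h1.integrable.add h2.integrable, A + B, ?_⟩
  · filter_upwards [h1.isFourier, h2.isFourier, sliceInt h1.integrable, sliceInt h2.integrable]
      with s h3 h4 h5 h6 f
    simp only [Submodule.coe_add, Pi.add_apply, ofReal_add, add_mul]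
    rw [integral_add (bddInt ψ.2 s f) (bddInt φ.2 s f), integral_add (h5 f) (h6 f), h3, h4]
  · filter_upwards [hA, hB] with p h3 h4
    rw [Pi.add_apply, mul_add]
    exact (norm_add_le _ _).trans (add_le_add h3 h4)

theorem hat_smul (c : ℝ) (ψ : Sc) : hat (c • ψ) =ᵐ[scriMeasure] fun p => (c : ℂ) * hat ψ p := by
  have h1 := hat_spec ψ
  obtain ⟨A, hA⟩ := h1.bounded
  refine (hat_spec (c • ψ)).ae_eq ⟨?_, h1.integrable.const_mul _, |c| * A, ?_⟩
  · filter_upwards [h1.isFourier] with s h3 f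
    simp only [Submodule.coe_smul, Pi.smul_apply, smul_eq_mul, ofReal_mul, mul_assoc]
    rw [integral_const_mul, integral_const_mul, h3]
  · filter_upwards [hA] with p h3
    rw [mul_left_comm, norm_mul]
    simpa using mul_le_mul_of_nonneg_left h3 (abs_nonneg c)

theorem memLp_sqrt_mul_hat (ψ : Sc) :
    MemLp (fun p : Scri => (Real.sqrt (2 * p.1) : ℂ) * hat ψ p) 2 posMeasure := by
  have h1 := hat_spec ψ
  have hm : AEStronglyMeasurable (fun p : Scri => (Real.sqrt (2 * p.1) : ℂ) * hat ψ p) posMeasure :=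
    (Continuous.aestronglyMeasurable (by fun_prop)).mul h1.integrable.1.restrict
  rw [memLp_two_iff_integrable_sq_norm hm]
  refine (h1.integrable_mul h1).restrict.norm.congr ?_
  filter_upwards [ae_posMeasure_pos] with p hp
  have hp' : 0 ≤ 2 * p.1 := by positivity
  rw [norm_mul, norm_mul, RCLike.norm_conj, norm_mul, norm_mul (_ : ℂ) (hat ψ p), mul_pow, Complex.norm_real, Complex.norm_real,
    Real.norm_of_nonneg (Real.sqrt_nonneg _), Real.sq_sqrt hp', Real.norm_of_nonneg hp.le]
  simp
  ring

/-- The one-particle structure `ψ ↦ √(2k) ψ̂` restricted to `k > 0`. -/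
noncomputable def oneParticleVec (ψ : Sc) : Lp ℂ 2 posMeasure := (memLp_sqrt_mul_hat ψ).toLp _

theorem oneParticleVec_add (ψ φ : Sc) :
    oneParticleVec (ψ + φ) = oneParticleVec ψ + oneParticleVec φ := by
  rw [oneParticleVec, oneParticleVec, oneParticleVec, ← MemLp.toLp_add, MemLp.toLp_eq_toLp_iff]
  filter_upwards [ae_posMeasure (hat_add ψ φ)] with p hp
  rw [hp]
  simp only [Pi.add_apply]
  ring

theorem oneParticleVec_smul (c : ℝ) (ψ : Sc) :
    oneParticleVec (c • ψ) = (c : ℂ) • oneParticleVec ψ := by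
  rw [oneParticleVec, oneParticleVec, ← MemLp.toLp_const_smul, MemLp.toLp_eq_toLp_iff]
  filter_upwards [ae_posMeasure (hat_smul c ψ)] with p hp
  rw [hp]
  simp only [Pi.smul_apply, smul_eq_mul]
  ring

theorem inner_oneParticleVec (ψ φ : Sc) :
    ⟪oneParticleVec ψ, oneParticleVec φ⟫_ℂ = twoPointC ψ φ := by
  rw [twoPointC_eq ψ φ (hat_spec ψ) (hat_spec φ), L2.inner_def]
  refine integral_congr_ae ?_
  filter_upwards [(memLp_sqrt_mul_hat ψ).coeFn_toLp, (memLp_sqrt_mul_hat φ).coeFn_toLp,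
    ae_posMeasure_pos] with p h1 h2 hp
  have hp' : 0 ≤ 2 * p.1 := by positivity
  have h3 : (Real.sqrt (2 * p.1) : ℂ) * (Real.sqrt (2 * p.1) : ℂ) = 2 * p.1 := by
    rw [← Complex.ofReal_mul, Real.mul_self_sqrt hp']; push_cast; rfl
  change ⟪(memLp_sqrt_mul_hat ψ).toLp _ p, (memLp_sqrt_mul_hat φ).toLp _ p⟫_ℂ = _
  rw [h1, h2, RCLike.inner_apply, map_mul, Complex.conj_ofReal, ← h3]
  ring

theorem exists_oneParticleStructure : ∃ (H : Type) (_ : NormedAddCommGroup H)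
    (_ : InnerProductSpace ℂ H) (K : Sc →ₗ[ℝ] H), ∀ ψ φ, ⟪K ψ, K φ⟫_ℂ = twoPointC ψ φ :=
  ⟨Lp ℂ 2 posMeasure, inferInstance, inferInstance,
    { toFun := oneParticleVec, map_add' := oneParticleVec_add, map_smul' := oneParticleVec_smul },
    inner_oneParticleVec⟩

theorem im_twoPointC (ψ φ : Sc) : (twoPointC ψ φ).im = sigmaC ψ φ / 2 := by
  simp [twoPointC]; ring

/-- The existence proof behind the `Classical.epsilon` in `omegaC`: the antisymmetric part of the
Gram kernel is `2i` times its imaginary part `σ/2`, as the commutation relations demand. -/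
theorem omegaC_spec : IsQuasiFree omegaC ∧ HasTwoPointC omegaC := by
  refine Classical.epsilon_spec (p := fun w => IsQuasiFree w ∧ HasTwoPointC w) ?_
  obtain ⟨H, _, _, K, hK⟩ := exists_oneParticleStructure
  obtain ⟨w, hw, h⟩ := exists_isQuasiFree K fun ψ φ => by
    rw [← inner_conj_symm (K φ) (K ψ), hK, Complex.sub_conj, im_twoPointC]
    push_cast
    ring
  exact ⟨w, hw, fun ψ φ => (h ψ φ).trans (hK ψ φ)⟩

/-! ## Symmetry of the two-point function -/

theorem horizonMap_bijective (a b : S2 → ℝ) (R : E3 ≃ₗᵢ[ℝ] E3) :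
    Function.Bijective (horizonMap a b R) := by
  refine ⟨fun p q h => ?_, fun p => ?_⟩
  · have h2 : p.2 = q.2 := by
      rw [← rot_inv R p.2, ← rot_inv R q.2]
      exact congrArg (rot R⁻¹) (congrArg Prod.snd h)
    have h1 := congrArg Prod.fst h
    simp only [horizonMap, h2, add_left_inj] at h1
    exact Prod.ext (mul_left_cancel₀ (Real.exp_pos _).ne' h1) h2
  · refine ⟨(Real.exp (-a (rot R⁻¹ p.2)) * (p.1 - b (rot R⁻¹ p.2)), rot R⁻¹ p.2),
      Prod.ext ?_ (rot_inv' R _)⟩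
    simp only [horizonMap]
    rw [← mul_assoc, ← Real.exp_add]
    simp

/-- The Fourier transform of `ψ ∘ F_{(a,b,R)}` in terms of `g = ψ̂`. -/
noncomputable def hatHorizonMap (a b : S2 → ℝ) (R : E3 ≃ₗᵢ[ℝ] E3) (g : Scri → ℂ) (p : Scri) : ℂ :=
  (Real.exp (-a p.2) : ℂ) *
    (Complex.exp (-(Complex.I * ((Real.exp (-a p.2) * p.1 : ℝ) : ℂ) * b p.2)) *
      g (horizonMap (-a) 0 R p))

/-- On each line, substituting `e^a u + b` rescales `k` by `e^{-a}`, with Jacobian `e^{-a}` and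
phase `exp(-i e^{-a} k b)`; the rotation only relabels the lines. -/
theorem IsGoodFourier.comp_horizonMap {ψ : Scri → ℝ} {g : Scri → ℂ} (hg : IsGoodFourier ψ g)
    {a b : S2 → ℝ} (ha : IsSmoothS2 a) (hb : IsSmoothS2 b) (R : E3 ≃ₗᵢ[ℝ] E3) :
    IsGoodFourier (ψ ∘ horizonMap a b R) (hatHorizonMap a b R g) := by
  obtain ⟨D, hD⟩ := hg.bounded
  have hac : Continuous a := ha.continuous
  have hbc : Continuous b := hb.continuous
  have h0 : IsSmoothS2 (0 : S2 → ℝ) := contMDiff_const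
  have hna : IsSmoothS2 (-a) := ha.neg
  have hm (p : Scri) : ‖Complex.exp (-(Complex.I * ((Real.exp (-a p.2) * p.1 : ℝ) : ℂ) * b p.2))‖ = 1 :=
    norm_phase _ _
  refine ⟨?_, ?_, D, ?_⟩
  · have h1 := (rot_mp R).quasiMeasurePreserving.ae hg.isFourier
    filter_upwards [h1] with s hs f
    have := fourier_slice (Real.exp_pos (a s)) (b s) hs f
    simpa [hatHorizonMap, horizonMap, Real.exp_neg] using this
  · have h1 := integrable_horizonMap hna h0 R hg.integrable
    have h2 := h1.bdd_mul (c := 1) (f := fun p : Scri =>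
      Complex.exp (-(Complex.I * ((Real.exp (-a p.2) * p.1 : ℝ) : ℂ) * b p.2))) (by
        refine Continuous.aestronglyMeasurable ?_
        fun_prop) (.of_forall fun p => (hm p).le)
    refine h2.congr (.of_forall fun p => ?_)
    simp only [hatHorizonMap, Complex.real_smul, Pi.neg_apply]
    ring
  · filter_upwards [ae_horizonMap hna h0 R hD] with p hp
    refine le_trans (le_of_eq ?_) hp
    rw [hatHorizonMap, norm_mul, norm_mul, norm_mul, norm_mul, hm, one_mul, ← mul_assoc, ← norm_mul]
    simp [horizonMap, mul_comm]

/-- The phases cancel between the conjugate factors, and `e^{-2a} k dk` is the pullback of `k dk`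
under `k ↦ e^{-a}k`, which preserves `k > 0`. No condition on `b` is needed. -/
theorem energyForm_hatHorizonMap {a : S2 → ℝ} (ha : IsSmoothS2 a) (b : S2 → ℝ) (R : E3 ≃ₗᵢ[ℝ] E3)
    (g h : Scri → ℂ) :
    energyForm (hatHorizonMap a b R g) (hatHorizonMap a b R h) = energyForm g h := by
  have hna : IsSmoothS2 (-a) := ha.neg
  have h0 : IsSmoothS2 (0 : S2 → ℝ) := contMDiff_const
  have hS : MeasurableSet {p : Scri | 0 < p.1} := measurableSet_lt measurable_const measurable_fst
  have hph (p : Scri) : (starRingEnd ℂ)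
      (Complex.exp (-(Complex.I * ((Real.exp (-a p.2) * p.1 : ℝ) : ℂ) * b p.2))) *
      Complex.exp (-(Complex.I * ((Real.exp (-a p.2) * p.1 : ℝ) : ℂ) * b p.2)) = 1 := by
    rw [← Complex.normSq_eq_conj_mul_self, Complex.normSq_eq_norm_sq, norm_phase]; simp
  simp only [energyForm, posMeasure]
  rw [← integral_indicator hS, ← integral_indicator hS]
  refine Eq.trans ?_ (integral_horizonMap hna h0 (horizonMap_bijective (-a) 0 R) _)
  refine integral_congr_ae (.of_forall fun p => ?_)
  by_cases hp : 0 < p.1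
  · have hp' : 0 < (horizonMap (-a) 0 R p).1 := by
      simp only [horizonMap, Pi.zero_apply, add_zero]; positivity
    simp only
    rw [Set.indicator_of_mem (by exact hp), Set.indicator_of_mem (by exact hp'), Complex.real_smul]
    simp only [hatHorizonMap, map_mul, Complex.conj_ofReal]
    have e : ((horizonMap (-a) 0 R p).1 : ℂ) = (Real.exp (-a p.2) : ℂ) * p.1 := by
      simp [horizonMap]
    rw [e, Pi.neg_apply]
    linear_combination (2 * (p.1 : ℂ) * (Real.exp (-a p.2) : ℂ) ^ 2 *
      (starRingEnd ℂ) (g (horizonMap (-a) 0 R p)) * h (horizonMap (-a) 0 R p)) * hph p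
  · have hp' : ¬ 0 < (horizonMap (-a) 0 R p).1 := by
      simp only [horizonMap, Pi.zero_apply, add_zero, not_lt]
      exact mul_nonpos_of_nonneg_of_nonpos (Real.exp_pos _).le (not_lt.1 hp)
    simp only
    rw [Set.indicator_of_notMem (by exact hp), Set.indicator_of_notMem (by exact hp'), smul_zero]

theorem twoPointC_actSc (h : SG) (ψ φ : Sc) :
    twoPointC (actSc h ψ) (actSc h φ) = twoPointC ψ φ := by
  obtain ⟨a, b, R, -, ha, hb, hF⟩ := exists_params h⁻¹
  have h1 (χ : Sc) : IsGoodFourier (actSc h χ) (hatHorizonMap a b R (hat χ)) := by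
    have : (actSc h χ : Scri → ℝ) = (χ : Scri → ℝ) ∘ horizonMap a b R := by rw [← hF]; rfl
    rw [this]
    exact (hat_spec χ).comp_horizonMap ha hb R
  rw [twoPointC_eq _ _ (h1 ψ) (h1 φ), energyForm_hatHorizonMap ha,
    twoPointC_eq _ _ (hat_spec ψ) (hat_spec φ)]

theorem alpha_field (h : SG) (ψ : Sc) : alpha h (field ψ) = field (actSc h ψ) := actHom_field h ψ

theorem alpha_word (h : SG) (l : List Sc) : alpha h (word l) = word (l.map (actSc h)) := by
  rw [word, word, map_list_prod, List.map_map, List.map_map]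
  congr 2
  funext ψ
  exact alpha_field h ψ

theorem wickList_map {S T : Type*} (W : T → T → ℂ) (f : S → T) (l : List S) :
    wickList W (l.map f) = wickList (fun ψ φ => W (f ψ) (f φ)) l := by
  rw [← List.ofFn_get l, List.map_ofFn, wickList_ofFn, wickList_ofFn]
  rfl

theorem omegaC_alpha (h : SG) (x : Ac) : omegaC (alpha h x) = omegaC x := by
  obtain ⟨s, c, rfl⟩ := exists_sum_word x
  simp only [map_sum, map_smul, alpha_word]
  refine Finset.sum_congr rfl fun l _ => ?_
  rw [omegaC_spec.1.apply_word, omegaC_spec.1.apply_word, wickList_map]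
  have h2 := omegaC_spec.2
  simp only [h2 _ _, twoPointC_actSc]

/-! ## Translations -/

/-- For `a = 0` a horizon map shifts `u` by an amount depending on `s` only, so it commutes with the
`u`-translations. -/
theorem frameTranslation_eq {B : SG} (hB : IsBondiFrame B) (t : ℝ) :
    frameTranslation B t = uTranslation t := by
  obtain ⟨b, R, -, -, hF⟩ := hB
  rw [frameTranslation, mul_assoc, inv_mul_eq_iff_eq_mul]
  refine Subtype.ext (Equiv.ext fun p => ?_)
  change (uTranslation t : Equiv.Perm Scri) ((B : Equiv.Perm Scri) p) =
    (B : Equiv.Perm Scri) ((uTranslation t : Equiv.Perm Scri) p)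
  rw [hF]
  refine Prod.ext ?_ rfl
  change (Real.exp 0 * p.1 + b p.2) + t = Real.exp 0 * (p.1 + t) + b p.2
  simp; ring

theorem uTranslation_zero : uTranslation 0 = 1 :=
  Subtype.ext (Equiv.ext fun p => Prod.ext (add_zero p.1) rfl)

theorem uTranslation_add (s t : ℝ) : uTranslation (s + t) = uTranslation s * uTranslation t := by
  refine Subtype.ext (Equiv.ext fun p => Prod.ext ?_ rfl)
  change p.1 + (s + t) = p.1 + t + s
  ring

/-- The action is by `ψ(u - t, s)`, whence `b = -t` and the phase is `e^{+ikt}`: positive `k` is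
positive energy. -/
theorem IsGoodFourier.translate {φ : Sc} {g : Scri → ℂ} (hg : IsGoodFourier φ g) (t : ℝ) :
    IsGoodFourier (actSc (uTranslation t) φ) fun p => cexp (I * p.1 * t) * g p := by
  have h1 := hg.comp_horizonMap (a := 0) (b := fun _ => -t) contMDiff_const contMDiff_const 1
  have e1 : (actSc (uTranslation t) φ : Scri → ℝ) = (φ : Scri → ℝ) ∘ horizonMap 0 (fun _ => -t) 1 := by
    funext p
    refine congrArg (φ : Scri → ℝ) (Prod.ext ?_ rfl)
    change p.1 + -t = Real.exp 0 * p.1 + -t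
    simp
  have e2 : hatHorizonMap 0 (fun _ => -t) 1 g = fun p => cexp (I * p.1 * t) * g p := by
    funext p
    have : horizonMap 0 0 1 p = p := by
      refine Prod.ext ?_ rfl
      simp [horizonMap]
    simp [hatHorizonMap, this]
  rwa [e1, ← e2]

theorem twoPointC_translate (ψ φ : Sc) (t : ℝ) : twoPointC ψ (actSc (uTranslation t) φ) =
    ∫ p, 2 * (p.1 : ℂ) * (starRingEnd ℂ) (hat ψ p) * hat φ p * cexp (I * p.1 * t) ∂posMeasure := by
  rw [twoPointC_eq _ _ (hat_spec ψ) ((hat_spec φ).translate t)]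
  refine integral_congr_ae (.of_forall fun p => ?_)
  simp only
  ring

/-- A Fourier integral over positive frequencies is the boundary value of a bounded holomorphic
function. -/
theorem isHardy_integral_exp {X : Type*} [MeasurableSpace X] {μ : Measure X} {m : X → ℂ} {κ : X → ℝ}
    (hm : Integrable m μ) (hκ : Measurable κ) (hpos : ∀ᵐ p ∂μ, 0 ≤ κ p) :
    IsHardy fun t => ∫ p, m p * cexp (I * κ p * t) ∂μ := by
  have hmeas (z : ℂ) : AEStronglyMeasurable (fun p => m p * cexp (I * κ p * z)) μ :=
    hm.1.mul (Measurable.aestronglyMeasurable (by fun_prop))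
  have hnorm (p : X) (z : ℂ) : ‖cexp (I * κ p * z)‖ = Real.exp (-(κ p * z.im)) := by
    rw [Complex.norm_exp]; simp
  have hle (z : ℂ) (hz : 0 ≤ z.im) : ∀ᵐ p ∂μ, ‖m p * cexp (I * κ p * z)‖ ≤ ‖m p‖ := by
    filter_upwards [hpos] with p hp
    rw [norm_mul, hnorm]
    refine mul_le_of_le_one_right (norm_nonneg _) (Real.exp_le_one_iff.2 ?_)
    have := mul_nonneg hp hz
    linarith
  refine ⟨fun z => ∫ p, m p * cexp (I * κ p * z) ∂μ, ⟨fun z hz => ?_, ?_⟩, ⟨∫ p, ‖m p‖ ∂μ, fun z hz => ?_⟩,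
    fun t => rfl⟩
  · have hz : 0 < z.im := hz
    -- On this neighbourhood `κ e^{-κ Im w} ≤ 2 / Im z`, by `x + 1 ≤ e^x`; this dominates the
    -- differentiated integrand although `κ` is unbounded.
    have hs : {w : ℂ | z.im / 2 < w.im} ∈ 𝓝 z :=
      (isOpen_lt continuous_const Complex.continuous_im).mem_nhds (by
        change z.im / 2 < z.im; linarith)
    have := hasDerivAt_integral_of_dominated_loc_of_deriv_le (𝕜 := ℂ) (μ := μ)
      (F := fun (z : ℂ) p => m p * cexp (I * κ p * z))
      (F' := fun (z : ℂ) p => m p * (cexp (I * κ p * z) * (I * κ p)))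
      (bound := fun p => ‖m p‖ * (2 / z.im)) hs (.of_forall hmeas)
      (hm.mono (hmeas z) (hle z hz.le))
      (hm.1.mul (Measurable.aestronglyMeasurable (by fun_prop))) ?_ (hm.norm.mul_const _) ?_
    · exact this.2.differentiableAt.differentiableWithinAt
    · filter_upwards [hpos] with p hp w hw
      have hw : z.im / 2 < w.im := hw
      rw [norm_mul, norm_mul, hnorm]
      refine mul_le_mul_of_nonneg_left ?_ (norm_nonneg _)
      have h1 : ‖I * (κ p : ℂ)‖ = κ p := by simp [abs_of_nonneg hp]
      rw [h1, Real.exp_neg, inv_mul_le_iff₀ (Real.exp_pos _)]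
      have h2 := Real.add_one_le_exp (κ p * w.im)
      have h3 : κ p * (z.im / 2) ≤ κ p * w.im := mul_le_mul_of_nonneg_left hw.le hp
      calc κ p = κ p * (z.im / 2) * (2 / z.im) := by field_simp
        _ ≤ Real.exp (κ p * w.im) * (2 / z.im) := by
          gcongr; linarith
    · refine .of_forall fun p w _ => ?_
      have h0 : HasDerivAt (fun w : ℂ => I * κ p * w) (I * κ p) w := by
        simpa using (hasDerivAt_id w).const_mul (I * (κ p : ℂ))
      exact h0.cexp.const_mul (m p)
  · rw [closure_upper]
    exact continuousOn_of_dominated (bound := fun p => ‖m p‖) (fun z _ => hmeas z) (fun z hz => hle z hz)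
      hm.norm (.of_forall fun p => by fun_prop)
  · refine (norm_integral_le_integral_norm _).trans ?_
    exact integral_mono_ae (hm.mono (hmeas z) (hle z hz)).norm hm.norm (hle z hz)

theorem isHardy_twoPointC (ψ φ : Sc) : IsHardy fun t => twoPointC ψ (actSc (uTranslation t) φ) := by
  simp only [twoPointC_translate]
  exact isHardy_integral_exp ((hat_spec ψ).integrable_mul (hat_spec φ)).restrict measurable_fst
    (ae_posMeasure_pos.mono fun p hp => hp.le)

/-- Decay of correlations (Riemann–Lebesgue). -/
theorem tendsto_twoPointC (ψ φ : Sc) :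
    Tendsto (fun t => twoPointC ψ (actSc (uTranslation t) φ)) atTop (𝓝 0) := by
  let M (k : ℝ) : ℂ := ∫ s, 2 * (k : ℂ) * (starRingEnd ℂ) (hat ψ (k, s)) * hat φ (k, s)
    ∂(volume : Measure E3).toSphere
  have h1 := Real.tendsto_integral_exp_smul_cocompact ((Set.Ioi (0 : ℝ)).indicator M)
  -- Mathlib's kernel is `e^{-2πi k v}`; at `v = -t/(2π)` it is `e^{ikt}`. The sphere variable is
  -- already integrated out in `M`.
  have h2 : Tendsto (fun t : ℝ => -(2 * Real.pi)⁻¹ * t) atTop (cocompact ℝ) := by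
    refine Tendsto.mono_right ?_ atBot_le_cocompact
    exact tendsto_id.const_mul_atTop_of_neg (by simp; positivity)
  refine (h1.comp h2).congr fun t => ?_
  have hi : Integrable (fun p : Scri => 2 * (p.1 : ℂ) * (starRingEnd ℂ) (hat ψ p) * hat φ p *
      cexp (I * p.1 * t)) posMeasure := by
    refine (((hat_spec ψ).integrable_mul (hat_spec φ)).restrict).mul_bdd (c := 1)
      (Continuous.aestronglyMeasurable (by fun_prop)) (.of_forall fun p => ?_)
    rw [Complex.norm_exp]; simp
  rw [twoPointC_translate, posMeasure_eq, integral_prod _ (by rwa [← posMeasure_eq]),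
    ← integral_indicator measurableSet_Ioi]
  refine integral_congr_ae (.of_forall fun k => ?_)
  simp only
  by_cases hk : k ∈ Set.Ioi (0 : ℝ)
  · rw [Set.indicator_of_mem hk, Set.indicator_of_mem hk, integral_mul_const,
      Circle.smul_def, Real.fourierChar_apply, smul_eq_mul, mul_comm]
    congr 2
    have : (Real.pi : ℂ) ≠ 0 := by exact_mod_cast Real.pi_ne_zero
    push_cast
    field_simp
  · rw [Set.indicator_of_notMem hk, Set.indicator_of_notMem hk, smul_zero]

/-! ## Invariant vectors and decay of matrix elements -/

section Decay
variable {H : Type*} [NormedAddCommGroup H] [InnerProductSpace ℂ H]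

/-- A weakly continuous family of unitaries is strongly continuous. -/
theorem continuous_apply_of_inner {U : ℝ → H ≃ₗᵢ[ℂ] H}
    (h : ∀ x y, Continuous fun t => ⟪x, U t y⟫_ℂ) (x : H) : Continuous fun t => U t x := by
  refine continuous_iff_continuousAt.2 fun s => ?_
  have h1 : Tendsto (fun t => 2 * ‖x‖ ^ 2 - 2 * (⟪U s x, U t x⟫_ℂ).re) (𝓝 s) (𝓝 0) := by
    have h2 := ((Complex.continuous_re.comp (h (U s x) x)).tendsto s).const_mul 2 |>.const_sub
      (2 * ‖x‖ ^ 2)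
    refine h2.trans (le_of_eq ?_)
    congr 1
    have : (⟪U s x, U s x⟫_ℂ).re = ‖U s x‖ ^ 2 := inner_self_eq_norm_sq (𝕜 := ℂ) (U s x)
    rw [Function.comp_apply, this, LinearIsometryEquiv.norm_map, sub_self]
  refine tendsto_iff_norm_sub_tendsto_zero.2 ?_
  have h3 := (Real.continuous_sqrt.tendsto 0).comp h1
  rw [Real.sqrt_zero] at h3
  refine h3.congr fun t => ?_
  have h4 : ‖U t x - U s x‖ ^ 2 = 2 * ‖x‖ ^ 2 - 2 * (⟪U s x, U t x⟫_ℂ).re := by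
    have h5 := norm_sub_sq (𝕜 := ℂ) (U s x) (U t x)
    rw [LinearIsometryEquiv.norm_map, LinearIsometryEquiv.norm_map] at h5
    rw [norm_sub_rev, h5]
    change _ - 2 * (⟪U s x, U t x⟫_ℂ).re + _ = _
    ring
  rw [Function.comp_apply, ← h4, Real.sqrt_sq (norm_nonneg _)]

namespace IsUnitaryGroup
variable {U : ℝ → H ≃ₗᵢ[ℂ] H} (hU : IsUnitaryGroup U)

/-- If the matrix elements with the vectors of a total set decay, then there is no invariant vector. -/
theorem eq_zero_of_decay {S : Set H}
    (hS : ∀ x ∈ S, ∀ y ∈ S, Tendsto (fun t => ⟪x, U t y⟫_ℂ) atTop (𝓝 0)) {z : H}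
    (hz : z ∈ (Submodule.span ℂ S).topologicalClosure) (hinv : ∀ t, U t z = z) : z = 0 := by
  have h1 (x : H) (hx : x ∈ S) (y : H) (hy : y ∈ Submodule.span ℂ S) :
      Tendsto (fun t => ⟪x, U t y⟫_ℂ) atTop (𝓝 0) := by
    induction hy using Submodule.span_induction with
    | mem y hy => exact hS x hx y hy
    | zero => simp
    | add y y' _ _ h h' => simpa [inner_add_right] using h.add h'
    | smul c y _ h => simpa [inner_smul_right] using h.const_mul c
  have h2 (x : H) (hx : x ∈ S) : ⟪x, z⟫_ℂ = 0 := by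
    refine norm_le_zero_iff.1 (le_of_forall_pos_le_add fun ε hε => ?_)
    -- Approximate `z` by `y` in the span. Since `z = U t z` for all `t`, `⟪x, z⟫` differs from the
    -- decaying `⟪x, U t y⟫` by at most `ε`.
    obtain ⟨y, hy, hyz⟩ := Metric.mem_closure_iff.1 hz (ε / (‖x‖ + 1)) (by positivity)
    have h3 : ∀ t, ‖⟪x, z⟫_ℂ‖ ≤ ‖⟪x, U t y⟫_ℂ‖ + ε := fun t => by
      have h4 : ⟪x, z⟫_ℂ = ⟪x, U t y⟫_ℂ + ⟪x, U t (z - y)⟫_ℂ := by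
        rw [← inner_add_right, ← _root_.map_add, add_sub_cancel, hinv]
      rw [h4]
      refine (norm_add_le _ _).trans (add_le_add le_rfl ?_)
      refine (norm_inner_le_norm _ _).trans ?_
      rw [LinearIsometryEquiv.norm_map, ← dist_eq_norm]
      calc ‖x‖ * dist z y ≤ (‖x‖ + 1) * (ε / (‖x‖ + 1)) := by gcongr; linarith
        _ = ε := by field_simp
    have h5 := ((h1 x hx y hy).norm).add_const ε
    rw [norm_zero] at h5
    exact ge_of_tendsto' h5 h3
  have h6 : z ∈ (Submodule.span ℂ S)ᗮ := by
    refine (Submodule.mem_orthogonal _ _).2 fun u hu => ?_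
    induction hu using Submodule.span_induction with
    | mem y hy => exact h2 y hy
    | zero => simp
    | add y y' _ _ h h' => rw [inner_add_left, h, h', add_zero]
    | smul c y _ h => rw [inner_smul_left, h, mul_zero]
  rw [← Submodule.orthogonal_closure] at h6
  exact inner_self_eq_zero.1 (Submodule.inner_right_of_mem_orthogonal hz h6)

include hU in
/-- If a closed invariant subspace contains no invariant vector, then convergent matrix elements
decay. -/
theorem tendsto_zero_of_tendsto [CompleteSpace H] {S : Set H} (hSU : ∀ t, ∀ y ∈ S, U t y ∈ S)
    (hinv : ∀ z ∈ (Submodule.span ℂ S).topologicalClosure, (∀ t, U t z = z) → z = 0) {x : H}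
    (hx : ∀ y ∈ S, ∃ c, Tendsto (fun t => ⟪x, U t y⟫_ℂ) atTop (𝓝 c)) {y : H} (hy : y ∈ S) :
    Tendsto (fun t => ⟪x, U t y⟫_ℂ) atTop (𝓝 0) := by
  -- Convergence is assumed only on `S`. Limits along an ultrafilter exist for all vectors and give
  -- a bounded linear functional on `H`.
  let F : Ultrafilter ℝ := Ultrafilter.of atTop
  have hF : (F : Filter ℝ) ≤ atTop := Ultrafilter.of_le _
  have hb (t : ℝ) (y : H) : ‖⟪x, U t y⟫_ℂ‖ ≤ ‖x‖ * ‖y‖ := by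
    have := norm_inner_le_norm (𝕜 := ℂ) x (U t y)
    rwa [LinearIsometryEquiv.norm_map] at this
  have hlim (y : H) : ∃ c, Tendsto (fun t => ⟪x, U t y⟫_ℂ) F (𝓝 c) := by
    obtain ⟨c, -, hc⟩ := (isCompact_closedBall (0 : ℂ) (‖x‖ * ‖y‖)).ultrafilter_le_nhds
      (F.map fun t => ⟪x, U t y⟫_ℂ) (by
        rw [le_principal_iff]
        exact Filter.mem_map.2 (Filter.univ_mem' fun t => by simpa using hb t y))
    exact ⟨c, hc⟩
  choose l hl using hlim
  let L : H →ₗ[ℂ] ℂ :=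
    { toFun := l
      map_add' := fun y y' => tendsto_nhds_unique (hl (y + y')) (by
        simpa [inner_add_right] using (hl y).add (hl y'))
      map_smul' := fun c y => tendsto_nhds_unique (hl (c • y)) (by
        simpa [inner_smul_right] using (hl y).const_mul c) }
  let L' : H →L[ℂ] ℂ := L.mkContinuous ‖x‖ fun y =>
    le_of_tendsto (hl y).norm (.of_forall fun t => hb t y)
  have hL (y : H) : L' y = l y := rfl
  -- On `S` the limit is a true limit at infinity, so it ignores shifts of `t`; for a mere
  -- ultrafilter limit this could fail.
  have hS1 (s : ℝ) (y : H) (hy : y ∈ S) : l (U s y) = l y := by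
    obtain ⟨c, hc⟩ := hx y hy
    have h1 := tendsto_nhds_unique (hl y) (hc.mono_left hF)
    have h2 : Tendsto (fun t => ⟪x, U t (U s y)⟫_ℂ) atTop (𝓝 c) := by
      simp only [← hU.add_apply]
      exact hc.comp (tendsto_atTop_add_const_right _ s tendsto_id)
    rw [h1, tendsto_nhds_unique (hl (U s y)) (h2.mono_left hF)]
  set K := (Submodule.span ℂ S).topologicalClosure with hK
  have hKind {p : H → Prop} (h0 : ∀ y ∈ Submodule.span ℂ S, p y) (hc : IsClosed {y | p y}) :
      ∀ y ∈ K, p y := fun y hy => (hc.closure_subset_iff.2 h0) hy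
  have hUK (s : ℝ) : ∀ y ∈ K, U s y ∈ K := by
    refine hKind (fun y hy => ?_)
      ((Submodule.isClosed_topologicalClosure _).preimage (U s).continuous)
    refine Submodule.le_topologicalClosure _ ?_
    induction hy using Submodule.span_induction with
    | mem y hy => exact Submodule.subset_span (hSU s y hy)
    | zero => simp
    | add y y' _ _ h h' => rw [_root_.map_add]; exact add_mem h h'
    | smul c y _ h => rw [map_smul]; exact Submodule.smul_mem _ _ h
  have hLK (s : ℝ) : ∀ y ∈ K, L' (U s y) = L' y := by
    refine hKind (fun y hy => ?_) (isClosed_eq (L'.continuous.comp (U s).continuous) L'.continuous)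
    induction hy using Submodule.span_induction with
    | mem y hy => exact hS1 s y hy
    | zero => simp
    | add y y' _ _ h h' => rw [_root_.map_add, _root_.map_add, _root_.map_add, h, h']
    | smul c y _ h => rw [map_smul, map_smul, map_smul, h]
  have : CompleteSpace K := (Submodule.isClosed_topologicalClosure _).completeSpace_coe
  -- The Riesz representative of an invariant functional on the invariant subspace `K` is an
  -- invariant vector, hence zero.
  obtain ⟨z, hz⟩ : ∃ z ∈ K, ∀ y ∈ K, L' y = ⟪z, y⟫_ℂ := by
    refine ⟨(InnerProductSpace.toDual ℂ K).symm (L'.comp K.subtypeL), Subtype.mem _, fun y hy => ?_⟩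
    exact (InnerProductSpace.toDual_symm_apply (x := (⟨y, hy⟩ : K)) (y := L'.comp K.subtypeL)).symm
  have hz0 : z = 0 := hinv z hz.1 fun t => by
    have h1 : ∀ y ∈ K, ⟪U t z - z, y⟫_ℂ = 0 := fun y hy => by
      have h2 : ⟪U t z, y⟫_ℂ = ⟪z, U (-t) y⟫_ℂ := by rw [hU.inner_apply_right, neg_neg]
      rw [inner_sub_left, h2, ← hz.2 _ (hUK _ _ hy), ← hz.2 _ hy, hLK _ _ hy, sub_self]
    exact sub_eq_zero.1 (inner_self_eq_zero.1 (h1 _ (sub_mem (hUK t z hz.1) hz.1)))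
  have hyK : y ∈ K := Submodule.le_topologicalClosure _ (Submodule.subset_span hy)
  obtain ⟨c, hc⟩ := hx y hy
  have h1 := tendsto_nhds_unique (hl y) (hc.mono_left hF)
  have h2 := hz.2 y hyK
  rw [hz0, inner_zero_left, hL, h1] at h2
  rwa [h2] at hc

end IsUnitaryGroup
end Decay

/-! ## The translations of a Bondi frame -/

/-- Each factor takes its arguments in the order of the list, so only ordered pairs must be Hardy;
the opposite order is not required. -/
theorem isHardy_wickList {S T : Type*} {W : T → T → ℂ} {f : ℝ → S → T} {l : List S}
    (h : l.Pairwise fun x y => IsHardy fun t => W (f t x) (f t y)) :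
    IsHardy fun t => wickList W (l.map (f t)) := by
  simp only [wickList_map]
  refine IsHardy.sum _ fun τ _ => IsHardy.prod _ fun i hi => ?_
  exact List.pairwise_iff_get.1 h i (τ i) (Finset.mem_filter.1 hi).2

variable {w : Ac →ₗ[ℂ] ℂ}

theorem oneParticle_eq (Q : GNSQuadruple w) : oneParticle Q =
    (Submodule.span ℂ (Set.range fun ψ : Sc => Q.vec (field ψ))).topologicalClosure := by
  simp only [oneParticle, GNSQuadruple.vec_apply]

/-- The sum type tags which entries are translated. Pairs within one word give constants, by
invariance; mixed pairs have the translated entry on the right and are Hardy. -/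
theorem isHardy_omegaC_word (l l' : List Sc) :
    IsHardy fun t => omegaC (star (word l) * alpha (uTranslation t) (word l')) := by
  have e (t : ℝ) : omegaC (star (word l) * alpha (uTranslation t) (word l')) =
      wickList twoPointC ((l.reverse.map Sum.inl ++ l'.map Sum.inr).map
        (Sum.elim id (actSc (uTranslation t)))) := by
    have h2 := omegaC_spec.2
    rw [star_word, alpha_word, ← word_append, omegaC_spec.1.apply_word]
    simp only [h2 _ _, List.map_append, List.map_map, Sum.elim_comp_inl, Sum.elim_comp_inr,
      List.map_id]
  simp only [e]
  refine isHardy_wickList ?_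
  rw [List.pairwise_append, List.pairwise_map, List.pairwise_map]
  refine ⟨List.pairwise_of_forall fun x y => ?_,
    List.pairwise_of_forall fun x y => ?_, fun x hx y hy => ?_⟩
  · simp only [Sum.elim_inl]
    exact IsHardy.const _
  · simp only [Sum.elim_inr, twoPointC_actSc]
    exact IsHardy.const _
  · obtain ⟨ψ, -, rfl⟩ := List.mem_map.1 hx
    obtain ⟨φ, -, rfl⟩ := List.mem_map.1 hy
    exact isHardy_twoPointC ψ φ

theorem isHardy_inner_vec (Q : GNSQuadruple omegaC) {U : ℝ → Q.H ≃ₗᵢ[ℂ] Q.H}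
    (hU : ∀ t a, U t (Q.vec a) = Q.vec (alpha (uTranslation t) a)) (x y : Q.H) :
    IsHardy fun t => ⟪x, U t y⟫_ℂ := by
  refine IsUnitaryGroup.isHardy_of_dense (S := Set.range Q.vec) Q.denseRange_vec ?_ x y
  rintro _ ⟨a, rfl⟩ _ ⟨b, rfl⟩
  obtain ⟨s, c, rfl⟩ := exists_sum_word a
  obtain ⟨s', c', rfl⟩ := exists_sum_word b
  have e (t : ℝ) : ⟪Q.vec (∑ l ∈ s, c l • word l), U t (Q.vec (∑ l ∈ s', c' l • word l))⟫_ℂ =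
      ∑ l ∈ s, ∑ l' ∈ s', (starRingEnd ℂ) (c l) * (c' l' *
        omegaC (star (word l) * alpha (uTranslation t) (word l'))) := by
    simp only [map_sum, map_smul, sum_inner, inner_sum, inner_smul_left, inner_smul_right, hU,
      Q.inner_vec, Finset.mul_sum]
    rw [Finset.sum_comm]
    exact Finset.sum_congr rfl fun l _ => Finset.sum_congr rfl fun l' _ => by ring
  simp only [e]
  exact IsHardy.sum _ fun l _ => IsHardy.sum _ fun l' _ =>
    (IsHardy.const _).mul ((IsHardy.const _).mul (isHardy_omegaC_word l l'))

theorem inner_vec_field (Q : GNSQuadruple w) (ψ φ : Sc) :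
    ⟪Q.vec (field ψ), Q.vec (field φ)⟫_ℂ = w (field ψ * field φ) := by
  rw [Q.inner_vec, star_field]

/-- The Hardy property of the matrix elements yields strong continuity and positivity together;
decay of the two-point function excludes invariant one-particle vectors. -/
theorem exists_positiveEnergy (Q : GNSQuadruple omegaC) : ∃ U : ℝ → Q.H ≃ₗᵢ[ℂ] Q.H,
    Q.PositiveEnergy (fun t => alpha (uTranslation t)) U ∧ NoZeroEigenvalue Q U := by
  obtain ⟨V, hV⟩ := Q.exists_representation alpha omegaC_alpha
  have hH := isHardy_inner_vec Q (U := fun t => V (uTranslation t)) fun t a => hV _ a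
  have hU : IsUnitaryGroup fun t => V (uTranslation t) :=
    ⟨by rw [uTranslation_zero, map_one], fun s t => by rw [uTranslation_add, map_mul],
      continuous_apply_of_inner fun x y => (hH x y).continuous⟩
  refine ⟨fun t => V (uTranslation t), ⟨fun t => Q.implements_of_apply_vec (hV _), hU.map_zero,
    hU.map_add, hU.continuous, fun x y h => hU.nonneg_of_isHardy hH h⟩, fun x hx h => ?_⟩
  rw [oneParticle_eq] at hx
  refine IsUnitaryGroup.eq_zero_of_decay ?_ hx (hU.eq_self_of_hasDerivAt_zero ?_)
  · rintro _ ⟨ψ, rfl⟩ _ ⟨φ, rfl⟩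
    have h2 := omegaC_spec.2
    simp only [hV, alpha_field, inner_vec_field, h2 _ _]
    exact tendsto_twoPointC ψ φ
  · rw [GNSQuadruple.GeneratorApplies, smul_zero] at h
    exact h

theorem apply_commutator {A : Type*} [Ring A] [Algebra ℂ A] {w : A →ₗ[ℂ] ℂ} (hw : w 1 = 1) {a b : A}
    {z : ℂ} (h : a * b - b * a = algebraMap ℂ A z) : w (a * b) - w (b * a) = z := by
  rw [← map_sub, h, Algebra.algebraMap_eq_smul_one, map_smul, hw, smul_eq_mul, mul_one]

/-- Exchanging two fields conjugates the two-point function and changes it by `iσ`, so different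
states can differ only in the real part. -/
theorem IsState.im_field_mul_field (hw : IsState w) (ψ φ : Sc) :
    (w (field ψ * field φ)).im = sigmaC ψ φ / 2 := by
  have h1 := hw.conj_symm (field ψ) (field φ)
  have h2 := apply_commutator (A := Ac) hw.normalized (field_ccr ψ φ)
  rw [star_field, star_field] at h1
  have h3 := congrArg Complex.im h2
  have h4 := congrArg Complex.im h1
  simp at h3 h4
  linarith

theorem eq_omegaC_of_positiveEnergy (hw : IsQuasiFree w) (Q : GNSQuadruple w)
    {U : ℝ → Q.H ≃ₗᵢ[ℂ] Q.H} (hP : Q.PositiveEnergy (fun t => alpha (uTranslation t)) U)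
    (hN : NoZeroEigenvalue Q U) : w = omegaC := by
  have hU : IsUnitaryGroup U := ⟨hP.map_zero, hP.map_add, hP.strongly_continuous⟩
  have hUv (t : ℝ) (φ : Sc) : U t (Q.vec (field φ)) = Q.vec (field (actSc (uTranslation t) φ)) := by
    rw [(hP.implements t).apply_vec, alpha_field]
  -- The two functions of `t` are Hardy with the same imaginary part, so their difference keeps its
  -- value at `t = 0`.
  have hc (ψ φ : Sc) (t : ℝ) : ⟪Q.vec (field ψ), U t (Q.vec (field φ))⟫_ℂ =
      twoPointC ψ (actSc (uTranslation t) φ) + (w (field ψ * field φ) - twoPointC ψ φ) := by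
    have h1 := ((hU.isHardy_of_nonneg hP.generator_nonneg (Q.vec (field ψ))
      (Q.vec (field φ))).sub (isHardy_twoPointC ψ φ)).eq_of_real (fun t => by
        rw [hUv, inner_vec_field, Complex.sub_im, hw.isState.im_field_mul_field, im_twoPointC,
          sub_self]) t 0
    have h2 := hU.zero_apply (Q.vec (field φ))
    rw [h2, inner_vec_field, uTranslation_zero, actSc_one] at h1
    rw [← h1]
    ring
  have hlim (ψ φ : Sc) : Tendsto (fun t => ⟪Q.vec (field ψ), U t (Q.vec (field φ))⟫_ℂ) atTop
      (𝓝 (w (field ψ * field φ) - twoPointC ψ φ)) := by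
    simp only [hc]
    simpa using (tendsto_twoPointC ψ φ).add_const (w (field ψ * field φ) - twoPointC ψ φ)
  refine hw.ext omegaC_spec.1 fun ψ φ => ?_
  -- Convergence comes from `hlim`, and an invariant one-particle vector would be a zero
  -- eigenvector, so the limit is `0`. It is also the difference of the two-point functions.
  have h0 : Tendsto (fun t => ⟪Q.vec (field ψ), U t (Q.vec (field φ))⟫_ℂ) atTop (𝓝 0) := by
    refine hU.tendsto_zero_of_tendsto (S := Set.range fun ψ : Sc => Q.vec (field ψ)) ?_ ?_ ?_ ⟨φ, rfl⟩
    · rintro t _ ⟨χ, rfl⟩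
      exact ⟨_, (hUv t χ).symm⟩
    · intro z hz hinv
      rw [← oneParticle_eq] at hz
      refine hN z hz ?_
      rw [GNSQuadruple.GeneratorApplies, smul_zero]
      simp only [hinv]
      exact hasDerivAt_const _ _
    · rintro _ ⟨χ, rfl⟩
      exact ⟨_, hlim ψ χ⟩
  have h2 := omegaC_spec.2
  rw [h2, ← sub_eq_zero]
  exact tendsto_nhds_unique (hlim ψ φ) h0

end CosmoHorizon

/-! ### Assembly of the theorem -/

theorem mainTheorem8 :
    (IsQuasiFree omegaC ∧ HasTwoPointC omegaC ∧ ∀ w, IsQuasiFree w → HasTwoPointC w → w = omegaC) ∧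
    Nonempty (GNSQuadruple omegaC) ∧
    ((∀ (h : SG) (a : Ac), omegaC (alpha h a) = omegaC a) ∧
      ∀ Q : GNSQuadruple omegaC, ∃ V : SG →* (Q.H ≃ₗᵢ[ℂ] Q.H),
        ∀ h, Q.Implements (alpha h) (V h)) ∧
    (∀ B : SG, IsBondiFrame B → ∀ Q : GNSQuadruple omegaC, ∃ U : ℝ → Q.H ≃ₗᵢ[ℂ] Q.H,
        Q.PositiveEnergy (fun t => alpha (frameTranslation B t)) U ∧ NoZeroEigenvalue Q U) ∧
    (∀ B : SG, IsBondiFrame B → ∀ w : Ac →ₗ[ℂ] ℂ, IsQuasiFree w →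
      ∀ (Q : GNSQuadruple w) (U : ℝ → Q.H ≃ₗᵢ[ℂ] Q.H),
        Q.PositiveEnergy (fun t => alpha (frameTranslation B t)) U → NoZeroEigenvalue Q U →
          w = omegaC) := by
  refine ⟨⟨omegaC_spec.1, omegaC_spec.2, fun w hw h => hw.ext omegaC_spec.1 fun ψ φ =>
    (h ψ φ).trans (omegaC_spec.2 ψ φ).symm⟩, omegaC_spec.1.isState.nonempty_gnsQuadruple,
    ⟨omegaC_alpha, fun Q => ?_⟩, fun B hB Q => ?_, fun B hB w hw Q U hP hN => ?_⟩
  · obtain ⟨V, hV⟩ := Q.exists_representation alpha omegaC_alpha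
    exact ⟨V, fun h => Q.implements_of_apply_vec (hV h)⟩
  · simp only [frameTranslation_eq hB]
    exact exists_positiveEnergy Q
  · simp only [frameTranslation_eq hB] at hP
    exact eq_omegaC_of_positiveEnergy hw Q hP hN
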